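/- **Setting.** Let $\lambda$ be Lebesgue measure on $\mathbb R$, $\mathbf N$ the space of counting measures on $\mathbb R$ (countable sums of $\mathbb N_0$-valued measures; equivalently measures $\sum_{k=1}^{m}\delta_{x_k}$, $m\in\mathbb N_0\cup\{\infty\}$) with the $\sigma$-algebra generated by $\mu\mapsto\mu(B)$, $B$ Borel. A random element of $\mathbf N$ is *proper* if it equals $\sum_{k=1}^K\delta_{Z_k}$ for random variables $Z_k\in\mathbb R$, $K\in\mathbb N_0\cup\{\infty\}$. *Dynamics.* Let $0\le a\le 1$. Correlated Brownian motions with pairwise correlation $a$ started at $(x_k)$ are a Gaussian process $(X_{k,t})$ with $\mathbb E[X_{k,t}]=x_k$, $\mathrm{Cov}[X_{k,t},X_{k,s}]=\min\{t,s\}$ and $\mathrm{Cov}[X_{k,t},X_{l,s}]=a\min\{t,s\}$ for $k\ne l$. Let $(\Omega,\mathcal F,(\eta_t)_{t\ge0},(\mathbb P_\mu)_{\mu\in\mathbf N})$ be a Markov family with state space $\mathbf N$ (each $\eta_t:\Omega\to\mathbf N$ is measurable, each $\mathbb P_\mu$ is a probability measure, $\mathbb P_\mu[\eta_0=\mu]=1$,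 $x\mapsto\mathbb P_{\sum_{k=1}^m\delta_{x_k}}[\eta_t\in A]$ is measurable on $\mathbb R^m$ for all $m\in\mathbb N_0\cup\{\infty\}$ and measurable $A$, and the Markov property holds for the natural filtration) such that each $\eta_t$ is proper and, for each $\mu=\sum_{k=1}^m\delta_{x_k}$, $m\in\mathbb N_0\cup\{\infty\}$, the law of $(\eta_t)_{t\ge0}$ under $\mathbb P_\mu$ is that of $\big(\sum_{k=1}^m\delta_{X_{k,t}}\big)_{t\ge0}$ with $(X_{k,t})_{k\le m}$ correlated Brownian motions with pairwise correlation $a$ started at $(x_k)$. Write $\mathbb E_\mu$ for expectation under $\mathbb P_\mu$. The $n$-particle semigroup is $$P^{[n]}_tf(x)=\mathbb E\big[f(\sqrt{1-a}\,B_{1,t}+\sqrt a\,B_t+x_1,\dots,\sqrt{1-a}\,B_{n,t}+\sqrt a\,B_t+x_n)\big],$$ where $B,B_1,\dots,B_n$ are independent standard Brownian motions started at $0$; for $f\in L^2(\lambda^{\otimes n})$ this is defined for $\lambda^{\otimes n}$-almost every $x$. *Multiple Wiener–Itô integral.* For $\mu=\sum_i\delta_{x_i}$ let $\mu^{(k)}=\sum\delta_{(x_{i_1},\dots,x_{i_k})}$,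 summed over pairwise different indices. For bounded measurable $f:\mathbb R^n\to\mathbb R$ with bounded support, with symmetrization $\tilde f$ (the average over all permutations of the coordinates), and locally finite $\mu$, put $$I_nf(\mu)=\sum_{k=0}^n\binom nk(-1)^{n-k}\iint\tilde f(x_1,\dots,x_n)\,\lambda^{\otimes(n-k)}(\mathrm d(x_{k+1},\dots,x_n))\,\mu^{(k)}(\mathrm d(x_1,\dots,x_k)).$$ Let $\zeta$ be a proper Poisson process with intensity measure $\lambda$, defined on some probability space, with law $\pi_\lambda$. **Theorem.** For every $n\in\mathbb N_0$, $I_n$ extends uniquely to a bounded linear operator $I_n:L^2(\lambda^{\otimes n})\to L^2(\pi_\lambda)$, and for all $t\ge0$ and $f_n\in L^2(\lambda^{\otimes n})$ one has $P^{[n]}_tf_n\in L^2(\lambda^{\otimes n})$ and, almost surely, $$\mathbb E_\zeta\big[I_nf_n(\eta_t)\big]=I_nP^{[n]}_tf_n(\zeta).$$ Here, for every choice of representative of $I_nf_n\in L^2(\pi_\lambda)$, the random variable $I_nf_n(\eta_t)$ is almost surely $\mathbb P_\zeta$-integrable, and the identity holds for every choice of representatives of $I_nf_n$ and $I_nP^{[n]}_tf_n$.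 -/

import Mathlib

open MeasureTheory ProbabilityTheory
open scoped ENNReal NNReal

namespace CorrelatedBM

/-! ### Counting measures -/

/-- The index set `{0, …, n - 1}` for `n : ℕ`, and all of `ℕ` for `n = ∞`. -/
abbrev Idx (n : ℕ∞) : Type := {k : ℕ // (k : ℕ∞) < n}

/-- The measure `∑ₖ δ_{xₖ}` (the zero measure if the family is empty). -/
noncomputable def diracSum {α : Type*} (x : α → ℝ) : Measure ℝ :=
  Measure.sum fun k => Measure.dirac (x k)

/-- A measure that takes values in `{0, 1, 2, …}` on measurable sets. -/
def NatValued (ν : Measure ℝ) : Prop :=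
  ∀ B : Set ℝ, MeasurableSet B → ∃ k : ℕ, ν B = k

/-- Countable sums of `ℕ₀`-valued measures. -/
def IsCounting (μ : Measure ℝ) : Prop :=
  ∃ ν : ℕ → Measure ℝ, (∀ i, NatValued (ν i)) ∧ μ = Measure.sum ν

/-- The space of counting measures on the real line.  As a subtype of `Measure ℝ` it carries the
smallest `σ`-algebra for which all evaluations `μ ↦ μ B`, `B` measurable, are measurable. -/
abbrev Config : Type := {μ : Measure ℝ // IsCounting μ}

theorem isCounting_diracSum {n : ℕ∞} (x : Idx n → ℝ) : IsCounting (diracSum x) := by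
  classical
  refine ⟨fun k => if h : (k : ℕ∞) < n then Measure.dirac (x ⟨k, h⟩) else 0, ?_, ?_⟩
  · intro i B hB
    by_cases h : (i : ℕ∞) < n
    · by_cases hx : x ⟨i, h⟩ ∈ B
      · exact ⟨1, by simp [h, Measure.dirac_apply' _ hB, hx]⟩
      · exact ⟨0, by simp [h, Measure.dirac_apply' _ hB, hx]⟩
    · exact ⟨0, by simp [h]⟩
  · ext B hB
    rw [diracSum, Measure.sum_apply _ hB, Measure.sum_apply _ hB]
    have h1 : ∀ k : Idx n, Measure.dirac (x k) B
        = (fun k : ℕ => (if h : (k : ℕ∞) < n then Measure.dirac (x ⟨k, h⟩) else 0 : Measure ℝ) B)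
          k.1 := by
      intro k
      simp [k.2]
    rw [tsum_congr h1]
    refine tsum_subtype_eq_of_support_subset (s := {k : ℕ | (k : ℕ∞) < n})
      (f := fun k : ℕ => (if h : (k : ℕ∞) < n then Measure.dirac (x ⟨k, h⟩) else 0 :
        Measure ℝ) B) ?_
    intro k hk
    by_contra hkn
    have hkn' : ¬ ((k : ℕ∞) < n) := hkn
    exact hk (by simp [hkn'])

/-- The map `ι_n : (x_k)_k ↦ ∑_k δ_{x_k}` from `ℝⁿ`, `n ∈ ℕ₀ ∪ {∞}`, to configurations. -/
noncomputable def iota {n : ℕ∞} (x : Idx n → ℝ) : Config := ⟨diracSum x, isCounting_diracSum x⟩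

theorem exists_atom (ν : Measure ℝ) (hν : NatValued ν) (h0 : ν Set.univ ≠ 0) :
    ∃ x, 1 ≤ ν {x} := by
  obtain ⟨x, -, hx⟩ := exists_mem_forall_mem_nhdsWithin_pos_measure h0
  refine ⟨x, ?_⟩
  have hfin : ∀ B, ν B ≠ ∞ := by
    intro B hB
    obtain ⟨k, hk⟩ := hν _ MeasurableSet.univ
    have := measure_mono (μ := ν) (Set.subset_univ B)
    rw [hB, hk] at this
    simp at this
  have hone : ∀ n : ℕ, 1 ≤ ν (Metric.closedBall x (1 / ((n : ℝ) + 1))) := by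
    intro n
    have hpos := hx (Metric.closedBall x (1 / ((n : ℝ) + 1))) (by
      rw [nhdsWithin_univ]
      exact Metric.closedBall_mem_nhds _ Nat.one_div_pos_of_nat)
    obtain ⟨k, hk⟩ := hν _ (Metric.isClosed_closedBall (x := x)
      (ε := 1 / ((n : ℝ) + 1))).measurableSet
    rw [hk] at hpos ⊢
    have : 0 < k := by exact_mod_cast hpos
    exact_mod_cast this
  have hint : (⋂ n : ℕ, Metric.closedBall x (1 / ((n : ℝ) + 1))) = {x} := by
    ext y
    simp only [Set.mem_iInter, Metric.mem_closedBall, Set.mem_singleton_iff]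
    constructor
    · intro h
      have hl := tendsto_one_div_add_atTop_nhds_zero_nat (𝕜 := ℝ)
      have := ge_of_tendsto' hl h
      exact dist_le_zero.1 this
    · rintro rfl n
      rw [dist_self]
      positivity
  have ht := tendsto_measure_iInter_atTop (μ := ν)
    (s := fun n : ℕ => Metric.closedBall x (1 / ((n : ℝ) + 1)))
    (fun n => Metric.isClosed_closedBall.measurableSet.nullMeasurableSet)
    (fun m n hmn => Metric.closedBall_subset_closedBall (Nat.one_div_le_one_div hmn))
    ⟨0, hfin _⟩
  rw [hint] at ht
  exact ge_of_tendsto' ht hone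

theorem natValued_eq_diracSum (m : ℕ) :
    ∀ ν : Measure ℝ, NatValued ν → ν Set.univ = m → ∃ x : Fin m → ℝ, ν = diracSum x := by
  induction m with
  | zero =>
    intro ν _ h
    refine ⟨Fin.elim0, ?_⟩
    have : ν = 0 := Measure.measure_univ_eq_zero.1 (by simpa using h)
    rw [this, diracSum, Measure.sum_of_isEmpty]
  | succ m ih =>
    intro ν hν h
    obtain ⟨a, ha⟩ := exists_atom ν hν (by rw [h]; simp)
    have hle : Measure.dirac a ≤ ν := by
      refine Measure.le_iff.2 fun s hs => ?_
      rw [Measure.dirac_apply' _ hs]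
      by_cases has : a ∈ s
      · simpa [has] using ha.trans (measure_mono (Set.singleton_subset_iff.2 has))
      · simp [has]
    obtain ⟨x, hx⟩ := ih (ν - Measure.dirac a) (by
      intro B hB
      obtain ⟨k, hk⟩ := hν B hB
      rw [Measure.sub_apply hB hle, hk, Measure.dirac_apply' _ hB]
      by_cases haB : a ∈ B
      · exact ⟨k - 1, by simp [haB]⟩
      · exact ⟨k, by simp [haB]⟩) (by
      rw [Measure.sub_apply MeasurableSet.univ hle, h]
      simp)
    refine ⟨Fin.cons a x, ?_⟩
    rw [← Measure.sub_add_cancel_of_le hle, hx]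
    ext B hB
    simp [diracSum, Fin.sum_univ_succ, add_comm]

theorem diracSum_comp_equiv {α β : Type*} (e : α ≃ β) (x : β → ℝ) :
    diracSum (x ∘ e) = diracSum x := by
  ext B hB
  rw [diracSum, diracSum, Measure.sum_apply _ hB, Measure.sum_apply _ hB]
  exact e.tsum_eq fun k => Measure.dirac (x k) B

theorem exists_idx_equiv (α : Type*) [Countable α] : ∃ n : ℕ∞, Nonempty (Idx n ≃ α) := by
  rcases finite_or_infinite α with h | h
  · obtain ⟨m, ⟨e⟩⟩ := Finite.exists_equiv_fin α
    refine ⟨m, ⟨Equiv.trans ⟨fun k => ⟨k.1, by exact_mod_cast k.2⟩,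
      fun k => ⟨k.1, by exact_mod_cast k.2⟩, fun _ => rfl, fun _ => rfl⟩ e.symm⟩⟩
  · obtain ⟨_⟩ := nonempty_denumerable α
    exact ⟨⊤, ⟨Equiv.trans ⟨fun k => k.1, fun k => ⟨k, ENat.natCast_lt_top k⟩,
      fun _ => rfl, fun _ => rfl⟩ (Denumerable.eqv α).symm⟩⟩

/-- Every counting measure is of the form `∑_{k=1}^n δ_{x_k}` with `n ∈ ℕ₀ ∪ {∞}`. -/
theorem exists_eq_diracSum (μ : Config) : ∃ n : ℕ∞, ∃ x : Idx n → ℝ, μ.1 = diracSum x := by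
  obtain ⟨ν, hν, hμ⟩ := μ.2
  have h : ∀ i, ∃ m : ℕ, ∃ x : Fin m → ℝ, ν i = diracSum x := by
    intro i
    obtain ⟨m, hm⟩ := hν i _ MeasurableSet.univ
    exact ⟨m, natValued_eq_diracSum m _ (hν i) hm⟩
  choose m x hx using h
  obtain ⟨n, ⟨e⟩⟩ := exists_idx_equiv (Σ i, Fin (m i))
  refine ⟨n, (fun p : Σ i, Fin (m i) => x p.1 p.2) ∘ e, ?_⟩
  rw [diracSum_comp_equiv, hμ]
  ext B hB
  rw [diracSum, Measure.sum_apply _ hB, Measure.sum_apply _ hB]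
  refine Eq.trans ?_ (ENNReal.tsum_sigma fun i j => Measure.dirac (x i j) B).symm
  refine tsum_congr fun i => ?_
  rw [hx i, diracSum, Measure.sum_apply _ hB]

/-! ### Factorial measures -/

/-- `∑ δ_{(x_{i_1}, …, x_{i_k})}`, the sum over pairwise different indices `i_1, …, i_k`. -/
noncomputable def factorialSum {α : Type*} (k : ℕ) (x : α → ℝ) : Measure (Fin k → ℝ) :=
  Measure.sum fun i : Fin k ↪ α => Measure.dirac (x ∘ i)

/-- The `k`-th factorial measure of a configuration `μ = ∑ δ_{x_i}`.  It does not depend on the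
chosen enumeration, see `factorialMeasure_iota`. -/
noncomputable def factorialMeasure (k : ℕ) (μ : Config) : Measure (Fin k → ℝ) :=
  factorialSum k (Classical.choose (Classical.choose_spec (exists_eq_diracSum μ)))

theorem diracSum_singleton {α : Type*} (x : α → ℝ) (r : ℝ) :
    diracSum x {r} = ((x ⁻¹' {r}).encard : ℝ≥0∞) := by
  let _ : MeasurableSpace α := ⊤
  rw [← Measure.count_apply (s := x ⁻¹' {r}) trivial, diracSum,
    Measure.sum_apply _ (measurableSet_singleton r), Measure.count,
    Measure.sum_apply _ (s := x ⁻¹' {r}) trivial]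
  refine tsum_congr fun k => ?_
  rw [Measure.dirac_apply' _ (measurableSet_singleton r),
    Measure.dirac_apply' _ (s := x ⁻¹' {r}) trivial]
  rfl

theorem exists_equiv_of_diracSum_eq {α β : Type*} [Countable α] [Countable β] (x : α → ℝ)
    (y : β → ℝ) (h : diracSum x = diracSum y) : ∃ e : α ≃ β, y ∘ e = x := by
  have hf : ∀ r : ℝ, Nonempty ({a // x a = r} ≃ {b // y b = r}) := by
    intro r
    have h1 : ((x ⁻¹' {r}).encard : ℝ≥0∞) = (y ⁻¹' {r}).encard := by
      rw [← diracSum_singleton, ← diracSum_singleton, h]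
    have h2 : (x ⁻¹' {r}).encard = (y ⁻¹' {r}).encard := by exact_mod_cast h1
    by_cases hfin : (x ⁻¹' {r}).Finite
    · have hfin' : (y ⁻¹' {r}).Finite := by
        rw [← Set.encard_lt_top_iff, ← h2]
        exact hfin.encard_lt_top
      have : Finite {a // x a = r} := hfin
      have : Finite {b // y b = r} := hfin'
      refine Finite.card_eq.1 ?_
      have h3 : (x ⁻¹' {r}).ncard = (y ⁻¹' {r}).ncard := by
        rw [Set.ncard_def, Set.ncard_def, h2]
      rw [← Nat.card_coe_set_eq, ← Nat.card_coe_set_eq] at h3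
      exact h3
    · have hfin' : ¬ (y ⁻¹' {r}).Finite := by
        rw [← Set.encard_lt_top_iff, ← h2, Set.encard_lt_top_iff]
        exact hfin
      have : Infinite {a // x a = r} := Set.infinite_coe_iff.2 hfin
      have : Infinite {b // y b = r} := Set.infinite_coe_iff.2 hfin'
      exact nonempty_equiv_of_countable
  let e : α ≃ β := (Equiv.sigmaFiberEquiv x).symm.trans
    ((Equiv.sigmaCongrRight fun r => (hf r).some).trans (Equiv.sigmaFiberEquiv y))
  refine ⟨e, ?_⟩
  funext a
  exact ((hf (x a)).some ⟨a, rfl⟩).2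

theorem factorialSum_comp_equiv {α β : Type*} (k : ℕ) (e : α ≃ β) (x : β → ℝ) :
    factorialSum k (x ∘ e) = factorialSum k x := by
  ext B hB
  rw [factorialSum, factorialSum, Measure.sum_apply _ hB, Measure.sum_apply _ hB]
  exact (Equiv.embeddingCongr (Equiv.refl (Fin k)) e).tsum_eq
    fun i : Fin k ↪ β => Measure.dirac (x ∘ i) B

/-- The factorial measure is given by the defining formula for every enumeration. -/
theorem factorialMeasure_iota (k : ℕ) {n : ℕ∞} (x : Idx n → ℝ) :
    factorialMeasure k (iota x) = factorialSum k x := by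
  have h := Classical.choose_spec (Classical.choose_spec (exists_eq_diracSum (iota x)))
  obtain ⟨e, he⟩ := exists_equiv_of_diracSum_eq _ _ h.symm
  rw [factorialMeasure, ← factorialSum_comp_equiv k e, he]

/-! ### The multiple Wiener-Itô integral -/

/-- Symmetrization: the average over all permutations of the coordinates. -/
noncomputable def symmetrization {n : ℕ} (f : (Fin n → ℝ) → ℝ) (x : Fin n → ℝ) : ℝ :=
  (n.factorial : ℝ)⁻¹ * ∑ s : Equiv.Perm (Fin n), f (x ∘ s)

/-- The vector `(x_1, …, x_k, y_1, …, y_{n-k})`. -/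
def joinCoords {n : ℕ} (k : ℕ) (x : Fin k → ℝ) (y : Fin (n - k) → ℝ) : Fin n → ℝ :=
  fun i => if h : i.1 < k then x ⟨i.1, h⟩ else y ⟨i.1 - k, by omega⟩

/-- The class `C_n` of bounded measurable functions with bounded support. -/
structure IsTestFunction {n : ℕ} (f : (Fin n → ℝ) → ℝ) : Prop where
  measurable : Measurable f
  bounded : ∃ C : ℝ, ∀ x, |f x| ≤ C
  bounded_support : Bornology.IsBounded (Function.support f)

theorem IsTestFunction.memLp {n : ℕ} {f : (Fin n → ℝ) → ℝ} (hf : IsTestFunction f) :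
    MemLp f 2 (volume : Measure (Fin n → ℝ)) := by
  obtain ⟨C, hC⟩ := hf.bounded
  have hm : MeasurableSet (Function.support f) := measurableSet_support hf.measurable
  have h1 : MemLp ((Function.support f).indicator fun _ => C) 2
      (volume : Measure (Fin n → ℝ)) :=
    memLp_indicator_const 2 hm C (Or.inr hf.bounded_support.measure_lt_top.ne)
  refine h1.mono hf.measurable.aestronglyMeasurable (Filter.Eventually.of_forall fun x => ?_)
  by_cases hx : x ∈ Function.support f
  · rw [Set.indicator_of_mem hx, Real.norm_eq_abs, Real.norm_eq_abs]
    exact (hC x).trans (le_abs_self C)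
  · rw [Function.notMem_support.1 hx]
    simp

/-- The explicit formula for `I_n f (μ)`, for test functions `f` and locally finite `μ`:
`∑_k (n choose k) (-1)^(n-k) ∬ f̃(x_1, …, x_n) dx_{k+1} ⋯ dx_n μ^{(k)}(d(x_1, …, x_k))`. -/
noncomputable def wienerItoFormula (n : ℕ) (f : (Fin n → ℝ) → ℝ) (μ : Config) : ℝ :=
  ∑ k ∈ Finset.range (n + 1), (n.choose k : ℝ) * (-1) ^ (n - k) *
    ∫ x : Fin k → ℝ, (∫ y : Fin (n - k) → ℝ, symmetrization f (joinCoords k x y))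
      ∂(factorialMeasure k μ)

/-- A bounded linear operator `L²(λ^{⊗n}) → L²(π)` that is given by the explicit formula on
test functions. -/
def ExtendsWienerIto (π : Measure Config) (n : ℕ)
    (I : Lp ℝ 2 (volume : Measure (Fin n → ℝ)) →L[ℝ] Lp ℝ 2 π) : Prop :=
  ∀ (f : (Fin n → ℝ) → ℝ) (hf : IsTestFunction f),
    (I (hf.memLp.toLp f) : Config → ℝ) =ᵐ[π] wienerItoFormula n f

open Classical in
/-- The multiple Wiener-Itô integral `I_n : L²(λ^{⊗n}) → L²(π)`: the extension of the explicit
formula to a bounded linear operator (and `0` for those `π` for which there is none). -/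
noncomputable def multipleWienerIto (π : Measure Config) (n : ℕ) :
    Lp ℝ 2 (volume : Measure (Fin n → ℝ)) →L[ℝ] Lp ℝ 2 π :=
  if h : ∃ I, ExtendsWienerIto π n I then Classical.choose h else 0

/-! ### Poisson processes -/

/-- The Poisson distribution with parameter `r ∈ [0, ∞]`, where `r = ∞` gives `δ_∞`. -/
noncomputable def poissonLaw (r : ℝ≥0∞) : Measure ℝ≥0∞ :=
  if r = ∞ then Measure.dirac ∞
  else (poissonMeasure r.toNNReal).map fun k : ℕ => (k : ℝ≥0∞)

/-- A random configuration is proper if it is `∑_{k=1}^K δ_{Z_k}` for random variables `Z_k` with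
values in `ℝ` and `K` with values in `ℕ₀ ∪ {∞}`. -/
def IsProper {Ω : Type*} [MeasurableSpace Ω] (ζ : Ω → Config) : Prop :=
  ∃ (K : Ω → ℕ∞) (Z : ℕ → Ω → ℝ), Measurable K ∧ (∀ k, Measurable (Z k)) ∧
    ∀ ω, (ζ ω).1 = diracSum fun k : Idx (K ω) => Z k.1 ω

/-- `ζ` is a Poisson process with intensity measure `Λ` under `P`. -/
structure IsPoissonProcess {Ω : Type*} [MeasurableSpace Ω] (ζ : Ω → Config) (Λ : Measure ℝ)
    (P : Measure Ω) : Prop where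
  measurable : Measurable ζ
  law : ∀ B : Set ℝ, MeasurableSet B → P.map (fun ω => (ζ ω).1 B) = poissonLaw (Λ B)
  indep : ∀ (m : ℕ) (B : Fin m → Set ℝ), (∀ i, MeasurableSet (B i)) →
    Pairwise (Function.onFun Disjoint B) → iIndepFun (fun i ω => (ζ ω).1 (B i)) P

/-! ### Correlated Brownian motions -/

/-- A family `(X_k)` of correlated Brownian motions with pairwise correlation `a` started at
`(x_k)`. -/
structure IsCorrelatedBM {κ Ω : Type*} [MeasurableSpace Ω] (a : ℝ) (x : κ → ℝ)
    (X : κ → ℝ≥0 → Ω → ℝ) (P : Measure Ω) : Prop where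
  measurable : ∀ k t, Measurable (X k t)
  gaussian : IsGaussianProcess (fun p : κ × ℝ≥0 => X p.1 p.2) P
  mean : ∀ k t, ∫ ω, X k t ω ∂P = x k
  cov_same : ∀ k t s, cov[X k t, X k s; P] = min (t : ℝ) s
  cov_ne : ∀ k l t s, k ≠ l → cov[X k t, X l s; P] = a * min (t : ℝ) s

/-- The `n`-particle semigroup
`P_t^{[n]} f(x) = E[f(√(1-a) B_{1,t} + √a B_t + x_1, …, √(1-a) B_{n,t} + √a B_t + x_n)]`, where
`B_t, B_{1,t}, …, B_{n,t}` (here `z.1` and the coordinates of `z.2`) are independent with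
distribution `N(0, t)`. -/
noncomputable def nParticleSemigroup (a : ℝ) (n : ℕ) (t : ℝ≥0) (f : (Fin n → ℝ) → ℝ)
    (x : Fin n → ℝ) : ℝ :=
  ∫ z : ℝ × (Fin n → ℝ), f (fun k => √(1 - a) * z.2 k + √a * z.1 + x k)
    ∂((gaussianReal 0 t).prod (Measure.pi fun _ : Fin n => gaussianReal 0 t))

/-- The natural filtration of a process at time `s`. -/
abbrev naturalFiltration {Ω : Type*} (η : ℝ≥0 → Ω → Config) (s : ℝ≥0) : MeasurableSpace Ω :=
  ⨆ u : {u : ℝ≥0 // u ≤ s}, MeasurableSpace.comap (η u.1) inferInstance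

/-- Markov families with state space `Config`.  The last field is the Markov property
`P_μ[η_{s+t} ∈ A | F_s] = P_{η_s}[η_t ∈ A]`, integrated over events of `F_s`. -/
structure IsMarkovFamily {Ω : Type*} [MeasurableSpace Ω] (η : ℝ≥0 → Ω → Config)
    (P : Config → Measure Ω) : Prop where
  measurable : ∀ t, Measurable (η t)
  prob : ∀ μ, IsProbabilityMeasure (P μ)
  start : ∀ μ, ∀ᵐ ω ∂(P μ), η 0 ω = μ
  measurable_prob : ∀ (n : ℕ∞) (t : ℝ≥0) (A : Set Config), MeasurableSet A →
    Measurable fun x : Idx n → ℝ => P (iota x) (η t ⁻¹' A)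
  markov : ∀ (μ : Config) (s t : ℝ≥0) (A : Set Config), MeasurableSet A →
    ∀ S : Set Ω, MeasurableSet[naturalFiltration η s] S →
      P μ (η (s + t) ⁻¹' A ∩ S) = ∫⁻ ω in S, P (η s ω) (η t ⁻¹' A) ∂(P μ)

/-- Unlabeled systems of correlated Brownian motions with pairwise correlation `a`: Markov families
such that every `η_t` is proper and such that, for every starting configuration
`∑_{k=1}^n δ_{x_k}`, `n ∈ ℕ₀ ∪ {∞}`, the process has the distribution of `(∑_k δ_{X_{k,t}})_t`,
where the `X_k` are correlated Brownian motions started at the `x_k`. -/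
structure IsUnlabeledCorrelatedBM {Ω : Type*} [MeasurableSpace Ω] (a : ℝ)
    (η : ℝ≥0 → Ω → Config) (P : Config → Measure Ω) : Prop where
  markovFamily : IsMarkovFamily η P
  proper : ∀ t, IsProper (η t)
  law : ∀ (n : ℕ∞) (x : Idx n → ℝ),
    ∃ (Ω' : Type) (_ : MeasurableSpace Ω') (P' : Measure Ω') (X : Idx n → ℝ≥0 → Ω' → ℝ),
      IsProbabilityMeasure P' ∧ IsCorrelatedBM a x X P' ∧
      IdentDistrib (fun ω t => η t ω) (fun ω t => iota fun k => X k t ω) (P (iota x)) P'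

end CorrelatedBM

namespace CorrelatedBM

/-! ### Sums over injective tuples and factorial measures -/

/-! The formula for `I_n` integrates marginals of the symmetrized function against the factorial
measures `μ^(k)`, and on these the dynamics is simple. Any `k` distinct labelled particles move, up
to time `t`, by the `k`-particle kernel, so the mean of `η_t^(k)` under `P_μ` is `μ^(k)` transported
by that kernel (`IsUnlabeledCorrelatedBM.map_bind_factorialKernel`). The kernel is a random
translation. Hence Lebesgue measure is invariant, and integrating out `n - k` Lebesgue coordinates
turns the `n`-particle semigroup into the `k`-particle one, although the common noise couples all
coordinates (`ae_symMarginal_nParticleSemigroup`). Comparing term by term gives the identity for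
integrable functions, between explicit formulas
(`IsUnlabeledCorrelatedBM.ae_integral_wienerItoFormula`).

The passage to `L²` rests on two facts about the Poisson law.

Boundedness: on a product of disjoint sets the formula collapses to a product of centred counts
(`wienerItoFormula_boxIndicator`). Independence of the counts gives `‖I_n f‖² ≤ n! ‖f‖²` for step
functions supported off the diagonals (`IsPoissonProcess.integral_sq_sum_prod_le`), and these are
dense because the diagonals are null sets.

Invariance: the factorial moment measures of the Poisson process are Lebesgue measures, hence so are
those of `η_t`. Such a law is unique, since the characteristic functions of its counts are
convergent series in these measures (`HasLebesgueFactorialMoments.unique`).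

Invariance and boundedness make the left side of the identity continuous from `L²` to `L¹`;
boundedness and the `L²` contractivity of the semigroup do the same for the right side. Truncation
then extends the identity from integrable to square integrable functions. -/

theorem tsum_not_mem_range_add {α : Type*} {k : ℕ} (e : Fin k ↪ α) (b : α → ℝ≥0∞) :
    ∑' a, b a = ∑' a : {a // a ∉ Set.range e}, b a + ∑ l, b (e l) := by
  have h := (ENNReal.summable (f := fun a : (Set.range e) => b a)).tsum_add_tsum_compl
    (s := Set.range e) (f := b) ENNReal.summable
  rw [← h, add_comm]
  congr 1
  rw [← tsum_fintype (L := .unconditional _), ← (Equiv.ofInjective e e.injective).tsum_eq]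
  rfl

/-- The additional index either avoids the range of `e`, and then extends it to an injective tuple
of length `k + 1`, or it equals exactly one of the `e l`. Working in `ℝ≥0∞` keeps this free of
summability conditions. -/
theorem tsum_mul_tsum_embedding {α : Type*} {k : ℕ} (b₀ : α → ℝ≥0∞) (b : Fin k → α → ℝ≥0∞) :
    (∑' a, b₀ a) * ∑' e : Fin k ↪ α, ∏ l, b l (e l) =
      (∑' e : Fin (k + 1) ↪ α, b₀ (e 0) * ∏ l : Fin k, b l (e l.succ)) +
        ∑ l, ∑' e : Fin k ↪ α, b₀ (e l) * ∏ m, b m (e m) := by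
  rw [← ENNReal.tsum_mul_left, ← (Equiv.embeddingFinSucc k α).symm.tsum_eq, ENNReal.tsum_sigma',
    ← Summable.tsum_finsetSum (fun _ _ => ENNReal.summable), ← ENNReal.tsum_add]
  refine tsum_congr fun e => ?_
  rw [tsum_not_mem_range_add e b₀, add_mul, Finset.sum_mul, ← ENNReal.tsum_mul_right]
  congr 1

theorem lintegral_factorialSum {α : Type*} {k : ℕ} (x : α → ℝ) {f : (Fin k → ℝ) → ℝ≥0∞}
    (hf : Measurable f) : ∫⁻ y, f y ∂(factorialSum k x) = ∑' e : Fin k ↪ α, f (x ∘ e) := by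
  rw [factorialSum, lintegral_sum_measure]
  exact tsum_congr fun e => lintegral_dirac' _ hf

theorem lintegral_diracSum {α : Type*} (x : α → ℝ) {f : ℝ → ℝ≥0∞}
    (hf : Measurable f) : ∫⁻ y, f y ∂(diracSum x) = ∑' a, f (x a) := by
  rw [diracSum, lintegral_sum_measure]
  exact tsum_congr fun e => lintegral_dirac' _ hf

theorem exists_eq_iota (μ : Config) : ∃ (n : ℕ∞) (x : Idx n → ℝ), μ = iota x := by
  obtain ⟨n, x, h⟩ := exists_eq_diracSum μ
  exact ⟨n, x, Subtype.ext h⟩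

theorem lintegral_mul_lintegral_factorialMeasure (μ : Config) {k : ℕ} {b₀ : ℝ → ℝ≥0∞}
    (hb₀ : Measurable b₀) {b : Fin k → ℝ → ℝ≥0∞} (hb : ∀ l, Measurable (b l)) :
    (∫⁻ x, b₀ x ∂μ.1) * ∫⁻ y, ∏ l, b l (y l) ∂(factorialMeasure k μ) =
      ∫⁻ y, b₀ (y 0) * ∏ l : Fin k, b l (y l.succ) ∂(factorialMeasure (k + 1) μ) +
        ∑ l, ∫⁻ y, b₀ (y l) * ∏ m, b m (y m) ∂(factorialMeasure k μ) := by
  obtain ⟨n, x, rfl⟩ := exists_eq_iota μ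
  simp only [factorialMeasure_iota]
  rw [show (iota x).1 = diracSum x from rfl, lintegral_diracSum x hb₀,
    lintegral_factorialSum x (by fun_prop), lintegral_factorialSum x (by fun_prop)]
  have h : ∀ l : Fin k, ∫⁻ y, b₀ (y l) * ∏ m, b m (y m) ∂(factorialSum k x)
      = ∑' e : Fin k ↪ Idx n, b₀ (x (e l)) * ∏ m, b m (x (e m)) := fun l =>
    lintegral_factorialSum x (by fun_prop)
  simp_rw [h]
  exact tsum_mul_tsum_embedding (fun a => b₀ (x a)) fun l a => b l (x a)

theorem factorialMeasure_zero (μ : Config) : factorialMeasure 0 μ = Measure.dirac Fin.elim0 := by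
  obtain ⟨n, x, rfl⟩ := exists_eq_iota μ
  rw [factorialMeasure_iota, factorialSum]
  ext B hB
  rw [Measure.sum_apply _ hB, tsum_eq_single (default : Fin 0 ↪ Idx n)]
  · congr 2
    exact Subsingleton.elim _ _
  · intro e he
    exact absurd (Subsingleton.elim _ _) he

theorem lintegral_factorialMeasure_one (μ : Config) {b : ℝ → ℝ≥0∞} (hb : Measurable b) :
    ∫⁻ y, b (y 0) ∂(factorialMeasure 1 μ) = ∫⁻ x, b x ∂μ.1 := by
  have h := lintegral_mul_lintegral_factorialMeasure μ hb (b := fun l : Fin 0 => Fin.elim0 l)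
    (fun l => Fin.elim0 l)
  simp only [Finset.univ_eq_empty, Finset.prod_empty, lintegral_const, one_mul, mul_one,
    Finset.sum_empty, add_zero] at h
  rw [← h, factorialMeasure_zero]
  simp

theorem indicator_pi_eq_prod {k : ℕ} (B : Fin k → Set ℝ) (y : Fin k → ℝ) :
    (Set.univ.pi B).indicator (1 : (Fin k → ℝ) → ℝ≥0∞) y
      = ∏ l, (B l).indicator (1 : ℝ → ℝ≥0∞) (y l) := by
  classical
  by_cases h : y ∈ Set.univ.pi B
  · rw [Set.indicator_of_mem h, Finset.prod_eq_one]
    · rfl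
    · intro l _
      rw [Set.indicator_of_mem (h l trivial)]
      rfl
  · rw [Set.indicator_of_notMem h]
    have : ∃ l, y l ∉ B l := by
      by_contra hc
      push Not at hc
      exact h fun l _ => hc l
    obtain ⟨l, hl⟩ := this
    rw [Finset.prod_eq_zero (Finset.mem_univ l)]
    rw [Set.indicator_of_notMem hl]

theorem measure_pi_eq_lintegral {k : ℕ} (M : Measure (Fin k → ℝ)) {B : Fin k → Set ℝ}
    (hB : ∀ l, MeasurableSet (B l)) :
    M (Set.univ.pi B) = ∫⁻ y, ∏ l, (B l).indicator (1 : ℝ → ℝ≥0∞) (y l) ∂M := by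
  simp_rw [← indicator_pi_eq_prod]
  rw [lintegral_indicator_one (MeasurableSet.univ_pi hB)]

/-- This recursion in `k` is the only way factorial measures of boxes are computed below: both the
measurability in `μ` and the product formula for disjoint sets follow from it by induction. -/
theorem mul_factorialMeasure_pi (μ : Config) {k : ℕ} {B₀ : Set ℝ} (hB₀ : MeasurableSet B₀)
    {B : Fin k → Set ℝ} (hB : ∀ l, MeasurableSet (B l)) :
    μ.1 B₀ * factorialMeasure k μ (Set.univ.pi B) =
      factorialMeasure (k + 1) μ (Set.univ.pi (Fin.cons B₀ B : Fin (k + 1) → Set ℝ)) +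
        ∑ l, factorialMeasure k μ (Set.univ.pi (Function.update B l (B₀ ∩ B l))) := by
  have h1 : ∀ l : Fin (k + 1), MeasurableSet ((Fin.cons B₀ B : Fin (k + 1) → Set ℝ) l) := by
    intro l
    cases l using Fin.cases with
    | zero => exact hB₀
    | succ l => exact hB l
  have h2 : ∀ l m, MeasurableSet (Function.update B l (B₀ ∩ B l) m) := by
    intro l m
    by_cases h : m = l
    · subst h
      rw [Function.update_self]
      exact hB₀.inter (hB m)
    · rw [Function.update_of_ne h]
      exact hB m
  rw [measure_pi_eq_lintegral _ hB, measure_pi_eq_lintegral _ h1, ← lintegral_indicator_one hB₀,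
    lintegral_mul_lintegral_factorialMeasure μ (measurable_one.indicator hB₀)
      (fun l => measurable_one.indicator (hB l))]
  congr 1
  · simp [Fin.prod_univ_succ]
  · refine Finset.sum_congr rfl fun l _ => ?_
    rw [measure_pi_eq_lintegral _ (h2 l)]
    refine lintegral_congr fun y => ?_
    rw [← Finset.mul_prod_erase _ _ (Finset.mem_univ l),
      ← Finset.mul_prod_erase Finset.univ (fun m => (Function.update B l (B₀ ∩ B l) m).indicator
        (1 : ℝ → ℝ≥0∞) (y m)) (Finset.mem_univ l), ← mul_assoc, Function.update_self]
    congr 1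
    · rw [Set.inter_indicator_one]
      rfl
    · refine Finset.prod_congr rfl fun m hm => ?_
      rw [Function.update_of_ne (Finset.ne_of_mem_erase hm)]

/-- Dropping the condition that the indices be different can only add tuples. -/
theorem factorialMeasure_pi_le (μ : Config) {k : ℕ} {B : Fin k → Set ℝ}
    (hB : ∀ l, MeasurableSet (B l)) :
    factorialMeasure k μ (Set.univ.pi B) ≤ ∏ l, μ.1 (B l) := by
  induction k with
  | zero =>
    rw [factorialMeasure_zero]
    simp
  | succ k ih =>
    have h := mul_factorialMeasure_pi μ (hB 0) (fun l => hB l.succ)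
    have h3 : (Fin.cons (B 0) (fun l => B (Fin.succ l)) : Fin (k + 1) → Set ℝ) = B :=
      Fin.cons_self_tail B
    rw [h3] at h
    rw [Fin.prod_univ_succ]
    calc _ ≤ μ.1 (B 0) * factorialMeasure k μ (Set.univ.pi fun l => B (Fin.succ l)) := by
          rw [h]; exact le_self_add
      _ ≤ _ := by gcongr; exact ih fun l => hB l.succ

/-! ### Locally finite configurations and measurability -/

/-- The set of locally finite configurations. -/
def locallyFiniteConfig : Set Config := {μ | ∀ m : ℕ, μ.1 (Set.Icc (-m : ℝ) m) < ∞}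

theorem measurable_config_apply {B : Set ℝ} (hB : MeasurableSet B) :
    Measurable fun μ : Config => μ.1 B :=
  (Measure.measurable_coe hB).comp measurable_subtype_coe

theorem measurableSet_locallyFiniteConfig : MeasurableSet locallyFiniteConfig := by
  have : locallyFiniteConfig = ⋂ m : ℕ, {μ : Config | μ.1 (Set.Icc (-m : ℝ) m) < ∞} := by
    ext; simp [locallyFiniteConfig]
  rw [this]
  exact MeasurableSet.iInter fun m =>
    measurable_config_apply measurableSet_Icc measurableSet_Iio

open Classical in
/-- The factorial measure on locally finite configurations, extended by zero. -/
noncomputable def factorialKernel (k : ℕ) (μ : Config) : Measure (Fin k → ℝ) :=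
  if μ ∈ locallyFiniteConfig then factorialMeasure k μ else 0

theorem factorialKernel_of_mem {k : ℕ} {μ : Config} (h : μ ∈ locallyFiniteConfig) :
    factorialKernel k μ = factorialMeasure k μ := if_pos h

theorem factorialKernel_of_notMem {k : ℕ} {μ : Config} (h : μ ∉ locallyFiniteConfig) :
    factorialKernel k μ = 0 := if_neg h

/-- The factorial measure is defined by a chosen enumeration, so measurability in `μ` has to come
from a formula without labels: the recursion, solved for the term of order `k + 1`. The subtraction
is legitimate only if the diagonal terms are finite, whence bounded boxes and locally finite
configurations. -/
theorem measurable_factorialKernel_pi {k : ℕ} (m : ℕ) {B : Fin k → Set ℝ}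
    (hB : ∀ l, MeasurableSet (B l)) (hB' : ∀ l, B l ⊆ Set.Icc (-m : ℝ) m) :
    Measurable fun μ => factorialKernel k μ (Set.univ.pi B) := by
  have key : ∀ (k : ℕ) (B : Fin k → Set ℝ), (∀ l, MeasurableSet (B l)) →
      (∀ l, B l ⊆ Set.Icc (-m : ℝ) m) →
      Measurable fun μ : locallyFiniteConfig => factorialMeasure k μ.1 (Set.univ.pi B) := by
    intro k
    induction k with
    | zero =>
      intro B _ _
      simp_rw [factorialMeasure_zero]
      exact measurable_const
    | succ k ih =>
      intro B hB hB'
      have h3 : (Fin.cons (B 0) (fun l => B (Fin.succ l)) : Fin (k + 1) → Set ℝ) = B :=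
        Fin.cons_self_tail B
      have h2 : ∀ l m, MeasurableSet (Function.update (fun l => B (Fin.succ l)) l
          (B 0 ∩ B l.succ) m) := by
        intro l m
        by_cases h : m = l
        · subst h
          rw [Function.update_self]
          exact (hB 0).inter (hB m.succ)
        · rw [Function.update_of_ne h]
          exact hB m.succ
      have h2' : ∀ l m', Function.update (fun l => B (Fin.succ l)) l
          (B 0 ∩ B l.succ) m' ⊆ Set.Icc (-m : ℝ) m := by
        intro l m
        by_cases h : m = l
        · subst h
          rw [Function.update_self]
          exact Set.inter_subset_left.trans (hB' 0)
        · rw [Function.update_of_ne h]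
          exact hB' m.succ
      have h : ∀ μ : locallyFiniteConfig, factorialMeasure (k + 1) μ.1 (Set.univ.pi B)
          = μ.1.1 (B 0) * factorialMeasure k μ.1 (Set.univ.pi fun l => B (Fin.succ l))
            - ∑ l, factorialMeasure k μ.1 (Set.univ.pi (Function.update
              (fun l => B (Fin.succ l)) l (B 0 ∩ B l.succ))) := by
        intro μ
        rw [mul_factorialMeasure_pi μ.1 (hB 0) (fun l => hB l.succ), h3]
        refine (ENNReal.add_sub_cancel_right ?_).symm
        refine (ENNReal.sum_lt_top.2 fun l _ => ?_).ne
        refine (factorialMeasure_pi_le _ (h2 l)).trans_lt (ENNReal.prod_lt_top fun j _ => ?_)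
        exact (measure_mono (h2' l j)).trans_lt (μ.2 m)
      simp_rw [h]
      refine Measurable.sub (((measurable_config_apply (hB 0)).comp measurable_subtype_coe).mul
        (ih _ (fun l => hB l.succ) fun l => hB' l.succ)) ?_
      exact Finset.measurable_sum _ fun l _ => ih _ (h2 l) (h2' l)
  classical
  refine measurable_of_restrict_of_restrict_compl measurableSet_locallyFiniteConfig ?_ ?_
  · convert key k B hB hB' using 2 with μ
    rw [Set.domRestrict_apply, factorialKernel_of_mem μ.2]
  · convert measurable_const (a := (0 : ℝ≥0∞)) using 2 with μ
    rw [Set.domRestrict_apply, factorialKernel_of_notMem μ.2]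
    rfl

/-- The cube `[-m, m]^k`. -/
def cube (k : ℕ) (m : ℕ) : Set (Fin k → ℝ) := Set.univ.pi fun _ => Set.Icc (-m : ℝ) m

theorem measurableSet_cube (k m : ℕ) : MeasurableSet (cube k m) :=
  MeasurableSet.univ_pi fun _ => measurableSet_Icc

theorem cube_mono (k : ℕ) : Monotone (cube k) := by
  intro m m' h
  refine Set.pi_mono fun _ _ => Set.Icc_subset_Icc ?_ ?_
  · simpa using h
  · simpa using h

theorem iUnion_cube (k : ℕ) : ⋃ m, cube k m = Set.univ := by
  refine Set.eq_univ_of_forall fun x => ?_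
  obtain ⟨m, hm⟩ := exists_nat_ge ‖x‖
  refine Set.mem_iUnion.2 ⟨m, fun l _ => ?_⟩
  have : |x l| ≤ m := (norm_le_pi_norm x l).trans hm
  exact abs_le.1 this

theorem factorialKernel_cube_lt_top (k m : ℕ) (μ : Config) :
    factorialKernel k μ (cube k m) < ∞ := by
  by_cases h : μ ∈ locallyFiniteConfig
  · rw [factorialKernel_of_mem h]
    exact (factorialMeasure_pi_le _ fun _ => measurableSet_Icc).trans_lt
      (ENNReal.prod_lt_top fun j _ => h m)
  · rw [factorialKernel_of_notMem h]
    simp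

/-- On a cube the measures are finite, so the π-system of boxes decides measurability; then the
cubes increase to the whole space. -/
theorem measurable_factorialKernel (k : ℕ) : Measurable (factorialKernel k) := by
  have h1 : ∀ m : ℕ, Measurable fun μ => (factorialKernel k μ).restrict (cube k m) := by
    intro m
    have : ∀ μ, IsFiniteMeasure ((factorialKernel k μ).restrict (cube k m)) := fun μ =>
      ⟨by rw [Measure.restrict_apply_univ]; exact factorialKernel_cube_lt_top k m μ⟩
    refine Measurable.measure_of_isPiSystem generateFrom_pi.symm isPiSystem_pi ?_ ?_
    · rintro _ ⟨B, hB, rfl⟩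
      have hB' : ∀ l, MeasurableSet (B l) := fun l => hB l trivial
      simp_rw [Measure.restrict_apply (MeasurableSet.univ_pi hB'), cube, ← Set.pi_inter_distrib]
      exact measurable_factorialKernel_pi m (fun l => (hB' l).inter measurableSet_Icc)
        fun l => Set.inter_subset_right
    · simp_rw [Measure.restrict_apply_univ]
      exact measurable_factorialKernel_pi m (fun l => measurableSet_Icc) fun l => subset_rfl
  refine Measure.measurable_of_measurable_coe _ fun B hB => ?_
  have h2 : ∀ μ, factorialKernel k μ B = ⨆ m, (factorialKernel k μ).restrict (cube k m) B := by
    intro μ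
    have : B = ⋃ m, B ∩ cube k m := by rw [← Set.inter_iUnion, iUnion_cube, Set.inter_univ]
    conv_lhs => rw [this]
    rw [Monotone.measure_iUnion]
    · simp_rw [Measure.restrict_apply hB]
    · exact fun i j hij => Set.inter_subset_inter_right _ (cube_mono k hij)
  simp_rw [h2]
  exact Measurable.iSup fun m => (Measure.measurable_coe hB).comp (h1 m)

/-! ### Factorial moments of the Poisson distribution -/

/-- The falling factorial `r (r - 1) ⋯ (r - m + 1)`, with truncated subtraction. -/
noncomputable def fallingFactorial (r : ℝ≥0∞) (m : ℕ) : ℝ≥0∞ := ∏ s ∈ Finset.range m, (r - s)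

theorem fallingFactorial_succ (r : ℝ≥0∞) (m : ℕ) :
    fallingFactorial r (m + 1) = (r - m) * fallingFactorial r m := by
  rw [fallingFactorial, Finset.prod_range_succ, mul_comm, fallingFactorial]

theorem fallingFactorial_succ' (r : ℝ≥0∞) (m : ℕ) :
    fallingFactorial r (m + 1) = r * fallingFactorial (r - 1) m := by
  rw [fallingFactorial, Finset.prod_range_succ', mul_comm, fallingFactorial]
  congr 1
  · simp
  · refine Finset.prod_congr rfl fun s _ => ?_
    push_cast
    rw [tsub_tsub, add_comm]

theorem measurable_fallingFactorial (m : ℕ) : Measurable fun r => fallingFactorial r m :=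
  Finset.measurable_prod _ fun _ _ => measurable_id.sub_const _

theorem lintegral_poissonMeasure (r : ℝ≥0) (g : ℕ → ℝ≥0∞) : ∫⁻ n, g n ∂(poissonMeasure r)
    = ∑' n : ℕ, ENNReal.ofReal (Real.exp (-r) * r ^ n / n.factorial) * g n := by
  rw [poissonMeasure, lintegral_sum_measure]
  simp

/-- The weights satisfy `n · rⁿ / n! = r · rⁿ⁻¹ / (n - 1)!`. Iterating this identity yields the
factorial moments. -/
theorem lintegral_poissonMeasure_mul (r : ℝ≥0) (g : ℕ → ℝ≥0∞) :
    ∫⁻ n, n * g n ∂(poissonMeasure r) = r * ∫⁻ n, g (n + 1) ∂(poissonMeasure r) := by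
  rw [lintegral_poissonMeasure, lintegral_poissonMeasure, tsum_eq_zero_add' ENNReal.summable,
    ← ENNReal.tsum_mul_left]
  simp only [Nat.cast_zero, zero_mul, mul_zero, zero_add]
  refine tsum_congr fun n => ?_
  rw [← mul_assoc, ← mul_assoc]
  congr 1
  rw [← ENNReal.ofReal_natCast, ← ENNReal.ofReal_mul (by positivity),
    show (r : ℝ≥0∞) = ENNReal.ofReal r from (ENNReal.ofReal_coe_nnreal).symm,
    ← ENNReal.ofReal_mul (by positivity)]
  congr 1
  rw [Nat.factorial_succ]
  push_cast
  field_simp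
  ring

theorem lintegral_fallingFactorial_poissonMeasure (r : ℝ≥0) (m : ℕ) :
    ∫⁻ n : ℕ, fallingFactorial n m ∂(poissonMeasure r) = (r : ℝ≥0∞) ^ m := by
  induction m with
  | zero => simp [fallingFactorial]
  | succ m ih =>
    simp_rw [fallingFactorial_succ']
    rw [lintegral_poissonMeasure_mul r fun n => fallingFactorial ((n : ℝ≥0∞) - 1) m]
    simp only [Nat.cast_add, Nat.cast_one, ENNReal.add_sub_cancel_right ENNReal.one_ne_top]
    rw [ih, pow_succ']

/-! ### Factorial moment measures of a Poisson process -/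

/-- Since the sets are disjoint, indices chosen for different `A j` differ automatically. The choice
therefore splits into independent choices, for each `j`, of an injective tuple of points of `A j`,
and a falling factorial counts those. -/
theorem factorialMeasure_pi_disjoint {ι : Type*} [Fintype ι] [DecidableEq ι] (μ : Config)
    {A : ι → Set ℝ} (hA : ∀ j, MeasurableSet (A j)) (hd : Pairwise (Function.onFun Disjoint A))
    (hfin : ∀ j, μ.1 (A j) ≠ ∞) {k : ℕ} (i : Fin k → ι) :
    factorialMeasure k μ (Set.univ.pi fun l => A (i l)) =
      ∏ j, fallingFactorial (μ.1 (A j)) (Finset.univ.filter fun l => i l = j).card := by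
  induction k with
  | zero =>
    rw [factorialMeasure_zero]
    simp [fallingFactorial]
  | succ k ih =>
    have hM : factorialMeasure k μ (Set.univ.pi fun l => A (i (Fin.succ l))) ≠ ∞ :=
      ((factorialMeasure_pi_le _ fun l => hA _).trans_lt
        (ENNReal.prod_lt_top fun j _ => (hfin _).lt_top)).ne
    have h := mul_factorialMeasure_pi μ (hA (i 0)) (fun l => hA (i (Fin.succ l)))
    have h3 : (Fin.cons (A (i 0)) (fun l => A (i (Fin.succ l))) : Fin (k + 1) → Set ℝ)
        = fun l => A (i l) := Fin.cons_self_tail fun l => A (i l)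
    rw [h3] at h
    set c := (Finset.univ.filter fun l : Fin k => i l.succ = i 0).card with hc
    -- By disjointness the diagonal term of index `l` is either the full box, if `l.succ` and `0`
    -- are assigned the same set, or empty. So exactly `c` equal terms survive.
    have hsum : ∑ l : Fin k, factorialMeasure k μ (Set.univ.pi
        (Function.update (fun l => A (i (Fin.succ l))) l (A (i 0) ∩ A (i l.succ))))
        = c * factorialMeasure k μ (Set.univ.pi fun l => A (i (Fin.succ l))) := by
      rw [hc, Finset.card_filter, Nat.cast_sum, Finset.sum_mul]
      refine Finset.sum_congr rfl fun l _ => ?_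
      by_cases hl : i l.succ = i 0
      · have : Function.update (fun l => A (i (Fin.succ l))) l (A (i 0) ∩ A (i l.succ))
            = fun l => A (i (Fin.succ l)) := by
          rw [← hl, Set.inter_self]
          exact Function.update_eq_self l fun l => A (i (Fin.succ l))
        rw [this]
        simp [hl]
      · have : (Set.univ.pi
            (Function.update (fun l => A (i (Fin.succ l))) l (A (i 0) ∩ A (i l.succ)))) = ∅ := by
          refine Set.univ_pi_eq_empty (i := l) ?_
          rw [Function.update_self]
          exact (hd (Ne.symm hl)).inter_eq
        rw [this]
        simp [hl]
    rw [hsum] at h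
    have h4 : factorialMeasure (k + 1) μ (Set.univ.pi fun l => A (i l))
        = (μ.1 (A (i 0)) - c) * factorialMeasure k μ (Set.univ.pi fun l => A (i (Fin.succ l))) := by
      rw [ENNReal.sub_mul fun _ _ => hM, h]
      exact (ENNReal.add_sub_cancel_right
        (ENNReal.mul_ne_top (ENNReal.natCast_ne_top c) hM)).symm
    rw [h4, ih, ← Finset.mul_prod_erase _ _ (Finset.mem_univ (i 0)),
      ← Finset.mul_prod_erase Finset.univ (fun j => fallingFactorial (μ.1 (A j))
        (Finset.univ.filter fun l => i l = j).card) (Finset.mem_univ (i 0)), ← mul_assoc]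
    have h5 : ∀ j, (Finset.univ.filter fun l => i l = j).card
        = (if i 0 = j then 1 else 0) + (Finset.univ.filter fun l : Fin k => i l.succ = j).card := by
      intro j
      rw [Finset.card_filter, Fin.sum_univ_succ, Finset.card_filter]
    congr 1
    · rw [h5, if_pos rfl, add_comm 1, fallingFactorial_succ]
    · refine Finset.prod_congr rfl fun j hj => ?_
      rw [h5, if_neg (Finset.ne_of_mem_erase hj).symm, zero_add]

/-- All factorial moment measures are Lebesgue measures. -/
def HasLebesgueFactorialMoments (π : Measure Config) : Prop :=
  ∀ k, π.bind (factorialKernel k) = (volume : Measure (Fin k → ℝ))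

section Poisson

variable {Ω₀ : Type*} [MeasurableSpace Ω₀] {Q : Measure Ω₀} {ζ : Ω₀ → Config}

theorem IsPoissonProcess.iIndepFun_of_fintype (hζ : IsPoissonProcess ζ volume Q) {ι : Type*}
    [Fintype ι] {A : ι → Set ℝ} (hA : ∀ j, MeasurableSet (A j))
    (hd : Pairwise (Function.onFun Disjoint A)) : iIndepFun (fun j ω => (ζ ω).1 (A j)) Q := by
  have h := hζ.indep (Fintype.card ι) (fun m => A ((Fintype.equivFin ι).symm m)) (fun m => hA _)
    (fun m m' hm => hd ((Fintype.equivFin ι).symm.injective.ne hm))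
  have h2 := h.precomp (Fintype.equivFin ι).injective
  simpa [Function.comp_def] using h2

theorem IsPoissonProcess.lintegral_comp (hζ : IsPoissonProcess ζ volume Q) {B : Set ℝ}
    (hB : MeasurableSet B) (hfin : volume B ≠ ∞) {g : ℝ≥0∞ → ℝ≥0∞} (hg : Measurable g) :
    ∫⁻ ω, g ((ζ ω).1 B) ∂Q = ∫⁻ n : ℕ, g n ∂(poissonMeasure (volume B).toNNReal) := by
  have hm : Measurable fun ω => (ζ ω).1 B := (measurable_config_apply hB).comp hζ.measurable
  rw [← lintegral_map hg hm, hζ.law B hB, poissonLaw, if_neg hfin,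
    lintegral_map hg (measurable_of_countable _)]

theorem IsPoissonProcess.lintegral_fallingFactorial (hζ : IsPoissonProcess ζ volume Q) {B : Set ℝ}
    (hB : MeasurableSet B) (hfin : volume B ≠ ∞) (m : ℕ) :
    ∫⁻ ω, fallingFactorial ((ζ ω).1 B) m ∂Q = volume B ^ m := by
  rw [hζ.lintegral_comp hB hfin (measurable_fallingFactorial m),
    lintegral_fallingFactorial_poissonMeasure, ENNReal.coe_toNNReal hfin]

theorem IsPoissonProcess.lintegral_apply (hζ : IsPoissonProcess ζ volume Q) {B : Set ℝ}
    (hB : MeasurableSet B) (hfin : volume B ≠ ∞) :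
    ∫⁻ ω, (ζ ω).1 B ∂Q = volume B := by
  simpa [fallingFactorial] using hζ.lintegral_fallingFactorial hB hfin 1

theorem IsPoissonProcess.ae_apply_lt_top (hζ : IsPoissonProcess ζ volume Q) {B : Set ℝ}
    (hB : MeasurableSet B) (hfin : volume B ≠ ∞) : ∀ᵐ ω ∂Q, (ζ ω).1 B < ∞ :=
  ae_lt_top ((measurable_config_apply hB).comp hζ.measurable)
    (by rw [hζ.lintegral_apply hB hfin]; exact hfin)

theorem IsPoissonProcess.ae_mem_locallyFiniteConfig (hζ : IsPoissonProcess ζ volume Q) :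
    ∀ᵐ ω ∂Q, ζ ω ∈ locallyFiniteConfig :=
  ae_all_iff.2 fun _ => hζ.ae_apply_lt_top measurableSet_Icc measure_Icc_lt_top.ne

/-- The falling factorials of the counts of disjoint sets are independent, and the `m`-th factorial
moment of a Poisson variable is the `m`-th power of its parameter. -/
theorem IsPoissonProcess.lintegral_factorialMeasure_disjoint (hζ : IsPoissonProcess ζ volume Q)
    {ι : Type*} [Fintype ι] {A : ι → Set ℝ}
    (hA : ∀ j, MeasurableSet (A j)) (hd : Pairwise (Function.onFun Disjoint A))
    (hfin : ∀ j, volume (A j) ≠ ∞) {k : ℕ} (i : Fin k → ι) :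
    ∫⁻ ω, factorialKernel k (ζ ω) (Set.univ.pi fun l => A (i l)) ∂Q = ∏ l, volume (A (i l)) := by
  classical
  have h1 : ∀ᵐ ω ∂Q, factorialKernel k (ζ ω) (Set.univ.pi fun l => A (i l)) =
      ∏ j, fallingFactorial ((ζ ω).1 (A j)) (Finset.univ.filter fun l => i l = j).card := by
    filter_upwards [hζ.ae_mem_locallyFiniteConfig,
      ae_all_iff.2 fun j => hζ.ae_apply_lt_top (hA j) (hfin j)] with ω hω hω'
    rw [factorialKernel_of_mem hω, factorialMeasure_pi_disjoint _ hA hd fun j => (hω' j).ne]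
  rw [lintegral_congr_ae h1, lintegral_prod_eq_prod_lintegral_of_indepFun Finset.univ
    (fun j ω => fallingFactorial ((ζ ω).1 (A j)) (Finset.univ.filter fun l => i l = j).card)
    ((hζ.iIndepFun_of_fintype hA hd).comp _ fun j => measurable_fallingFactorial _)
    fun j => (measurable_fallingFactorial _).comp
      ((measurable_config_apply (hA j)).comp hζ.measurable)]
  simp_rw [hζ.lintegral_fallingFactorial (hA _) (hfin _)]
  rw [← Finset.prod_fiberwise Finset.univ i fun l => volume (A (i l))]
  refine Finset.prod_congr rfl fun j _ => ?_
  rw [Finset.prod_congr rfl fun l hl => by rw [(Finset.mem_filter.1 hl).2], Finset.prod_const]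

end Poisson

/-- The atoms of the algebra generated by finitely many sets. -/
def setAtom {k : ℕ} (B : Fin k → Set ℝ) (S : Finset (Fin k)) : Set ℝ :=
  {x | ∀ l, x ∈ B l ↔ l ∈ S}

theorem measurableSet_setAtom {k : ℕ} {B : Fin k → Set ℝ} (hB : ∀ l, MeasurableSet (B l))
    (S : Finset (Fin k)) : MeasurableSet (setAtom B S) := by
  have : setAtom B S = ⋂ l, if l ∈ S then B l else (B l)ᶜ := by
    ext x
    simp only [setAtom, Set.mem_ofPred_eq, Set.mem_iInter]
    refine forall_congr' fun l => ?_
    split_ifs with h <;> simp [h]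
  rw [this]
  refine MeasurableSet.iInter fun l => ?_
  split_ifs
  exacts [hB l, (hB l).compl]

theorem disjoint_setAtom {k : ℕ} (B : Fin k → Set ℝ) :
    Pairwise (Function.onFun Disjoint (setAtom B)) := by
  intro S T hST
  refine Set.disjoint_left.2 fun x hx hx' => hST ?_
  ext l
  rw [← hx l, hx' l]

theorem indicator_eq_sum_setAtom {k : ℕ} (B : Fin k → Set ℝ) (l : Fin k) (x : ℝ) :
    (B l).indicator (1 : ℝ → ℝ≥0∞) x
      = ∑ S ∈ Finset.univ.filter (fun S => l ∈ S), (setAtom B S).indicator 1 x := by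
  classical
  set T := Finset.univ.filter fun l => x ∈ B l with hT
  have h : ∀ S, (setAtom B S).indicator (1 : ℝ → ℝ≥0∞) x = if S = T then 1 else 0 := by
    intro S
    by_cases hS : S = T
    · rw [if_pos hS, Set.indicator_of_mem]
      · rfl
      · intro l
        simp [hS, hT]
    · rw [if_neg hS, Set.indicator_of_notMem]
      intro hx
      refine hS ?_
      ext l
      rw [← hx l]
      simp [hT]
  simp_rw [h]
  rw [Finset.sum_ite_eq']
  simp [hT, Set.indicator]

/-- Reduces arbitrary boxes to boxes whose sides are pairwise equal or disjoint: each `B l` is the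
disjoint union of the atoms whose label contains `l`. -/
theorem measure_pi_eq_sum_setAtom {k : ℕ} (M : Measure (Fin k → ℝ)) {B : Fin k → Set ℝ}
    (hB : ∀ l, MeasurableSet (B l)) :
    M (Set.univ.pi B) = ∑ i ∈ Fintype.piFinset fun l : Fin k => Finset.univ.filter
      (fun S : Finset (Fin k) => l ∈ S), M (Set.univ.pi fun l => setAtom B (i l)) := by
  simp_rw [measure_pi_eq_lintegral M hB, indicator_eq_sum_setAtom B, Finset.prod_univ_sum]
  rw [lintegral_finsetSum]
  · refine Finset.sum_congr rfl fun i _ => ?_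
    rw [measure_pi_eq_lintegral M fun l => measurableSet_setAtom hB _]
  · intro i _
    refine Finset.measurable_prod _ fun l _ => ?_
    exact (measurable_one.indicator (measurableSet_setAtom hB _)).comp (measurable_pi_apply l)

/-- Lebesgue measure is determined by boxes with sides of finite volume. Both measures are additive
over the decomposition of such a box into atoms, where the disjoint case applies. -/
theorem IsPoissonProcess.hasLebesgueFactorialMoments {Ω₀ : Type*} [MeasurableSpace Ω₀]
    {Q : Measure Ω₀} {ζ : Ω₀ → Config} (hζ : IsPoissonProcess ζ volume Q) :
    HasLebesgueFactorialMoments (Q.map ζ) := by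
  intro k
  have hgen : ∀ _ : Fin k, MeasurableSpace.generateFrom
      {s : Set ℝ | MeasurableSet s ∧ volume s ≠ ∞} = (inferInstance : MeasurableSpace ℝ) := by
    intro _
    refine le_antisymm (MeasurableSpace.generateFrom_le fun s hs => hs.1) ?_
    intro s hs
    have : s = ⋃ m : ℕ, s ∩ Set.Icc (-m : ℝ) m := by
      rw [← Set.inter_iUnion]
      refine (Set.inter_eq_left.2 fun x _ => ?_).symm
      obtain ⟨m, hm⟩ := exists_nat_ge |x|
      exact Set.mem_iUnion.2 ⟨m, abs_le.1 hm⟩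
    rw [this]
    refine MeasurableSet.iUnion fun m => MeasurableSpace.measurableSet_generateFrom
      ⟨hs.inter measurableSet_Icc, ?_⟩
    exact ((measure_mono Set.inter_subset_right).trans_lt measure_Icc_lt_top).ne
  symm
  rw [volume_pi]
  refine Measure.pi_eq_generateFrom (C := fun _ => {s : Set ℝ | MeasurableSet s ∧ volume s ≠ ∞})
    hgen ?_ ?_ ?_
  · rintro _ s hs t ht -
    exact ⟨hs.1.inter ht.1, ((measure_mono Set.inter_subset_left).trans_lt hs.2.lt_top).ne⟩
  · intro _
    refine ⟨fun m => Set.Icc (-m : ℝ) m, fun m => ⟨measurableSet_Icc, measure_Icc_lt_top.ne⟩,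
      fun m => measure_Icc_lt_top, ?_⟩
    refine Set.eq_univ_of_forall fun x => ?_
    obtain ⟨m, hm⟩ := exists_nat_ge |x|
    exact Set.mem_iUnion.2 ⟨m, abs_le.1 hm⟩
  · intro B hB
    have hB1 : ∀ l, MeasurableSet (B l) := fun l => (hB l).1
    have hκ := measurable_factorialKernel k
    rw [measure_pi_eq_sum_setAtom _ hB1]
    have hprod : ∏ l, volume (B l) = ∑ i ∈ Fintype.piFinset fun l : Fin k => Finset.univ.filter
        (fun S : Finset (Fin k) => l ∈ S), ∏ l, volume (setAtom B (i l)) := by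
      have := measure_pi_eq_sum_setAtom (Measure.pi fun _ => volume) hB1
      simpa only [Measure.pi_pi] using this
    rw [hprod]
    refine Finset.sum_congr rfl fun i hi => ?_
    have hil : ∀ l, l ∈ i l := fun l => (Finset.mem_filter.1 (Fintype.mem_piFinset.1 hi l)).2
    rw [Measure.bind_apply (MeasurableSet.univ_pi fun l => measurableSet_setAtom hB1 _)
      hκ.aemeasurable, lintegral_map (f := fun μ => factorialKernel k μ
        (Set.univ.pi fun l => setAtom B (i l))) (Measure.measurable_coe
        (MeasurableSet.univ_pi fun l => measurableSet_setAtom hB1 _) |>.comp hκ) hζ.measurable]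
    -- The empty label is excluded: its atom is the complement of all the `B l` and has infinite
    -- volume. It never occurs, because `i l` contains `l`.
    let A : {S : Finset (Fin k) // S.Nonempty} → Set ℝ := fun S => setAtom B S.1
    refine hζ.lintegral_factorialMeasure_disjoint (A := A) (fun S => measurableSet_setAtom hB1 _)
      (fun S T hST => disjoint_setAtom B (Subtype.coe_injective.ne hST)) ?_
      (fun l => ⟨i l, l, hil l⟩)
    rintro ⟨S, l, hl⟩
    exact ((measure_mono fun x hx => (hx l).2 hl).trans_lt (hB l).2.lt_top).ne

/-- This is the content of the case `k = 0`: the zeroth factorial measure has mass one, but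
`factorialKernel` is zero on configurations that are not locally finite, so the zeroth moment is the
probability of local finiteness. -/
theorem HasLebesgueFactorialMoments.ae_mem_locallyFiniteConfig {π : Measure Config}
    [IsProbabilityMeasure π] (hπ : HasLebesgueFactorialMoments π) :
    ∀ᵐ μ ∂π, μ ∈ locallyFiniteConfig := by
  have h := congrArg (fun M => M Set.univ) (hπ 0)
  beta_reduce at h
  rw [Measure.bind_apply MeasurableSet.univ (measurable_factorialKernel 0).aemeasurable] at h
  have h1 : ∀ μ, factorialKernel 0 μ Set.univ = locallyFiniteConfig.indicator 1 μ := by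
    intro μ
    by_cases hμ : μ ∈ locallyFiniteConfig
    · rw [factorialKernel_of_mem hμ, Set.indicator_of_mem hμ, factorialMeasure_zero]
      simp
    · rw [factorialKernel_of_notMem hμ, Set.indicator_of_notMem hμ]
      simp
  simp_rw [h1] at h
  rw [lintegral_indicator_one measurableSet_locallyFiniteConfig] at h
  have h2 : (volume : Measure (Fin 0 → ℝ)) Set.univ = 1 := by
    simp [volume_pi]
  rw [h2] at h
  exact (prob_compl_eq_zero_iff measurableSet_locallyFiniteConfig).2 h

/-! ### Joining coordinates -/

/-- The splitting of `n` coordinates into the first `k` and the remaining `n - k`. -/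
def splitEquiv {k n : ℕ} (h : k ≤ n) : Fin k ⊕ Fin (n - k) ≃ Fin n :=
  finSumFinEquiv.trans (finCongr (Nat.add_sub_cancel' h))

theorem joinCoords_inl {k n : ℕ} (h : k ≤ n) (x : Fin k → ℝ) (y : Fin (n - k) → ℝ) (l : Fin k) :
    joinCoords k x y (splitEquiv h (Sum.inl l)) = x l := by
  simp [joinCoords, splitEquiv]

theorem joinCoords_inr {k n : ℕ} (h : k ≤ n) (x : Fin k → ℝ) (y : Fin (n - k) → ℝ)
    (l : Fin (n - k)) : joinCoords k x y (splitEquiv h (Sum.inr l)) = y l := by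
  simp [joinCoords, splitEquiv]

theorem measurable_joinCoords {n : ℕ} (k : ℕ) :
    Measurable fun p : (Fin k → ℝ) × (Fin (n - k) → ℝ) => (joinCoords k p.1 p.2 : Fin n → ℝ) := by
  refine measurable_pi_lambda _ fun i => ?_
  unfold joinCoords
  split_ifs <;> fun_prop

theorem map_joinCoords {k n : ℕ} (h : k ≤ n) (ν : Measure ℝ) [SigmaFinite ν] :
    ((Measure.pi fun _ : Fin k => ν).prod (Measure.pi fun _ : Fin (n - k) => ν)).map
      (fun p => (joinCoords k p.1 p.2 : Fin n → ℝ)) = Measure.pi fun _ => ν := by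
  symm
  refine Measure.pi_eq fun B hB => ?_
  rw [Measure.map_apply (measurable_joinCoords k) (MeasurableSet.univ_pi hB)]
  have : (fun p : (Fin k → ℝ) × (Fin (n - k) → ℝ) => (joinCoords k p.1 p.2 : Fin n → ℝ)) ⁻¹'
      (Set.univ.pi B) = (Set.univ.pi fun l => B (splitEquiv h (Sum.inl l))) ×ˢ
        (Set.univ.pi fun l => B (splitEquiv h (Sum.inr l))) := by
    ext p
    simp only [Set.mem_preimage, Set.mem_univ_pi, Set.mem_prod]
    rw [← (splitEquiv h).forall_congr_right, Sum.forall]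
    simp only [joinCoords_inl, joinCoords_inr]
  rw [this, Measure.prod_prod, Measure.pi_pi, Measure.pi_pi, ← (splitEquiv h).prod_comp,
    Fintype.prod_sum_type]

theorem measurePreserving_joinCoords {k n : ℕ} (h : k ≤ n) :
    MeasurePreserving (fun p : (Fin k → ℝ) × (Fin (n - k) → ℝ) =>
      (joinCoords k p.1 p.2 : Fin n → ℝ)) := by
  refine ⟨measurable_joinCoords k, ?_⟩
  exact map_joinCoords h volume

/-! ### Symmetrization and its marginals -/

theorem measurePreserving_pi_comp_perm (ν : Measure ℝ) [SigmaFinite ν] {n : ℕ}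
    (s : Equiv.Perm (Fin n)) : MeasurePreserving (fun x : Fin n → ℝ => x ∘ s)
      (Measure.pi fun _ => ν) (Measure.pi fun _ => ν) := by
  refine ⟨by fun_prop, ?_⟩
  symm
  refine Measure.pi_eq fun B hB => ?_
  rw [Measure.map_apply (by fun_prop) (MeasurableSet.univ_pi hB)]
  have : (fun x : Fin n → ℝ => x ∘ s) ⁻¹' (Set.univ.pi B)
      = Set.univ.pi fun l => B (s.symm l) := by
    ext x
    simp only [Set.mem_preimage, Set.mem_univ_pi, Function.comp_apply]
    rw [← s.forall_congr_right (q := fun l => x l ∈ B (s.symm l))]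
    simp
  rw [this, Measure.pi_pi]
  exact s.symm.prod_comp fun l => ν (B l)

theorem measurePreserving_comp_perm {n : ℕ} (s : Equiv.Perm (Fin n)) :
    MeasurePreserving (fun x : Fin n → ℝ => x ∘ s) :=
  measurePreserving_pi_comp_perm volume s

theorem measurable_symmetrization {n : ℕ} {f : (Fin n → ℝ) → ℝ} (hf : Measurable f) :
    Measurable (symmetrization f) := by
  unfold symmetrization
  refine Measurable.const_mul (Finset.measurable_sum _ fun s _ => ?_) _
  exact hf.comp (measurePreserving_comp_perm s).measurable

theorem integrable_symmetrization {n : ℕ} {f : (Fin n → ℝ) → ℝ} (hf : Integrable f) :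
    Integrable (symmetrization f) := by
  unfold symmetrization
  exact (integrable_finsetSum _ fun s _ =>
    (measurePreserving_comp_perm s).integrable_comp_of_integrable hf).const_mul _

theorem integral_abs_symmetrization_le {n : ℕ} {f : (Fin n → ℝ) → ℝ} (hf : Integrable f) :
    ∫ x, |symmetrization f x| ≤ ∫ x, |f x| := by
  have hs : ∀ s : Equiv.Perm (Fin n), Integrable fun x => |f (x ∘ s)| := fun s =>
    ((measurePreserving_comp_perm s).integrable_comp_of_integrable hf).abs
  have h1 : ∀ s : Equiv.Perm (Fin n), ∫ x, |f (x ∘ s)| = ∫ x, |f x| := fun s => by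
    have := (measurePreserving_comp_perm s).map_eq
    conv_rhs => rw [← this]
    rw [integral_map (measurePreserving_comp_perm s).aemeasurable]
    rw [this]
    exact hf.abs.aestronglyMeasurable
  calc ∫ x, |symmetrization f x|
      ≤ ∫ x, (n.factorial : ℝ)⁻¹ * ∑ s : Equiv.Perm (Fin n), |f (x ∘ s)| := by
        refine integral_mono (integrable_symmetrization hf).abs
          ((integrable_finsetSum _ fun s _ => hs s).const_mul _) fun x => ?_
        simp only [symmetrization]
        rw [abs_mul, abs_of_nonneg (by positivity : (0 : ℝ) ≤ (n.factorial : ℝ)⁻¹)]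
        gcongr
        exact Finset.abs_sum_le_sum_abs _ _
    _ = ∫ x, |f x| := by
        rw [integral_const_mul, integral_finsetSum _ fun s _ => hs s]
        simp_rw [h1]
        rw [Finset.sum_const, Finset.card_univ, Fintype.card_perm, Fintype.card_fin, nsmul_eq_mul,
          ← mul_assoc, inv_mul_cancel₀ (by positivity), one_mul]

/-- The function `x ↦ ∫ f̃(x, y) dy` of the first `k` variables. -/
noncomputable def symMarginal {n : ℕ} (k : ℕ) (f : (Fin n → ℝ) → ℝ) (x : Fin k → ℝ) : ℝ :=
  ∫ y : Fin (n - k) → ℝ, symmetrization f (joinCoords k x y)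

theorem wienerItoFormula_eq {n : ℕ} (f : (Fin n → ℝ) → ℝ) (μ : Config) :
    wienerItoFormula n f μ = ∑ k ∈ Finset.range (n + 1), (n.choose k : ℝ) * (-1) ^ (n - k) *
      ∫ x, symMarginal k f x ∂(factorialMeasure k μ) := rfl

theorem integrable_symmetrization_joinCoords {k n : ℕ} (h : k ≤ n) {f : (Fin n → ℝ) → ℝ}
    (hf : Integrable f) :
    Integrable fun p : (Fin k → ℝ) × (Fin (n - k) → ℝ) =>
      symmetrization f (joinCoords k p.1 p.2) :=
  (measurePreserving_joinCoords h).integrable_comp_of_integrable (integrable_symmetrization hf)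

theorem integrable_symMarginal {k n : ℕ} (h : k ≤ n) {f : (Fin n → ℝ) → ℝ}
    (hf : Integrable f) : Integrable (symMarginal k f) :=
  (integrable_symmetrization_joinCoords h hf).integral_prod_left

theorem measurable_symMarginal {k n : ℕ} {f : (Fin n → ℝ) → ℝ}
    (hf : Measurable f) : Measurable (symMarginal k f) := by
  have : StronglyMeasurable fun p : (Fin k → ℝ) × (Fin (n - k) → ℝ) =>
      symmetrization f (joinCoords k p.1 p.2) :=
    ((measurable_symmetrization hf).comp (measurable_joinCoords k)).stronglyMeasurable
  exact this.integral_prod_right.measurable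

theorem integral_abs_symMarginal_le {k n : ℕ} (h : k ≤ n) {f : (Fin n → ℝ) → ℝ}
    (hf : Integrable f) : ∫ x, |symMarginal k f x| ≤ ∫ x, |f x| := by
  have hi := integrable_symmetrization_joinCoords h hf
  calc ∫ x, |symMarginal k f x|
      ≤ ∫ x : Fin k → ℝ, ∫ y : Fin (n - k) → ℝ, |symmetrization f (joinCoords k x y)| := by
        refine integral_mono (integrable_symMarginal h hf).abs hi.abs.integral_prod_left ?_
        exact fun x => abs_integral_le_integral_abs
    _ = ∫ p : (Fin k → ℝ) × (Fin (n - k) → ℝ), |symmetrization f (joinCoords k p.1 p.2)| :=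
        (integral_prod _ hi.abs).symm
    _ = ∫ x, |symmetrization f x| := by
        have := (measurePreserving_joinCoords h).map_eq
        conv_rhs => rw [← this]
        rw [integral_map (measurePreserving_joinCoords h).aemeasurable]
        rw [this]
        exact (integrable_symmetrization hf).abs.aestronglyMeasurable
    _ ≤ _ := integral_abs_symmetrization_le hf

theorem symmetrization_add {n : ℕ} (f g : (Fin n → ℝ) → ℝ) :
    symmetrization (f + g) = symmetrization f + symmetrization g := by
  funext x
  simp [symmetrization, Finset.sum_add_distrib, mul_add]

theorem symmetrization_smul {n : ℕ} (c : ℝ) (f : (Fin n → ℝ) → ℝ) :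
    symmetrization (c • f) = c • symmetrization f := by
  funext x
  simp [symmetrization, ← Finset.mul_sum]
  ring

theorem symMarginal_smul {n k : ℕ} (c : ℝ) (f : (Fin n → ℝ) → ℝ) :
    symMarginal k (c • f) = c • symMarginal k f := by
  funext x
  simp [symMarginal, symmetrization_smul, integral_const_mul]

theorem symMarginal_add {k n : ℕ} (h : k ≤ n) {f g : (Fin n → ℝ) → ℝ} (hf : Integrable f)
    (hg : Integrable g) : symMarginal k (f + g) =ᵐ[volume] symMarginal k f + symMarginal k g := by
  filter_upwards [(integrable_symmetrization_joinCoords h hf).prod_right_ae,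
    (integrable_symmetrization_joinCoords h hg).prod_right_ae] with x hx hy
  simp only [symMarginal, symmetrization_add, Pi.add_apply]
  exact integral_add hx hy

theorem wienerItoFormula_smul {n : ℕ} (c : ℝ) (f : (Fin n → ℝ) → ℝ) (μ : Config) :
    wienerItoFormula n (c • f) μ = c * wienerItoFormula n f μ := by
  rw [wienerItoFormula_eq, wienerItoFormula_eq, Finset.mul_sum]
  refine Finset.sum_congr rfl fun k _ => ?_
  rw [symMarginal_smul]
  simp only [Pi.smul_apply, smul_eq_mul, integral_const_mul]
  ring

/-! ### Linear statistics under Lebesgue factorial moments -/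

section Moments

variable {π : Measure Config}

/-- Factorial measures are purely atomic, yet almost surely they do not charge a given Lebesgue null
set. This allows functions defined only almost everywhere to be integrated against them. -/
theorem HasLebesgueFactorialMoments.ae_ae (hπ : HasLebesgueFactorialMoments π) {k : ℕ}
    {p : (Fin k → ℝ) → Prop} (h : ∀ᵐ x, p x) : ∀ᵐ μ ∂π, ∀ᵐ x ∂(factorialKernel k μ), p x := by
  refine Measure.ae_ae_of_ae_bind (measurable_factorialKernel k).aemeasurable ?_
  rwa [hπ k]

theorem HasLebesgueFactorialMoments.lintegral (hπ : HasLebesgueFactorialMoments π) {k : ℕ}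
    {F : (Fin k → ℝ) → ℝ≥0∞} (hF : AEMeasurable F) :
    ∫⁻ μ, ∫⁻ x, F x ∂(factorialKernel k μ) ∂π = ∫⁻ x, F x := by
  rw [← hπ k, Measure.lintegral_bind (measurable_factorialKernel k).aemeasurable]
  rwa [hπ k]

theorem HasLebesgueFactorialMoments.ae_integrable (hπ : HasLebesgueFactorialMoments π) {k : ℕ}
    {F : (Fin k → ℝ) → ℝ} (hF : Integrable F) :
    ∀ᵐ μ ∂π, Integrable F (factorialKernel k μ) := by
  obtain ⟨G, hG, hFG⟩ := hF.aestronglyMeasurable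
  have hGi : Integrable G := hF.congr hFG
  have h : ∀ᵐ μ ∂π, ∫⁻ x, ‖G x‖ₑ ∂(factorialKernel k μ) < ∞ := by
    refine ae_lt_top ?_ ?_
    · exact (Measure.measurable_lintegral hG.measurable.enorm).comp (measurable_factorialKernel k)
    · rw [hπ.lintegral hG.measurable.enorm.aemeasurable]
      exact hGi.hasFiniteIntegral.ne
  filter_upwards [h, hπ.ae_ae hFG] with μ h1 h2
  exact Integrable.congr ⟨hG.aestronglyMeasurable, h1⟩ (h2.mono fun _ h => h.symm)

theorem HasLebesgueFactorialMoments.aestronglyMeasurable_integral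
    (hπ : HasLebesgueFactorialMoments π) {k : ℕ} {F : (Fin k → ℝ) → ℝ} (hF : Integrable F) :
    AEStronglyMeasurable (fun μ => ∫ x, F x ∂(factorialKernel k μ)) π := by
  obtain ⟨G, hG, hFG⟩ := hF.aestronglyMeasurable
  have hGi : Integrable G := hF.congr hFG
  refine ⟨fun μ => (∫⁻ x, ENNReal.ofReal (G x) ∂(factorialKernel k μ)).toReal
    - (∫⁻ x, ENNReal.ofReal (-G x) ∂(factorialKernel k μ)).toReal, ?_, ?_⟩
  · have h1 : ∀ H : (Fin k → ℝ) → ℝ≥0∞, Measurable H →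
        Measurable fun μ => (∫⁻ x, H x ∂(factorialKernel k μ)).toReal := fun H hH =>
      ((Measure.measurable_lintegral hH).comp (measurable_factorialKernel k)).ennreal_toReal
    exact ((h1 _ hG.measurable.ennreal_ofReal).sub
      (h1 _ hG.measurable.neg.ennreal_ofReal)).stronglyMeasurable
  · filter_upwards [hπ.ae_ae hFG, hπ.ae_integrable hGi] with μ h1 h2
    rw [integral_congr_ae h1, integral_eq_lintegral_pos_part_sub_lintegral_neg_part h2]

theorem HasLebesgueFactorialMoments.lintegral_enorm_integral_le
    (hπ : HasLebesgueFactorialMoments π) {k : ℕ} {F : (Fin k → ℝ) → ℝ} (hF : Integrable F) :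
    ∫⁻ μ, ‖∫ x, F x ∂(factorialKernel k μ)‖ₑ ∂π ≤ ∫⁻ x, ‖F x‖ₑ := by
  rw [← hπ.lintegral hF.aestronglyMeasurable.enorm]
  exact lintegral_mono fun μ => enorm_integral_le_lintegral_enorm _

theorem HasLebesgueFactorialMoments.ae_wienerItoFormula_eq [IsProbabilityMeasure π]
    (hπ : HasLebesgueFactorialMoments π) {n : ℕ} (f : (Fin n → ℝ) → ℝ) :
    wienerItoFormula n f =ᵐ[π] fun μ => ∑ k ∈ Finset.range (n + 1),
      (n.choose k : ℝ) * (-1) ^ (n - k) * ∫ x, symMarginal k f x ∂(factorialKernel k μ) := by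
  filter_upwards [hπ.ae_mem_locallyFiniteConfig] with μ hμ
  rw [wienerItoFormula_eq]
  simp_rw [factorialKernel_of_mem hμ]

theorem HasLebesgueFactorialMoments.aestronglyMeasurable_wienerItoFormula [IsProbabilityMeasure π]
    (hπ : HasLebesgueFactorialMoments π) {n : ℕ} {f : (Fin n → ℝ) → ℝ} (hf : Integrable f) :
    AEStronglyMeasurable (wienerItoFormula n f) π := by
  refine AEStronglyMeasurable.congr ?_ (hπ.ae_wienerItoFormula_eq f).symm
  refine Finset.aestronglyMeasurable_fun_sum _ fun k hk => ?_
  exact (hπ.aestronglyMeasurable_integral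
    (integrable_symMarginal (Nat.lt_succ_iff.1 (Finset.mem_range.1 hk)) hf)).const_mul _

theorem lintegral_enorm_symMarginal_le {k n : ℕ} (h : k ≤ n) {f : (Fin n → ℝ) → ℝ}
    (hf : Integrable f) : ∫⁻ x, ‖symMarginal k f x‖ₑ ≤ ∫⁻ x, ‖f x‖ₑ := by
  rw [← ofReal_integral_norm_eq_lintegral_enorm (integrable_symMarginal h hf),
    ← ofReal_integral_norm_eq_lintegral_enorm hf]
  exact ENNReal.ofReal_le_ofReal (integral_abs_symMarginal_le h hf)

/-- Taking marginals contracts `L¹`, and so does integrating against a random factorial measure with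
Lebesgue mean; the binomial coefficients sum to `2 ^ n`. This `L¹` continuity identifies limits of
the formula where an `L²` bound is not yet available. -/
theorem HasLebesgueFactorialMoments.lintegral_enorm_wienerItoFormula_le [IsProbabilityMeasure π]
    (hπ : HasLebesgueFactorialMoments π) {n : ℕ} {f : (Fin n → ℝ) → ℝ} (hf : Integrable f) :
    ∫⁻ μ, ‖wienerItoFormula n f μ‖ₑ ∂π ≤ 2 ^ n * ∫⁻ x, ‖f x‖ₑ := by
  have hk : ∀ k ∈ Finset.range (n + 1), k ≤ n := fun k hk =>
    Nat.lt_succ_iff.1 (Finset.mem_range.1 hk)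
  calc ∫⁻ μ, ‖wienerItoFormula n f μ‖ₑ ∂π
      ≤ ∫⁻ μ, ∑ k ∈ Finset.range (n + 1), (n.choose k : ℝ≥0∞) *
          ‖∫ x, symMarginal k f x ∂(factorialKernel k μ)‖ₑ ∂π := by
        refine lintegral_mono_ae ?_
        filter_upwards [hπ.ae_wienerItoFormula_eq f] with μ hμ
        rw [hμ]
        refine (enorm_sum_le _ _).trans (Finset.sum_le_sum fun k _ => ?_)
        rw [enorm_mul, enorm_mul]
        simp
    _ = ∑ k ∈ Finset.range (n + 1), (n.choose k : ℝ≥0∞) *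
          ∫⁻ μ, ‖∫ x, symMarginal k f x ∂(factorialKernel k μ)‖ₑ ∂π := by
        rw [lintegral_finsetSum']
        · refine Finset.sum_congr rfl fun k _ => ?_
          rw [lintegral_const_mul' _ _ (ENNReal.natCast_ne_top _)]
        · intro k h
          exact ((hπ.aestronglyMeasurable_integral
            (integrable_symMarginal (hk k h) hf)).enorm).const_mul _
    _ ≤ ∑ k ∈ Finset.range (n + 1), (n.choose k : ℝ≥0∞) * ∫⁻ x, ‖f x‖ₑ := by
        refine Finset.sum_le_sum fun k h => ?_
        gcongr
        exact (hπ.lintegral_enorm_integral_le (integrable_symMarginal (hk k h) hf)).trans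
          (lintegral_enorm_symMarginal_le (hk k h) hf)
    _ = 2 ^ n * ∫⁻ x, ‖f x‖ₑ := by
        rw [← Finset.sum_mul, ← Nat.cast_sum, Nat.sum_range_choose]
        simp

theorem HasLebesgueFactorialMoments.wienerItoFormula_add [IsProbabilityMeasure π]
    (hπ : HasLebesgueFactorialMoments π) {n : ℕ} {f g : (Fin n → ℝ) → ℝ} (hf : Integrable f)
    (hg : Integrable g) :
    wienerItoFormula n (f + g) =ᵐ[π] wienerItoFormula n f + wienerItoFormula n g := by
  have hk : ∀ k ∈ Finset.range (n + 1), k ≤ n := fun k hk =>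
    Nat.lt_succ_iff.1 (Finset.mem_range.1 hk)
  have h : ∀ᵐ μ ∂π, ∀ k ∈ Finset.range (n + 1),
      ∫ x, symMarginal k (f + g) x ∂(factorialKernel k μ)
      = ∫ x, symMarginal k f x ∂(factorialKernel k μ)
        + ∫ x, symMarginal k g x ∂(factorialKernel k μ) := by
    rw [Filter.eventually_all_finset]
    intro k h
    filter_upwards [hπ.ae_ae (symMarginal_add (hk k h) hf hg),
      hπ.ae_integrable (integrable_symMarginal (hk k h) hf),
      hπ.ae_integrable (integrable_symMarginal (hk k h) hg)] with μ h1 h2 h3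
    rw [integral_congr_ae h1, ← integral_add h2 h3]
    rfl
  filter_upwards [hπ.ae_wienerItoFormula_eq f, hπ.ae_wienerItoFormula_eq g,
    hπ.ae_wienerItoFormula_eq (f + g), h] with μ h1 h2 h3 h4
  rw [Pi.add_apply, h1, h2, h3, ← Finset.sum_add_distrib]
  refine Finset.sum_congr rfl fun k hk => ?_
  rw [h4 k hk, mul_add]

theorem HasLebesgueFactorialMoments.wienerItoFormula_sub [IsProbabilityMeasure π]
    (hπ : HasLebesgueFactorialMoments π) {n : ℕ} {f g : (Fin n → ℝ) → ℝ} (hf : Integrable f)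
    (hg : Integrable g) :
    wienerItoFormula n (f - g) =ᵐ[π] wienerItoFormula n f - wienerItoFormula n g := by
  have h := hπ.wienerItoFormula_add hf (hg.smul (-1 : ℝ))
  have h2 : f + (-1 : ℝ) • g = f - g := by
    rw [neg_one_smul, sub_eq_add_neg]
  rw [h2] at h
  filter_upwards [h] with μ hμ
  rw [hμ, Pi.add_apply, Pi.sub_apply, wienerItoFormula_smul]
  ring

theorem HasLebesgueFactorialMoments.wienerItoFormula_sum [IsProbabilityMeasure π]
    (hπ : HasLebesgueFactorialMoments π) {n : ℕ} {ι : Type*} (s : Finset ι) (c : ι → ℝ)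
    {f : ι → (Fin n → ℝ) → ℝ} (hf : ∀ i, Integrable (f i)) :
    wienerItoFormula n (∑ i ∈ s, c i • f i) =ᵐ[π]
      fun μ => ∑ i ∈ s, c i * wienerItoFormula n (f i) μ := by
  classical
  induction s using Finset.induction_on with
  | empty =>
    refine Filter.Eventually.of_forall fun μ => ?_
    have h := wienerItoFormula_smul 0 (0 : (Fin n → ℝ) → ℝ) μ
    simpa using h
  | insert i s hi ih =>
    have h := hπ.wienerItoFormula_add ((hf i).smul (c i))
      (integrable_finsetSum' s fun j _ => (hf j).smul (c j))
    filter_upwards [h, ih] with μ h1 h2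
    rw [Finset.sum_insert hi, Finset.sum_insert hi, h1, Pi.add_apply, h2, wienerItoFormula_smul]

end Moments

/-! ### The formula on products of disjoint sets -/

/-- Double counting: a uniformly random permutation carries the first `k` indices to a uniformly
random set of `k` indices. -/
theorem sum_powersetCard_eq_sum_perm {n k : ℕ} (h : k ≤ n) (g : Finset (Fin n) → ℝ) :
    ∑ J ∈ Finset.powersetCard k Finset.univ, g J = (n.choose k : ℝ) * ((n.factorial : ℝ)⁻¹ *
      ∑ s : Equiv.Perm (Fin n), g (Finset.univ.image fun l : Fin k =>
        s (splitEquiv h (Sum.inl l)))) := by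
  classical
  set J₀ : Finset (Fin n) := Finset.univ.image fun l : Fin k => splitEquiv h (Sum.inl l) with hJ₀
  have hinj : Function.Injective fun l : Fin k => splitEquiv h (Sum.inl l) :=
    (splitEquiv h).injective.comp Sum.inl_injective
  have h0 : ∀ s : Equiv.Perm (Fin n), (Finset.univ.image fun l : Fin k =>
      s (splitEquiv h (Sum.inl l))) = J₀.image s := by
    intro s
    rw [hJ₀, Finset.image_image]
    rfl
  simp_rw [h0]
  have h1 : ∀ s : Equiv.Perm (Fin n), ∑ J ∈ Finset.powersetCard k Finset.univ, g J
      = ∑ J ∈ Finset.powersetCard k Finset.univ, g (J.image s) := by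
    intro s
    refine (Finset.sum_nbij' (fun J => J.image s) (fun J => J.image s.symm) ?_ ?_ ?_ ?_ ?_).symm
    · intro J hJ
      rw [Finset.mem_powersetCard] at hJ ⊢
      exact ⟨Finset.subset_univ _, by rw [Finset.card_image_of_injective _ s.injective, hJ.2]⟩
    · intro J hJ
      rw [Finset.mem_powersetCard] at hJ ⊢
      exact ⟨Finset.subset_univ _, by rw [Finset.card_image_of_injective _ s.symm.injective, hJ.2]⟩
    · intro J _
      simp [Finset.image_image]
    · intro J _
      simp [Finset.image_image]
    · intro J _
      rfl
  have h2 : ∀ J ∈ Finset.powersetCard k (Finset.univ : Finset (Fin n)),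
      ∑ s : Equiv.Perm (Fin n), g (J.image s) = ∑ s : Equiv.Perm (Fin n), g (J₀.image s) := by
    intro J hJ
    have hc : J.card = k := (Finset.mem_powersetCard.1 hJ).2
    obtain ⟨t, ht⟩ := Equiv.Perm.exists_map_finset_eq J₀ J (by
      rw [hc, hJ₀, Finset.card_image_of_injective _ hinj, Finset.card_univ, Fintype.card_fin])
    have hJt : J = J₀.image t := by
      rw [← ht, Finset.map_eq_image]
      rfl
    rw [hJt]
    refine Fintype.sum_equiv (Equiv.mulRight t) _ _ fun s => ?_
    rw [Finset.image_image]
    rfl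
  have h3 : (n.factorial : ℝ) * ∑ J ∈ Finset.powersetCard k Finset.univ, g J
      = n.choose k * ∑ s : Equiv.Perm (Fin n), g (J₀.image s) := by
    calc (n.factorial : ℝ) * ∑ J ∈ Finset.powersetCard k Finset.univ, g J
        = ∑ s : Equiv.Perm (Fin n), ∑ J ∈ Finset.powersetCard k Finset.univ, g (J.image s) := by
          rw [← Finset.sum_congr rfl fun s _ => h1 s, Finset.sum_const, Finset.card_univ,
            Fintype.card_perm, Fintype.card_fin, nsmul_eq_mul]
      _ = _ := by
          rw [Finset.sum_comm, Finset.sum_congr rfl h2, Finset.sum_const,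
            Finset.card_powersetCard, Finset.card_univ, Fintype.card_fin, nsmul_eq_mul]
  have hn : (n.factorial : ℝ) ≠ 0 := by positivity
  field_simp
  linarith

/-- The expansion over subsets, grouped by cardinality and averaged over permutations, so that it
has the shape that symmetrization produces in the definition of `I_n`. The `attach` supplies `k ≤
n`, needed to split the coordinates. -/
theorem prod_add_eq_sum_perm {n : ℕ} (u v : Fin n → ℝ) :
    ∏ l, (u l + v l) = ∑ k ∈ (Finset.range (n + 1)).attach, (n.choose k : ℝ) *
      ((n.factorial : ℝ)⁻¹ * ∑ s : Equiv.Perm (Fin n),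
        (∏ l, u (s (splitEquiv (Nat.lt_succ_iff.1 (Finset.mem_range.1 k.2)) (Sum.inl l)))) *
          ∏ l, v (s (splitEquiv (Nat.lt_succ_iff.1 (Finset.mem_range.1 k.2)) (Sum.inr l)))) := by
  classical
  rw [Fintype.prod_add, ← Finset.powerset_univ, Finset.sum_powerset, Finset.card_univ,
    Fintype.card_fin, ← Finset.sum_attach (Finset.range (n + 1))]
  refine Finset.sum_congr rfl fun k _ => ?_
  have h : k.1 ≤ n := Nat.lt_succ_iff.1 (Finset.mem_range.1 k.2)
  rw [sum_powersetCard_eq_sum_perm h fun J => (∏ a ∈ J, u a) * ∏ a ∈ Jᶜ, v a]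
  congr 2
  refine Finset.sum_congr rfl fun s _ => ?_
  congr 1
  · rw [Finset.prod_image]
    exact (s.injective.comp ((splitEquiv h).injective.comp Sum.inl_injective)).injOn
  · have : (Finset.univ.image fun l : Fin k => s (splitEquiv h (Sum.inl l)))ᶜ
        = Finset.univ.image fun l : Fin (n - k) => s (splitEquiv h (Sum.inr l)) := by
      ext a
      obtain ⟨b, rfl⟩ := (((splitEquiv h).trans s).surjective a)
      cases b <;> simp
    rw [this, Finset.prod_image]
    exact (s.injective.comp ((splitEquiv h).injective.comp Sum.inr_injective)).injOn

/-- The indicator function of a product set. -/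
noncomputable def boxIndicator {n : ℕ} (A : Fin n → Set ℝ) (x : Fin n → ℝ) : ℝ :=
  ∏ l, (A l).indicator (1 : ℝ → ℝ) (x l)

theorem boxIndicator_eq {n : ℕ} (A : Fin n → Set ℝ) :
    boxIndicator A = (Set.univ.pi A).indicator 1 := by
  classical
  funext y
  rw [boxIndicator]
  by_cases h : y ∈ Set.univ.pi A
  · rw [Set.indicator_of_mem h, Finset.prod_eq_one]
    · rfl
    · intro l _
      rw [Set.indicator_of_mem (h l trivial)]
      rfl
  · rw [Set.indicator_of_notMem h]
    have : ∃ l, y l ∉ A l := by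
      by_contra hc
      push Not at hc
      exact h fun l _ => hc l
    obtain ⟨l, hl⟩ := this
    rw [Finset.prod_eq_zero (Finset.mem_univ l)]
    rw [Set.indicator_of_notMem hl]

theorem integral_boxIndicator {n : ℕ} (M : Measure (Fin n → ℝ)) {A : Fin n → Set ℝ}
    (hA : ∀ l, MeasurableSet (A l)) :
    ∫ x, boxIndicator A x ∂M = (M (Set.univ.pi A)).toReal := by
  rw [boxIndicator_eq, integral_indicator_one (MeasurableSet.univ_pi hA)]
  rfl

theorem integrable_boxIndicator {n : ℕ} {M : Measure (Fin n → ℝ)} {A : Fin n → Set ℝ}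
    (hA : ∀ l, MeasurableSet (A l)) (h : M (Set.univ.pi A) ≠ ∞) :
    Integrable (boxIndicator A) M := by
  rw [boxIndicator_eq]
  exact (integrable_indicator_iff (MeasurableSet.univ_pi hA)).2 (integrableOn_const h)

theorem symmetrization_boxIndicator_joinCoords {n k : ℕ} (h : k ≤ n) (A : Fin n → Set ℝ)
    (x : Fin k → ℝ) (y : Fin (n - k) → ℝ) :
    symmetrization (boxIndicator A) (joinCoords k x y) = (n.factorial : ℝ)⁻¹ *
      ∑ s : Equiv.Perm (Fin n), boxIndicator (fun l => A (s (splitEquiv h (Sum.inl l)))) x *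
        boxIndicator (fun l => A (s (splitEquiv h (Sum.inr l)))) y := by
  rw [symmetrization]
  congr 1
  -- Permuting the coordinates by `s` is the same as permuting the sets by the inverse of `s`.
  refine Fintype.sum_equiv (Equiv.inv _) _ _ fun s => ?_
  rw [boxIndicator, ← (s.symm).prod_comp, ← (splitEquiv h).prod_comp, Fintype.prod_sum_type]
  simp [boxIndicator, joinCoords_inl, joinCoords_inr]

theorem symMarginal_boxIndicator {n k : ℕ} (h : k ≤ n) {A : Fin n → Set ℝ}
    (hA : ∀ l, MeasurableSet (A l)) (hfin : ∀ l, volume (A l) ≠ ∞) (x : Fin k → ℝ) :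
    symMarginal k (boxIndicator A) x = (n.factorial : ℝ)⁻¹ *
      ∑ s : Equiv.Perm (Fin n), boxIndicator (fun l => A (s (splitEquiv h (Sum.inl l)))) x *
        ∏ l, (volume (A (s (splitEquiv h (Sum.inr l))))).toReal := by
  simp only [symMarginal, symmetrization_boxIndicator_joinCoords h]
  rw [integral_const_mul, integral_finsetSum]
  · congr 1
    refine Finset.sum_congr rfl fun s _ => ?_
    rw [integral_const_mul, integral_boxIndicator _ fun l => hA _, volume_pi, Measure.pi_pi,
      ENNReal.toReal_prod]
  · intro s _
    refine (integrable_boxIndicator (fun l => hA _) ?_).const_mul _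
    rw [volume_pi, Measure.pi_pi]
    exact (ENNReal.prod_lt_top fun l _ => (hfin _).lt_top).ne

theorem factorialMeasure_pi_injective (μ : Config) {n : ℕ} {A : Fin n → Set ℝ}
    (hA : ∀ j, MeasurableSet (A j)) (hd : Pairwise (Function.onFun Disjoint A))
    (hfin : ∀ j, μ.1 (A j) ≠ ∞) {k : ℕ} {i : Fin k → Fin n} (hi : Function.Injective i) :
    factorialMeasure k μ (Set.univ.pi fun l => A (i l)) = ∏ l, μ.1 (A (i l)) := by
  rw [factorialMeasure_pi_disjoint μ hA hd hfin,
    ← Finset.prod_fiberwise Finset.univ i fun l => μ.1 (A (i l))]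
  refine Finset.prod_congr rfl fun j _ => ?_
  rw [Finset.prod_congr rfl fun l hl => by rw [(Finset.mem_filter.1 hl).2], Finset.prod_const]
  have hc : (Finset.univ.filter fun l => i l = j).card ≤ 1 := by
    rw [Finset.card_le_one]
    intro a ha b hb
    exact hi ((Finset.mem_filter.1 ha).2.trans (Finset.mem_filter.1 hb).2.symm)
  interval_cases (Finset.univ.filter fun l => i l = j).card <;> simp [fallingFactorial]

/-- For disjoint sides there are no diagonal contributions, so every factorial measure factorizes on
the box. The alternating sum is then the expansion of the product of the differences. -/
theorem wienerItoFormula_boxIndicator {μ : Config} {n : ℕ} {A : Fin n → Set ℝ}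
    (hA : ∀ j, MeasurableSet (A j)) (hd : Pairwise (Function.onFun Disjoint A))
    (hfin : ∀ l, volume (A l) ≠ ∞) (hfin' : ∀ j, μ.1 (A j) ≠ ∞) :
    wienerItoFormula n (boxIndicator A) μ =
      ∏ l, ((μ.1 (A l)).toReal - (volume (A l)).toReal) := by
  simp_rw [sub_eq_add_neg]
  rw [wienerItoFormula_eq, prod_add_eq_sum_perm, ← Finset.sum_attach (Finset.range (n + 1))]
  refine Finset.sum_congr rfl fun k _ => ?_
  have h : k.1 ≤ n := Nat.lt_succ_iff.1 (Finset.mem_range.1 k.2)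
  have hinj : ∀ s : Equiv.Perm (Fin n), Function.Injective fun l : Fin k =>
      s (splitEquiv h (Sum.inl l)) := fun s =>
    s.injective.comp ((splitEquiv h).injective.comp Sum.inl_injective)
  simp_rw [symMarginal_boxIndicator h hA hfin]
  rw [integral_const_mul, integral_finsetSum]
  · rw [mul_assoc]
    congr 1
    rw [← mul_assoc, mul_comm ((-1 : ℝ) ^ (n - k)), mul_assoc, Finset.mul_sum]
    congr 1
    refine Finset.sum_congr rfl fun s _ => ?_
    rw [integral_mul_const, integral_boxIndicator _ fun l => hA _,
      factorialMeasure_pi_injective μ hA hd hfin' (hinj s), ENNReal.toReal_prod,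
      Finset.prod_neg, Finset.card_univ, Fintype.card_fin]
    ring
  · intro s _
    refine (integrable_boxIndicator (fun l => hA _) ?_).mul_const _
    rw [factorialMeasure_pi_injective μ hA hd hfin' (hinj s)]
    exact (ENNReal.prod_lt_top fun l _ => (hfin' _).lt_top).ne

/-! ### Second moments of off-diagonal step functions -/

theorem lintegral_natCast_poissonMeasure (r : ℝ≥0) :
    ∫⁻ n : ℕ, (n : ℝ≥0∞) ∂(poissonMeasure r) = r := by
  simpa using lintegral_poissonMeasure_mul r 1

theorem lintegral_natCast_mul_self_poissonMeasure (r : ℝ≥0) :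
    ∫⁻ n : ℕ, (n : ℝ≥0∞) * n ∂(poissonMeasure r) = r * (r + 1) := by
  rw [lintegral_poissonMeasure_mul r fun n => (n : ℝ≥0∞)]
  simp only [Nat.cast_add, Nat.cast_one]
  rw [lintegral_add_right _ measurable_const, lintegral_natCast_poissonMeasure]
  simp

theorem integrable_natCast_poissonMeasure (r : ℝ≥0) :
    Integrable (fun n : ℕ => (n : ℝ)) (poissonMeasure r) := by
  refine ⟨(measurable_of_countable _).aestronglyMeasurable, ?_⟩
  simp [HasFiniteIntegral, lintegral_natCast_poissonMeasure]

theorem integrable_natCast_mul_self_poissonMeasure (r : ℝ≥0) :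
    Integrable (fun n : ℕ => (n : ℝ) * n) (poissonMeasure r) := by
  refine ⟨(measurable_of_countable _).aestronglyMeasurable, ?_⟩
  have h : ∀ n : ℕ, ‖(n : ℝ)‖ₑ = n := fun n => by simp
  simp_rw [HasFiniteIntegral, enorm_mul, h]
  rw [lintegral_natCast_mul_self_poissonMeasure]
  exact ENNReal.mul_lt_top ENNReal.coe_lt_top (by simp)

theorem integral_natCast_poissonMeasure (r : ℝ≥0) :
    ∫ n : ℕ, (n : ℝ) ∂(poissonMeasure r) = r := by
  rw [integral_eq_lintegral_of_nonneg_ae (Filter.Eventually.of_forall fun n => Nat.cast_nonneg n)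
    (measurable_of_countable _).aestronglyMeasurable]
  simp [lintegral_natCast_poissonMeasure]

theorem integral_natCast_mul_self_poissonMeasure (r : ℝ≥0) :
    ∫ n : ℕ, (n : ℝ) * n ∂(poissonMeasure r) = r * (r + 1) := by
  rw [integral_eq_lintegral_of_nonneg_ae (Filter.Eventually.of_forall fun n => by positivity)
    (measurable_of_countable _).aestronglyMeasurable]
  simp_rw [ENNReal.ofReal_mul (Nat.cast_nonneg _), ENNReal.ofReal_natCast]
  rw [lintegral_natCast_mul_self_poissonMeasure]
  simp [ENNReal.toReal_mul, ENNReal.toReal_add]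

/-- Injective tuples with the same range differ by a permutation. This is the source of the factor
`n!` in the second moment bound. -/
theorem card_filter_image_eq_le {ι : Type*} [DecidableEq ι] {n : ℕ} (S : Finset (Fin n → ι))
    (hS : ∀ i ∈ S, Function.Injective i) {i : Fin n → ι} (hi : Function.Injective i) :
    (S.filter fun i' => Finset.univ.image i = Finset.univ.image i').card ≤ n.factorial := by
  have h : S.filter (fun i' => Finset.univ.image i = Finset.univ.image i') ⊆
      (Finset.univ : Finset (Equiv.Perm (Fin n))).image fun s : Equiv.Perm (Fin n) => i ∘ s := by
    intro i' hi'
    obtain ⟨h1, h2⟩ := Finset.mem_filter.1 hi'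
    have h3 : Set.range i = Set.range i' := by
      have := congrArg (fun T : Finset ι => (T : Set ι)) h2
      simpa using this
    refine Finset.mem_image.2 ⟨((Equiv.ofInjective i' (hS i' h1)).trans
      (Equiv.setCongr h3.symm)).trans (Equiv.ofInjective i hi).symm, Finset.mem_univ _, ?_⟩
    funext l
    simp only [Function.comp_apply, Equiv.trans_apply]
    rw [Equiv.apply_ofInjective_symm hi]
    rfl
  refine (Finset.card_le_card h).trans (Finset.card_image_le.trans ?_)
  rw [Finset.card_univ, Fintype.card_perm, Fintype.card_fin]

section Poisson

variable {Ω₀ : Type*} [MeasurableSpace Ω₀] {Q : Measure Ω₀} {ζ : Ω₀ → Config}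

theorem IsPoissonProcess.map_apply_eq (hζ : IsPoissonProcess ζ volume Q) {B : Set ℝ}
    (hB : MeasurableSet B) (hfin : volume B ≠ ∞) : Q.map (fun ω => (ζ ω).1 B)
      = (poissonMeasure (volume B).toNNReal).map fun n : ℕ => (n : ℝ≥0∞) := by
  rw [hζ.law B hB, poissonLaw, if_neg hfin]

theorem IsPoissonProcess.integral_comp (hζ : IsPoissonProcess ζ volume Q) {B : Set ℝ}
    (hB : MeasurableSet B) (hfin : volume B ≠ ∞) {g : ℝ≥0∞ → ℝ} (hg : Measurable g) :
    ∫ ω, g ((ζ ω).1 B) ∂Q = ∫ n : ℕ, g n ∂(poissonMeasure (volume B).toNNReal) := by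
  have hm : Measurable fun ω => (ζ ω).1 B := (measurable_config_apply hB).comp hζ.measurable
  rw [← integral_map (φ := fun ω => (ζ ω).1 B) hm.aemeasurable hg.aestronglyMeasurable,
    hζ.map_apply_eq hB hfin,
    integral_map (measurable_of_countable _).aemeasurable hg.aestronglyMeasurable]

theorem IsPoissonProcess.integrable_comp_iff (hζ : IsPoissonProcess ζ volume Q) {B : Set ℝ}
    (hB : MeasurableSet B) (hfin : volume B ≠ ∞) {g : ℝ≥0∞ → ℝ} (hg : Measurable g) :
    Integrable (fun ω => g ((ζ ω).1 B)) Q ↔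
      Integrable (fun n : ℕ => g n) (poissonMeasure (volume B).toNNReal) := by
  have hm : Measurable fun ω => (ζ ω).1 B := (measurable_config_apply hB).comp hζ.measurable
  have h1 := integrable_map_measure (μ := Q) (f := fun ω => (ζ ω).1 B)
    hg.aestronglyMeasurable hm.aemeasurable
  rw [hζ.map_apply_eq hB hfin, integrable_map_measure hg.aestronglyMeasurable
    (measurable_of_countable _).aemeasurable] at h1
  exact h1.symm

/-- The centered number of points in `B`. -/
noncomputable def centeredCount (B : Set ℝ) (μ : Config) : ℝ :=
  (μ.1 B).toReal - (volume B).toReal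

theorem measurable_centeredCount {B : Set ℝ} (hB : MeasurableSet B) :
    Measurable (centeredCount B) :=
  (measurable_config_apply hB).ennreal_toReal.sub_const _

theorem IsPoissonProcess.integrable_centeredCount (hζ : IsPoissonProcess ζ volume Q) {B : Set ℝ}
    (hB : MeasurableSet B) (hfin : volume B ≠ ∞) :
    Integrable (fun ω => centeredCount B (ζ ω)) Q := by
  refine (hζ.integrable_comp_iff hB hfin (g := fun r => r.toReal - (volume B).toReal)
    (ENNReal.measurable_toReal.sub_const _)).2 ?_
  exact (integrable_natCast_poissonMeasure _).sub (integrable_const _)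

theorem IsPoissonProcess.integral_centeredCount (hζ : IsPoissonProcess ζ volume Q) {B : Set ℝ}
    (hB : MeasurableSet B) (hfin : volume B ≠ ∞) :
    ∫ ω, centeredCount B (ζ ω) ∂Q = 0 := by
  refine (hζ.integral_comp hB hfin (g := fun r => r.toReal - (volume B).toReal)
    (ENNReal.measurable_toReal.sub_const _)).trans ?_
  simp only [ENNReal.toReal_natCast]
  rw [integral_sub (integrable_natCast_poissonMeasure _) (integrable_const _),
    integral_natCast_poissonMeasure]
  simp [ENNReal.toReal]

theorem IsPoissonProcess.integrable_centeredCount_mul_self (hζ : IsPoissonProcess ζ volume Q)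
    {B : Set ℝ} (hB : MeasurableSet B) (hfin : volume B ≠ ∞) :
    Integrable (fun ω => centeredCount B (ζ ω) * centeredCount B (ζ ω)) Q := by
  have hm : Measurable fun r : ℝ≥0∞ => r.toReal - (volume B).toReal :=
    ENNReal.measurable_toReal.sub_const _
  refine (hζ.integrable_comp_iff hB hfin (g := fun r => (r.toReal - (volume B).toReal)
    * (r.toReal - (volume B).toReal)) (hm.mul hm)).2 ?_
  simp only [ENNReal.toReal_natCast]
  have h := ((integrable_natCast_mul_self_poissonMeasure (volume B).toNNReal).sub
    ((integrable_natCast_poissonMeasure _).const_mul (2 * (volume B).toReal))).add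
      (integrable_const ((volume B).toReal * (volume B).toReal))
  refine h.congr (Filter.Eventually.of_forall fun n => ?_)
  simp only [Pi.add_apply, Pi.sub_apply]
  ring

theorem IsPoissonProcess.integral_centeredCount_mul_self (hζ : IsPoissonProcess ζ volume Q)
    {B : Set ℝ} (hB : MeasurableSet B) (hfin : volume B ≠ ∞) :
    ∫ ω, centeredCount B (ζ ω) * centeredCount B (ζ ω) ∂Q = (volume B).toReal := by
  have hm : Measurable fun r : ℝ≥0∞ => r.toReal - (volume B).toReal :=
    ENNReal.measurable_toReal.sub_const _
  refine (hζ.integral_comp hB hfin (g := fun r => (r.toReal - (volume B).toReal)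
    * (r.toReal - (volume B).toReal)) (hm.mul hm)).trans ?_
  simp only [ENNReal.toReal_natCast]
  have h : ∀ n : ℕ, ((n : ℝ) - (volume B).toReal) * ((n : ℝ) - (volume B).toReal)
      = ((n : ℝ) * n - 2 * (volume B).toReal * n) + (volume B).toReal * (volume B).toReal := by
    intro n; ring
  simp_rw [h]
  have i1 := integrable_natCast_mul_self_poissonMeasure (volume B).toNNReal
  have i2 := (integrable_natCast_poissonMeasure (volume B).toNNReal).const_mul
    (2 * (volume B).toReal)
  have i3 : Integrable (fun n : ℕ => (n : ℝ) * n - 2 * (volume B).toReal * n)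
    (poissonMeasure (volume B).toNNReal) := i1.sub i2
  rw [integral_add i3 (integrable_const _), integral_sub i1 i2, integral_const_mul,
    integral_natCast_mul_self_poissonMeasure, integral_natCast_poissonMeasure]
  simp only [ENNReal.toReal, integral_const, probReal_univ, smul_eq_mul]
  ring

/-- Two products along different tuples become products over one common index set, so that
independence can be applied factor by factor. -/
theorem prod_comp_injective_eq {ι : Type*} [Fintype ι] [DecidableEq ι] {n : ℕ} {i : Fin n → ι}
    (hi : Function.Injective i) (X : ι → ℝ) :
    ∏ l, X (i l) = ∏ j, if j ∈ Finset.univ.image i then X j else 1 := by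
  rw [Finset.prod_ite_mem, Finset.univ_inter, Finset.prod_image hi.injOn]

theorem prod_mul_prod_comp_injective {ι : Type*} [Fintype ι] [DecidableEq ι] {n : ℕ}
    {i i' : Fin n → ι} (hi : Function.Injective i) (hi' : Function.Injective i') (X : ι → ℝ) :
    (∏ l, X (i l)) * ∏ l, X (i' l) = ∏ j, (if j ∈ Finset.univ.image i then X j else 1) *
      (if j ∈ Finset.univ.image i' then X j else 1) := by
  rw [prod_comp_injective_eq hi, prod_comp_injective_eq hi', Finset.prod_mul_distrib]

variable {ι : Type*} [Fintype ι] {A : ι → Set ℝ}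

theorem IsPoissonProcess.iIndepFun_centeredCount (hζ : IsPoissonProcess ζ volume Q)
    (hA : ∀ j, MeasurableSet (A j)) (hd : Pairwise (Function.onFun Disjoint A)) :
    iIndepFun (fun j ω => centeredCount (A j) (ζ ω)) Q :=
  (hζ.iIndepFun_of_fintype hA hd).comp (fun j r => r.toReal - (volume (A j)).toReal)
    fun _ => ENNReal.measurable_toReal.sub_const _

theorem measurable_ite_mul_ite (p q : Prop) [Decidable p] [Decidable q] :
    Measurable fun t : ℝ => (if p then t else 1) * (if q then t else 1) := by
  split_ifs <;> fun_prop

theorem IsPoissonProcess.integrable_ite_mul_ite (hζ : IsPoissonProcess ζ volume Q)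
    [IsProbabilityMeasure Q] {B : Set ℝ} (hB : MeasurableSet B) (hfin : volume B ≠ ∞)
    (p q : Prop) [Decidable p] [Decidable q] :
    Integrable (fun ω => (if p then centeredCount B (ζ ω) else 1) *
      (if q then centeredCount B (ζ ω) else 1)) Q := by
  split_ifs
  · exact hζ.integrable_centeredCount_mul_self hB hfin
  · simpa using hζ.integrable_centeredCount hB hfin
  · simpa using hζ.integrable_centeredCount hB hfin
  · exact integrable_const _

theorem IsPoissonProcess.integrable_prod_mul_prod (hζ : IsPoissonProcess ζ volume Q)
    [IsProbabilityMeasure Q] (hA : ∀ j, MeasurableSet (A j))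
    (hd : Pairwise (Function.onFun Disjoint A)) (hfin : ∀ j, volume (A j) ≠ ∞) {n : ℕ}
    {i i' : Fin n → ι} (hi : Function.Injective i) (hi' : Function.Injective i') :
    Integrable (fun ω => (∏ l, centeredCount (A (i l)) (ζ ω)) *
      ∏ l, centeredCount (A (i' l)) (ζ ω)) Q := by
  classical
  have h := fun ω => prod_mul_prod_comp_injective hi hi' fun j => centeredCount (A j) (ζ ω)
  simp_rw [h]
  have hm : ∀ j, Measurable fun ω => centeredCount (A j) (ζ ω) := fun j =>
    (measurable_centeredCount (hA j)).comp hζ.measurable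
  refine ⟨(Finset.measurable_fun_prod _ fun j _ =>
    (measurable_ite_mul_ite _ _).comp (hm j)).aestronglyMeasurable, ?_⟩
  have he : ∀ ω, ‖∏ j, (if j ∈ Finset.univ.image i then centeredCount (A j) (ζ ω) else 1) *
      (if j ∈ Finset.univ.image i' then centeredCount (A j) (ζ ω) else 1)‖ₑ
      = ∏ j, ‖(if j ∈ Finset.univ.image i then centeredCount (A j) (ζ ω) else 1) *
      (if j ∈ Finset.univ.image i' then centeredCount (A j) (ζ ω) else 1)‖ₑ := by
    intro ω
    simp only [enorm_eq_nnnorm, nnnorm_prod, ENNReal.ofNNReal_finsetProd]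
  rw [HasFiniteIntegral, lintegral_congr he, lintegral_prod_eq_prod_lintegral_of_indepFun
    Finset.univ (fun j ω => ‖(if j ∈ Finset.univ.image i then centeredCount (A j) (ζ ω) else 1) *
      (if j ∈ Finset.univ.image i' then centeredCount (A j) (ζ ω) else 1)‖ₑ)]
  · exact ENNReal.prod_lt_top fun j _ =>
      (hζ.integrable_ite_mul_ite (hA j) (hfin j) _ _).hasFiniteIntegral
  · exact (hζ.iIndepFun_centeredCount hA hd).comp
      (fun j (t : ℝ) => ‖(if j ∈ Finset.univ.image i then t else 1) *
        (if j ∈ Finset.univ.image i' then t else 1)‖ₑ)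
      fun j => (measurable_ite_mul_ite _ _).enorm
  · exact fun j => ((measurable_ite_mul_ite _ _).comp (hm j)).enorm

/-- By independence the expectation factorizes over `j`. A set met by only one of the tuples
contributes a centred count, of mean zero; a set met by both contributes the variance, which is its
volume. -/
theorem IsPoissonProcess.integral_prod_mul_prod [DecidableEq ι] (hζ : IsPoissonProcess ζ volume Q)
    [IsProbabilityMeasure Q] (hA : ∀ j, MeasurableSet (A j))
    (hd : Pairwise (Function.onFun Disjoint A)) (hfin : ∀ j, volume (A j) ≠ ∞) {n : ℕ}
    {i i' : Fin n → ι} (hi : Function.Injective i) (hi' : Function.Injective i') :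
    ∫ ω, (∏ l, centeredCount (A (i l)) (ζ ω)) * ∏ l, centeredCount (A (i' l)) (ζ ω) ∂Q =
      if Finset.univ.image i = Finset.univ.image i' then ∏ l, (volume (A (i l))).toReal else 0 := by
  have h := fun ω => prod_mul_prod_comp_injective hi hi' fun j => centeredCount (A j) (ζ ω)
  simp_rw [h]
  have hm : ∀ j, Measurable fun ω => centeredCount (A j) (ζ ω) := fun j =>
    (measurable_centeredCount (hA j)).comp hζ.measurable
  rw [(hζ.iIndepFun_centeredCount hA hd).integral_fun_prod_comp
    (f := fun j (t : ℝ) => (if j ∈ Finset.univ.image i then t else 1) *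
      (if j ∈ Finset.univ.image i' then t else 1)) (fun j => (hm j).aemeasurable)
    fun j => (measurable_ite_mul_ite _ _).aestronglyMeasurable]
  split_ifs with hii
  · rw [prod_comp_injective_eq hi fun j => (volume (A j)).toReal]
    refine Finset.prod_congr rfl fun j _ => ?_
    rw [← hii]
    split_ifs
    · exact hζ.integral_centeredCount_mul_self (hA j) (hfin j)
    · simp
  · obtain ⟨j, hj⟩ : ∃ j, ¬ (j ∈ Finset.univ.image i ↔ j ∈ Finset.univ.image i') := by
      by_contra hc
      push Not at hc
      exact hii (Finset.ext hc)
    refine Finset.prod_eq_zero (Finset.mem_univ j) ?_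
    by_cases h1 : j ∈ Finset.univ.image i <;> by_cases h2 : j ∈ Finset.univ.image i'
    · exact absurd (iff_of_true h1 h2) hj
    · simp only [h1, h2, if_true, if_false, mul_one]
      exact hζ.integral_centeredCount (hA j) (hfin j)
    · simp only [h1, h2, if_true, if_false, one_mul]
      exact hζ.integral_centeredCount (hA j) (hfin j)
    · exact absurd (iff_of_false h1 h2) hj

/-- In the expanded square only pairs of tuples with equal range survive, and each tuple has at most
`n!` partners. -/
theorem IsPoissonProcess.integral_sq_sum_prod_le (hζ : IsPoissonProcess ζ volume Q)
    [IsProbabilityMeasure Q] (hA : ∀ j, MeasurableSet (A j))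
    (hd : Pairwise (Function.onFun Disjoint A)) (hfin : ∀ j, volume (A j) ≠ ∞) {n : ℕ}
    (S : Finset (Fin n → ι)) (hS : ∀ i ∈ S, Function.Injective i) (c : (Fin n → ι) → ℝ) :
    Integrable (fun ω => (∑ i ∈ S, c i * ∏ l, centeredCount (A (i l)) (ζ ω)) ^ 2) Q ∧
    ∫ ω, (∑ i ∈ S, c i * ∏ l, centeredCount (A (i l)) (ζ ω)) ^ 2 ∂Q ≤
      n.factorial * ∑ i ∈ S, c i ^ 2 * ∏ l, (volume (A (i l))).toReal := by
  classical
  have h1 : ∀ ω, (∑ i ∈ S, c i * ∏ l, centeredCount (A (i l)) (ζ ω)) ^ 2 =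
      ∑ i ∈ S, ∑ i' ∈ S, c i * c i' * ((∏ l, centeredCount (A (i l)) (ζ ω)) *
        ∏ l, centeredCount (A (i' l)) (ζ ω)) := by
    intro ω
    rw [sq, Finset.sum_mul_sum]
    refine Finset.sum_congr rfl fun i _ => Finset.sum_congr rfl fun i' _ => ?_
    ring
  have hint : ∀ i ∈ S, ∀ i' ∈ S, Integrable (fun ω => c i * c i' *
      ((∏ l, centeredCount (A (i l)) (ζ ω)) * ∏ l, centeredCount (A (i' l)) (ζ ω))) Q :=
    fun i hi i' hi' =>
      (hζ.integrable_prod_mul_prod hA hd hfin (hS i hi) (hS i' hi')).const_mul _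
  simp_rw [h1]
  refine ⟨integrable_finsetSum _ fun i hi => integrable_finsetSum _ fun i' hi' =>
    hint i hi i' hi', ?_⟩
  rw [integral_finsetSum _ fun i hi => integrable_finsetSum _ fun i' hi' => hint i hi i' hi']
  set L : (Fin n → ι) → ℝ := fun i => ∏ l, (volume (A (i l))).toReal with hL
  have hL0 : ∀ i, 0 ≤ L i := fun i => Finset.prod_nonneg fun l _ => ENNReal.toReal_nonneg
  have hLL : ∀ i ∈ S, ∀ i' ∈ S, Finset.univ.image i = Finset.univ.image i' → L i = L i' := by
    intro i hi i' hi' h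
    simp only [hL]
    rw [prod_comp_injective_eq (hS i hi) fun j => (volume (A j)).toReal,
      prod_comp_injective_eq (hS i' hi') fun j => (volume (A j)).toReal, h]
  calc ∑ i ∈ S, ∫ ω, ∑ i' ∈ S, c i * c i' * ((∏ l, centeredCount (A (i l)) (ζ ω)) *
        ∏ l, centeredCount (A (i' l)) (ζ ω)) ∂Q
      = ∑ i ∈ S, ∑ i' ∈ S, if Finset.univ.image i = Finset.univ.image i'
          then c i * c i' * L i else 0 := by
        refine Finset.sum_congr rfl fun i hi => ?_
        rw [integral_finsetSum _ fun i' hi' => hint i hi i' hi']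
        refine Finset.sum_congr rfl fun i' hi' => ?_
        rw [integral_const_mul, hζ.integral_prod_mul_prod hA hd hfin (hS i hi) (hS i' hi')]
        split_ifs
        · rfl
        · simp
    -- Bound `c i * c i'` by half the sum of squares. The second condition is written with its sides
    -- swapped so that exchanging the two sums turns the second half into the first.
    _ ≤ ∑ i ∈ S, ∑ i' ∈ S, ((if Finset.univ.image i = Finset.univ.image i'
          then c i ^ 2 * L i / 2 else 0) + if Finset.univ.image i' = Finset.univ.image i
          then c i' ^ 2 * L i' / 2 else 0) := by
        refine Finset.sum_le_sum fun i hi => Finset.sum_le_sum fun i' hi' => ?_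
        by_cases h : Finset.univ.image i = Finset.univ.image i'
        · rw [if_pos h, if_pos h, if_pos h.symm, ← hLL i hi i' hi' h]
          nlinarith [hL0 i, mul_nonneg (sq_nonneg (c i - c i')) (hL0 i)]
        · rw [if_neg h, if_neg h, if_neg (Ne.symm h)]
          simp
    _ = ∑ i ∈ S, (S.filter fun i' => Finset.univ.image i = Finset.univ.image i').card *
          (c i ^ 2 * L i) := by
        simp_rw [Finset.sum_add_distrib]
        rw [Finset.sum_comm (s := S) (t := S) (f := fun i i' =>
          if Finset.univ.image i' = Finset.univ.image i then c i' ^ 2 * L i' / 2 else 0),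
          ← Finset.sum_add_distrib]
        refine Finset.sum_congr rfl fun i _ => ?_
        rw [← Finset.sum_filter, Finset.sum_const, nsmul_eq_mul]
        ring
    _ ≤ ∑ i ∈ S, n.factorial * (c i ^ 2 * L i) := by
        refine Finset.sum_le_sum fun i hi => ?_
        have := card_filter_image_eq_le S hS (hS i hi)
        have h0 : 0 ≤ c i ^ 2 * L i := mul_nonneg (sq_nonneg _) (hL0 i)
        gcongr
    _ = _ := by rw [Finset.mul_sum]

end Poisson

/-! ### Boundedness of the multiple Wiener-Itô integral -/

theorem eLpNorm_two_sq_eq_lintegral {α : Type*} [MeasurableSpace α] {μ : Measure α} (F : α → ℝ) :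
    eLpNorm F 2 μ ^ 2 = ∫⁻ x, ‖F x‖ₑ ^ 2 ∂μ := by
  have h := eLpNorm_nnreal_pow_eq_lintegral (μ := μ) (f := F) (p := 2) two_ne_zero
  simpa using h

theorem eLpNorm_two_sq {α : Type*} [MeasurableSpace α] {μ : Measure α} {F : α → ℝ}
    (hF : Integrable (fun x => F x ^ 2) μ) :
    eLpNorm F 2 μ ^ 2 = ENNReal.ofReal (∫ x, F x ^ 2 ∂μ) := by
  rw [eLpNorm_two_sq_eq_lintegral,
    ofReal_integral_eq_lintegral_ofReal hF (Filter.Eventually.of_forall fun x => sq_nonneg _)]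
  refine lintegral_congr fun x => ?_
  rw [← ofReal_norm, ← ENNReal.ofReal_pow (norm_nonneg _), Real.norm_eq_abs, sq_abs]

theorem tendsto_eLpNorm_sub_of_dominated {α : Type*} [MeasurableSpace α] {μ : Measure α}
    {p : ℝ≥0∞} (hp0 : p ≠ 0) (hp : p ≠ ∞) {h : ℕ → α → ℝ} {g B : α → ℝ} (hB : MemLp B p μ)
    (hm : ∀ j, AEStronglyMeasurable (h j) μ) (hg : AEStronglyMeasurable g μ)
    (hle : ∀ j, ∀ᵐ x ∂μ, |h j x - g x| ≤ B x)
    (hlim : ∀ᵐ x ∂μ, Filter.Tendsto (fun j => h j x) Filter.atTop (nhds (g x))) :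
    Filter.Tendsto (fun j => eLpNorm (h j - g) p μ) Filter.atTop (nhds 0) := by
  have hpos : 0 < p.toReal := ENNReal.toReal_pos hp0 hp
  have h1 : Filter.Tendsto (fun j => ∫⁻ x, ‖(h j - g) x‖ₑ ^ p.toReal ∂μ) Filter.atTop
      (nhds (∫⁻ _, 0 ∂μ)) := by
    refine tendsto_lintegral_of_dominated_convergence' (fun x => ‖B x‖ₑ ^ p.toReal)
      (fun j => ((hm j).sub hg).enorm.pow_const _) ?_ ?_ ?_
    · intro j
      filter_upwards [hle j] with x hx
      gcongr
      refine enorm_le_iff_norm_le.2 ?_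
      rw [Pi.sub_apply, Real.norm_eq_abs, Real.norm_eq_abs]
      exact hx.trans (le_abs_self _)
    · exact (lintegral_rpow_enorm_lt_top_of_eLpNorm_lt_top hp0 hp hB.2).ne
    · filter_upwards [hlim] with x hx
      have h2 : Filter.Tendsto (fun j => h j x - g x) Filter.atTop (nhds 0) := by
        simpa using hx.sub_const (g x)
      have h3 := (h2.enorm).ennrpow_const p.toReal
      simpa [hpos] using h3
  rw [lintegral_zero] at h1
  simp_rw [eLpNorm_eq_lintegral_rpow_enorm_toReal hp0 hp]
  have h4 := h1.ennrpow_const (1 / p.toReal)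
  simpa [hpos] using h4

section General

variable {π : Measure Config} [IsProbabilityMeasure π]

theorem HasLebesgueFactorialMoments.eLpNorm_one_wienerItoFormula_sub_le
    (hπ : HasLebesgueFactorialMoments π) {n : ℕ} {f g : (Fin n → ℝ) → ℝ} (hf : Integrable f)
    (hg : Integrable g) : eLpNorm (wienerItoFormula n f - wienerItoFormula n g) 1 π ≤
      2 ^ n * eLpNorm (f - g) 1 volume := by
  rw [← eLpNorm_congr_ae (hπ.wienerItoFormula_sub hf hg), eLpNorm_one_eq_lintegral_enorm,
    eLpNorm_one_eq_lintegral_enorm]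
  exact hπ.lintegral_enorm_wienerItoFormula_le (hf.sub hg)

theorem HasLebesgueFactorialMoments.tendsto_wienerItoFormula
    (hπ : HasLebesgueFactorialMoments π) {n : ℕ} {f : ℕ → (Fin n → ℝ) → ℝ}
    {g : (Fin n → ℝ) → ℝ} (hf : ∀ j, Integrable (f j)) (hg : Integrable g)
    (h : Filter.Tendsto (fun j => eLpNorm (f j - g) 1 volume) Filter.atTop (nhds 0)) :
    Filter.Tendsto (fun j => eLpNorm (wienerItoFormula n (f j) - wienerItoFormula n g) 1 π)
      Filter.atTop (nhds 0) := by
  refine tendsto_of_tendsto_of_tendsto_of_le_of_le tendsto_const_nhds ?_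
    (fun _ => zero_le) fun j => hπ.eLpNorm_one_wienerItoFormula_sub_le (hf j) hg
  have := ENNReal.Tendsto.const_mul (a := (2 : ℝ≥0∞) ^ n) h (Or.inr (by simp))
  simpa using this

/-- Convergence in `L¹` makes the formulas converge in measure, and the `L²` norm is lower
semicontinuous under convergence in measure. Convergence in `L²` is used only to control the
right-hand sides. -/
theorem HasLebesgueFactorialMoments.eLpNorm_wienerItoFormula_le_of_tendsto
    (hπ : HasLebesgueFactorialMoments π) {n : ℕ} {f : ℕ → (Fin n → ℝ) → ℝ}
    {g : (Fin n → ℝ) → ℝ} (hf : ∀ j, Integrable (f j)) (hg : Integrable g)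
    (h1 : Filter.Tendsto (fun j => eLpNorm (f j - g) 1 volume) Filter.atTop (nhds 0))
    (h2 : Filter.Tendsto (fun j => eLpNorm (f j - g) 2 volume) Filter.atTop (nhds 0))
    {C : ℝ≥0∞} (hC : C ≠ ∞)
    (hle : ∀ j, eLpNorm (wienerItoFormula n (f j)) 2 π ≤ C * eLpNorm (f j) 2 volume) :
    eLpNorm (wienerItoFormula n g) 2 π ≤ C * eLpNorm g 2 volume := by
  -- Lower semicontinuity is applied with a bound that is constant in `j`, so the norm of `g` is
  -- enlarged by `ε`, which tends to zero afterwards.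
  have hlim : Filter.Tendsto (fun ε : ℝ≥0∞ => C * (eLpNorm g 2 volume + ε))
      (nhdsWithin 0 (Set.Ioi 0)) (nhds (C * (eLpNorm g 2 volume + 0))) := by
    refine ENNReal.Tendsto.const_mul ?_ (Or.inr hC)
    exact (tendsto_const_nhds.add Filter.tendsto_id).mono_left nhdsWithin_le_nhds
  rw [add_zero] at hlim
  refine ge_of_tendsto hlim ?_
  filter_upwards [self_mem_nhdsWithin] with ε hε
  refine eLpNorm_le_of_tendstoInMeasure (u := Filter.atTop) (f := fun j => wienerItoFormula n (f j))
    ?_ (tendstoInMeasure_of_tendsto_eLpNorm one_ne_zero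
      (fun j => hπ.aestronglyMeasurable_wienerItoFormula (hf j))
      (hπ.aestronglyMeasurable_wienerItoFormula hg)
      (hπ.tendsto_wienerItoFormula hf hg h1))
    (fun j => hπ.aestronglyMeasurable_wienerItoFormula (hf j))
  filter_upwards [h2.eventually_le_const hε] with j hj
  refine (hle j).trans ?_
  gcongr
  calc eLpNorm (f j) 2 volume = eLpNorm (g + (f j - g)) 2 volume := by rw [add_sub_cancel]
    _ ≤ eLpNorm g 2 volume + eLpNorm (f j - g) 2 volume :=
        eLpNorm_add_le hg.aestronglyMeasurable
          ((hf j).sub hg).aestronglyMeasurable (by norm_num)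
    _ ≤ _ := by gcongr

end General

section Poisson

variable {Ω₀ : Type*} [MeasurableSpace Ω₀] {Q : Measure Ω₀} [IsProbabilityMeasure Q]
  {ζ : Ω₀ → Config}

theorem IsPoissonProcess.isProbabilityMeasure_map (hζ : IsPoissonProcess ζ volume Q) :
    IsProbabilityMeasure (Q.map ζ) :=
  Measure.isProbabilityMeasure_map hζ.measurable.aemeasurable

theorem boxIndicator_mul_boxIndicator {ι : Type*} [DecidableEq ι] {n : ℕ} {A : ι → Set ℝ}
    (hd : Pairwise (Function.onFun Disjoint A)) (i i' : Fin n → ι) (x : Fin n → ℝ) :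
    boxIndicator (fun l => A (i l)) x * boxIndicator (fun l => A (i' l)) x =
      if i = i' then boxIndicator (fun l => A (i l)) x else 0 := by
  rw [boxIndicator_eq, boxIndicator_eq]
  split_ifs with h
  · subst h
    by_cases hx : x ∈ Set.univ.pi fun l => A (i l)
    · simp [Set.indicator_of_mem hx]
    · simp [Set.indicator_of_notMem hx]
  · by_contra hne
    obtain ⟨h1, h2⟩ := mul_ne_zero_iff.1 hne
    have h3 := Set.mem_of_indicator_ne_zero h1
    have h4 := Set.mem_of_indicator_ne_zero h2
    refine h (funext fun l => ?_)
    by_contra hl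
    exact Set.disjoint_left.1 (hd hl) (h3 l trivial) (h4 l trivial)

theorem integral_sq_sum_boxIndicator {ι : Type*} {n : ℕ} {A : ι → Set ℝ}
    (hA : ∀ j, MeasurableSet (A j)) (hd : Pairwise (Function.onFun Disjoint A))
    (hfin : ∀ j, volume (A j) ≠ ∞) (S : Finset (Fin n → ι)) (c : (Fin n → ι) → ℝ) :
    Integrable (fun x => (∑ i ∈ S, c i • boxIndicator fun l => A (i l)) x ^ 2) ∧
    ∫ x, (∑ i ∈ S, c i • boxIndicator fun l => A (i l)) x ^ 2 =
      ∑ i ∈ S, c i ^ 2 * ∏ l, (volume (A (i l))).toReal := by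
  classical
  have h1 : ∀ x, (∑ i ∈ S, c i • boxIndicator fun l => A (i l)) x ^ 2
      = ∑ i ∈ S, c i ^ 2 * boxIndicator (fun l => A (i l)) x := by
    intro x
    rw [Finset.sum_apply, sq, Finset.sum_mul_sum]
    refine Finset.sum_congr rfl fun i hi => ?_
    rw [Finset.sum_eq_single i]
    · have := boxIndicator_mul_boxIndicator hd i i x
      rw [if_pos rfl] at this
      simp only [Pi.smul_apply, smul_eq_mul]
      linear_combination c i ^ 2 * this
    · intro i' _ hne
      have := boxIndicator_mul_boxIndicator hd i i' x
      rw [if_neg (Ne.symm hne)] at this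
      simp only [Pi.smul_apply, smul_eq_mul]
      linear_combination c i * c i' * this
    · exact fun h => absurd hi h
  have hvol : ∀ i : Fin n → ι, volume (Set.univ.pi fun l => A (i l)) = ∏ l, volume (A (i l)) :=
    fun i => by rw [volume_pi, Measure.pi_pi]
  have hint : ∀ i ∈ S, Integrable fun x => c i ^ 2 * boxIndicator (fun l => A (i l)) x := by
    intro i _
    refine (integrable_boxIndicator (fun l => hA _) ?_).const_mul _
    rw [hvol]
    exact (ENNReal.prod_lt_top fun l _ => (hfin _).lt_top).ne
  simp_rw [h1]
  refine ⟨integrable_finsetSum _ hint, ?_⟩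
  rw [integral_finsetSum _ hint]
  refine Finset.sum_congr rfl fun i _ => ?_
  rw [integral_const_mul, integral_boxIndicator _ fun l => hA _, hvol, ENNReal.toReal_prod]

theorem IsPoissonProcess.eLpNorm_wienerItoFormula_step_le (hζ : IsPoissonProcess ζ volume Q)
    {ι : Type*} [Fintype ι] {A : ι → Set ℝ}
    (hA : ∀ j, MeasurableSet (A j)) (hd : Pairwise (Function.onFun Disjoint A))
    (hfin : ∀ j, volume (A j) ≠ ∞) {n : ℕ} (S : Finset (Fin n → ι))
    (hS : ∀ i ∈ S, Function.Injective i) (c : (Fin n → ι) → ℝ) :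
    eLpNorm (wienerItoFormula n (∑ i ∈ S, c i • boxIndicator fun l => A (i l))) 2 (Q.map ζ) ≤
      n.factorial * eLpNorm (∑ i ∈ S, c i • boxIndicator fun l => A (i l)) 2 volume := by
  have := hζ.isProbabilityMeasure_map
  have hπ := hζ.hasLebesgueFactorialMoments
  have hm : Measurable fun μ : Config => ∑ i ∈ S, c i * ∏ l, centeredCount (A (i l)) μ :=
    Finset.measurable_fun_sum _ fun i _ => (Finset.measurable_fun_prod _ fun l _ =>
      measurable_centeredCount (hA _)).const_mul _
  have hae : ∀ᵐ μ ∂(Q.map ζ), ∀ j, μ.1 (A j) < ∞ := by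
    rw [ae_all_iff]
    intro j
    exact (ae_map_iff hζ.measurable.aemeasurable
      (measurable_config_apply (hA j) measurableSet_Iio)).2 (hζ.ae_apply_lt_top (hA j) (hfin j))
  have hbox : ∀ i : Fin n → ι, Integrable (boxIndicator fun l => A (i l)) := by
    intro i
    refine integrable_boxIndicator (fun l => hA _) ?_
    rw [volume_pi, Measure.pi_pi]
    exact (ENNReal.prod_lt_top fun l _ => (hfin _).lt_top).ne
  have hF : wienerItoFormula n (∑ i ∈ S, c i • boxIndicator fun l => A (i l)) =ᵐ[Q.map ζ]
      fun μ => ∑ i ∈ S, c i * ∏ l, centeredCount (A (i l)) μ := by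
    filter_upwards [hπ.wienerItoFormula_sum S c hbox, hae] with μ h1 h2
    rw [h1]
    refine Finset.sum_congr rfl fun i hi => ?_
    rw [wienerItoFormula_boxIndicator (fun l => hA _) (fun l l' h => hd ((hS i hi).ne h))
      (fun l => hfin _) fun l => (h2 _).ne]
    rfl
  obtain ⟨hi1, hle⟩ := hζ.integral_sq_sum_prod_le hA hd hfin S hS c
  obtain ⟨hi2, heq⟩ := integral_sq_sum_boxIndicator hA hd hfin S c
  rw [eLpNorm_congr_ae hF, ← ENNReal.pow_le_pow_left_iff two_ne_zero, mul_pow,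
    eLpNorm_two_sq hi2, heq,
    eLpNorm_two_sq ((integrable_map_measure (hm.pow_const 2).aestronglyMeasurable
      hζ.measurable.aemeasurable).2 hi1), integral_map hζ.measurable.aemeasurable
      (hm.pow_const 2).aestronglyMeasurable]
  refine (ENNReal.ofReal_le_ofReal hle).trans ?_
  rw [ENNReal.ofReal_mul (Nat.cast_nonneg _), ENNReal.ofReal_natCast]
  gcongr
  -- The bound on the squares carries the factor `n!`; weakening it to the square of `n!` avoids a
  -- square root in the operator bound.
  have h1 : 1 ≤ n.factorial := Nat.factorial_pos n
  exact_mod_cast Nat.le_self_pow two_ne_zero _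

end Poisson

/-- The half-open cube `[-R, R)^n`. -/
def window (n R : ℕ) : Set (Fin n → ℝ) := Set.univ.pi fun _ => Set.Ico (-R : ℝ) R

theorem measurableSet_window (n R : ℕ) : MeasurableSet (window n R) :=
  MeasurableSet.univ_pi fun _ => measurableSet_Ico

theorem volume_window_lt_top (n R : ℕ) : volume (window n R) < ∞ := by
  rw [window, volume_pi, Measure.pi_pi]
  exact ENNReal.prod_lt_top fun _ _ => measure_Ico_lt_top

/-- Each diagonal is a proper subspace, hence a null set. This is why step functions that omit the
cells meeting the same interval twice still approximate everything. -/
theorem ae_injective (n : ℕ) : ∀ᵐ x : Fin n → ℝ, Function.Injective x := by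
  have h : ∀ l m : Fin n, l ≠ m → ∀ᵐ x : Fin n → ℝ, x l ≠ x m := by
    intro l m hlm
    let V : Submodule ℝ (Fin n → ℝ) := LinearMap.ker
      ((LinearMap.proj l : (Fin n → ℝ) →ₗ[ℝ] ℝ) - LinearMap.proj m)
    have hV : V ≠ ⊤ := by
      intro hV
      have : (Pi.single l 1 : Fin n → ℝ) ∈ V := hV ▸ Submodule.mem_top
      rw [LinearMap.mem_ker] at this
      simp [Pi.single_eq_of_ne (Ne.symm hlm)] at this
    have := Measure.addHaar_submodule volume V hV
    refine measure_mono_null ?_ this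
    intro x hx
    have hx' : x l = x m := by simpa using hx
    change x ∈ V
    rw [LinearMap.mem_ker]
    simp [hx']
  have h2 : ∀ᵐ x : Fin n → ℝ, ∀ l m, l ≠ m → x l ≠ x m := by
    rw [ae_all_iff]
    intro l
    rw [ae_all_iff]
    intro m
    by_cases hlm : l = m
    · exact Filter.Eventually.of_forall fun x h => absurd hlm h
    · exact (h l m hlm).mono fun x hx _ => hx
  filter_upwards [h2] with x hx l m hlm
  by_contra hne
  exact hx l m hne hlm

/-! ### Approximation by step functions -/

/-- The cell `[j / M, (j + 1) / M)`. -/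
def gridCell (M : ℕ) (j : ℤ) : Set ℝ := {x | ⌊(M : ℝ) * x⌋ = j}

theorem measurableSet_gridCell (M : ℕ) (j : ℤ) : MeasurableSet (gridCell M j) :=
  (Int.measurable_floor.comp (measurable_const_mul (M : ℝ))) (measurableSet_singleton j)

theorem disjoint_gridCell (M : ℕ) : Pairwise (Function.onFun Disjoint (gridCell M)) := by
  intro i j hij
  refine Set.disjoint_left.2 fun x hx hx' => hij ?_
  exact hx.symm.trans hx'

theorem volume_gridCell_ne_top {M : ℕ} (hM : 0 < M) (j : ℤ) : volume (gridCell M j) ≠ ∞ := by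
  have hM' : (0 : ℝ) < M := by exact_mod_cast hM
  refine ((measure_mono fun x hx => ?_).trans_lt
    (measure_Icc_lt_top (a := (j : ℝ) / M) (b := ((j : ℝ) + 1) / M))).ne
  obtain ⟨h1, h2⟩ := Int.floor_eq_iff.1 hx
  constructor
  · rw [div_le_iff₀ hM']
    linarith
  · rw [le_div_iff₀ hM']
    linarith

open Classical in
/-- The off-diagonal step function approximating `g` on the window. -/
noncomputable def stepApprox {n : ℕ} (R : ℕ) (g : (Fin n → ℝ) → ℝ) (M : ℕ) : (Fin n → ℝ) → ℝ :=
  ∑ i ∈ Finset.univ.filter fun i : Fin n → Finset.Ico (-(R * M : ℕ) : ℤ) (R * M : ℕ) =>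
    Function.Injective i, g (fun l => ((i l : ℤ) : ℝ) / M) • boxIndicator fun l => gridCell M (i l)

open Classical in
-- Each point lies in one product cell, so at most one term of the sum is nonzero; its coefficient
-- is the value of `g` at the lower corner of that cell.
theorem stepApprox_apply {n : ℕ} (R : ℕ) (g : (Fin n → ℝ) → ℝ) {M : ℕ} (hM : 0 < M)
    (x : Fin n → ℝ) : stepApprox R g M x =
      if x ∈ window n R ∧ Function.Injective fun l => ⌊(M : ℝ) * x l⌋ then
        g fun l => (⌊(M : ℝ) * x l⌋ : ℝ) / M else 0 := by
  have hM' : (0 : ℝ) < M := by exact_mod_cast hM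
  have hbox : ∀ i : Fin n → Finset.Ico (-(R * M : ℕ) : ℤ) (R * M : ℕ),
      boxIndicator (fun l => gridCell M (i l)) x = if ∀ l, ⌊(M : ℝ) * x l⌋ = i l then 1 else 0 := by
    intro i
    rw [boxIndicator_eq, Set.indicator_apply]
    refine if_congr ?_ rfl rfl
    simp [gridCell]
  rw [stepApprox, Finset.sum_apply]
  simp only [Pi.smul_apply, hbox, smul_eq_mul]
  split_ifs with h
  · obtain ⟨hx, hinj⟩ := h
    have hmem : ∀ l, ⌊(M : ℝ) * x l⌋ ∈ Finset.Ico (-(R * M : ℕ) : ℤ) (R * M : ℕ) := by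
      intro l
      obtain ⟨h1, h2⟩ := hx l trivial
      rw [Finset.mem_Ico, Int.le_floor, Int.floor_lt]
      push_cast
      constructor <;> nlinarith
    rw [Finset.sum_eq_single (fun l => ⟨⌊(M : ℝ) * x l⌋, hmem l⟩)]
    · simp
    · intro i _ hi
      rw [if_neg, mul_zero]
      intro hc
      exact hi (funext fun l => Subtype.ext (hc l).symm)
    · intro hc
      refine absurd (Finset.mem_filter.2 ⟨Finset.mem_univ _, ?_⟩) hc
      intro l m hlm
      exact hinj (congrArg Subtype.val hlm)
  · refine Finset.sum_eq_zero fun i hi => ?_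
    rw [if_neg, mul_zero]
    intro hc
    refine h ⟨fun l _ => ?_, ?_⟩
    · have := (i l).2
      rw [← hc l, Finset.mem_Ico, Int.le_floor, Int.floor_lt] at this
      push_cast at this
      constructor <;> nlinarith [this.1, this.2]
    · intro l m hlm
      refine (Finset.mem_filter.1 hi).2 (Subtype.ext ?_)
      rw [← hc l, ← hc m]
      exact hlm

theorem tendsto_floor_mul_div (x : ℝ) : Filter.Tendsto
    (fun j : ℕ => (⌊((j + 1 : ℕ) : ℝ) * x⌋ : ℝ) / (j + 1 : ℕ)) Filter.atTop (nhds x) := by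
  have h := tendsto_one_div_add_atTop_nhds_zero_nat (𝕜 := ℝ)
  refine tendsto_of_tendsto_of_tendsto_of_le_of_le (g := fun j : ℕ => x - 1 / ((j : ℝ) + 1))
    (h := fun _ => x) (by simpa using tendsto_const_nhds.sub h) tendsto_const_nhds ?_ ?_
  · intro j
    have hj : (0 : ℝ) < ((j + 1 : ℕ) : ℝ) := by positivity
    have h2 := Int.sub_one_lt_floor (((j + 1 : ℕ) : ℝ) * x)
    change x - 1 / ((j : ℝ) + 1) ≤ (⌊((j + 1 : ℕ) : ℝ) * x⌋ : ℝ) / (j + 1 : ℕ)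
    rw [le_div_iff₀ hj]
    push_cast at hj h2 ⊢
    have h3 : (x - 1 / ((j : ℝ) + 1)) * ((j : ℝ) + 1) = ((j : ℝ) + 1) * x - 1 := by field_simp
    rw [h3]
    exact h2.le
  · intro j
    have hj : (0 : ℝ) < ((j + 1 : ℕ) : ℝ) := by positivity
    change (⌊((j + 1 : ℕ) : ℝ) * x⌋ : ℝ) / (j + 1 : ℕ) ≤ x
    rw [div_le_iff₀ hj, mul_comm x]
    exact Int.floor_le _

/-- When the coordinates of `x` are distinct, a sufficiently fine grid puts them into distinct
cells, and the corner of the cell of `x` converges to `x`. -/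
theorem tendsto_stepApprox {n : ℕ} (R : ℕ) {g : (Fin n → ℝ) → ℝ} (hg : Continuous g)
    {x : Fin n → ℝ} (hx : Function.Injective x) :
    Filter.Tendsto (fun j : ℕ => stepApprox R g (j + 1) x) Filter.atTop
      (nhds ((window n R).indicator g x)) := by
  classical
  simp_rw [stepApprox_apply R g (Nat.succ_pos _)]
  by_cases hW : x ∈ window n R
  · rw [Set.indicator_of_mem hW]
    have h1 : Filter.Tendsto (fun j : ℕ => g fun l => (⌊((j + 1 : ℕ) : ℝ) * x l⌋ : ℝ) / (j + 1 : ℕ))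
        Filter.atTop (nhds (g x)) :=
      (hg.tendsto x).comp (tendsto_pi_nhds.2 fun l => tendsto_floor_mul_div (x l))
    have h2 : ∀ᶠ j : ℕ in Filter.atTop,
        Function.Injective fun l => ⌊((j + 1 : ℕ) : ℝ) * x l⌋ := by
      have h3 : ∀ᶠ j : ℕ in Filter.atTop, ∀ l m, l ≠ m →
          ⌊((j + 1 : ℕ) : ℝ) * x l⌋ ≠ ⌊((j + 1 : ℕ) : ℝ) * x m⌋ := by
        rw [Filter.eventually_all]
        intro l
        rw [Filter.eventually_all]
        intro m
        by_cases hlm : l = m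
        · exact Filter.Eventually.of_forall fun j h => absurd hlm h
        · filter_upwards [((tendsto_floor_mul_div (x l)).sub
            (tendsto_floor_mul_div (x m))).eventually_ne (sub_ne_zero.2 (hx.ne hlm))] with j hj _ hc
          exact hj (by rw [hc, sub_self])
      filter_upwards [h3] with j hj l m hlm
      by_contra hne
      exact hj l m hne hlm
    refine h1.congr' ?_
    filter_upwards [h2] with j hj
    rw [if_pos ⟨hW, hj⟩]
  · rw [Set.indicator_of_notMem hW]
    simp [hW]

theorem integrable_stepApprox {n : ℕ} (R : ℕ) (g : (Fin n → ℝ) → ℝ) {M : ℕ} (hM : 0 < M) :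
    Integrable (stepApprox R g M) := by
  refine integrable_finsetSum' _ fun i _ => Integrable.smul _ ?_
  refine integrable_boxIndicator (fun l => measurableSet_gridCell M _) ?_
  rw [volume_pi, Measure.pi_pi]
  exact (ENNReal.prod_lt_top fun l _ => (volume_gridCell_ne_top hM _).lt_top).ne

theorem isCompact_cubeR (n R : ℕ) : IsCompact (cube n R) := isCompact_univ_pi fun _ => isCompact_Icc

theorem window_subset_cube (n R : ℕ) : window n R ⊆ cube n R :=
  Set.pi_mono fun _ _ => Set.Ico_subset_Icc_self

theorem exists_bound_on_cube {n : ℕ} (R : ℕ) {g : (Fin n → ℝ) → ℝ} (hg : Continuous g) :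
    ∃ C, 0 ≤ C ∧ ∀ x ∈ cube n R, |g x| ≤ C := by
  obtain ⟨C, hC⟩ := (isCompact_cubeR n R).exists_bound_of_continuousOn hg.continuousOn
  exact ⟨max C 0, le_max_right _ _, fun x hx => (hC x hx).trans (le_max_left _ _)⟩

theorem tendsto_eLpNorm_stepApprox {n : ℕ} (R : ℕ) {g : (Fin n → ℝ) → ℝ} (hg : Continuous g)
    {p : ℝ≥0∞} (hp0 : p ≠ 0) (hp : p ≠ ∞) :
    Filter.Tendsto (fun j : ℕ => eLpNorm (stepApprox R g (j + 1) - (window n R).indicator g) p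
      volume) Filter.atTop (nhds 0) := by
  classical
  obtain ⟨C, hC0, hC⟩ := exists_bound_on_cube R hg
  refine tendsto_eLpNorm_sub_of_dominated hp0 hp (B := (window n R).indicator fun _ => C + C)
    (memLp_indicator_const p (measurableSet_window n R) _ (Or.inr (volume_window_lt_top n R).ne))
    (fun j => (integrable_stepApprox R g (Nat.succ_pos j)).aestronglyMeasurable)
    (hg.measurable.indicator (measurableSet_window n R)).aestronglyMeasurable ?_ ?_
  · intro j
    refine Filter.Eventually.of_forall fun x => ?_
    rw [stepApprox_apply R g (Nat.succ_pos j)]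
    by_cases hx : x ∈ window n R
    · rw [Set.indicator_of_mem hx, Set.indicator_of_mem hx]
      refine (abs_sub _ _).trans (add_le_add ?_ (hC x (window_subset_cube n R hx)))
      split_ifs
      · refine hC _ fun l _ => ?_
        obtain ⟨h1, h2⟩ := hx l trivial
        have hj : (0 : ℝ) < ((j + 1 : ℕ) : ℝ) := by positivity
        -- Since `-R` is a grid point, rounding down does not leave `[-R, R]`, so the bound for `g`
        -- on the cube also holds at the corner.
        have h3 : (-(R * (j + 1) : ℕ) : ℤ) ≤ ⌊((j + 1 : ℕ) : ℝ) * x l⌋ := by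
          rw [Int.le_floor]
          push_cast at hj ⊢
          nlinarith
        have h3' : (-(R * (j + 1) : ℝ)) ≤ ⌊((j + 1 : ℕ) : ℝ) * x l⌋ := by exact_mod_cast h3
        have h4 := Int.floor_le (((j + 1 : ℕ) : ℝ) * x l)
        simp only [Set.mem_Icc]
        rw [le_div_iff₀ hj, div_le_iff₀ hj]
        push_cast at hj h3' h4 ⊢
        constructor
        · linarith
        · nlinarith
      · simpa using hC0
    · rw [Set.indicator_of_notMem hx, Set.indicator_of_notMem hx]
      simp [hx]
  · filter_upwards [ae_injective n] with x hx
    exact tendsto_stepApprox R hg hx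

/-! ### The `L²` bound for test functions. -/

section Poisson

variable {Ω₀ : Type*} [MeasurableSpace Ω₀] {Q : Measure Ω₀} [IsProbabilityMeasure Q]
  {ζ : Ω₀ → Config}

theorem integrable_window_indicator {n : ℕ} (R : ℕ) {g : (Fin n → ℝ) → ℝ} (hg : Continuous g) :
    Integrable ((window n R).indicator g) := by
  refine (integrable_indicator_iff (measurableSet_window n R)).2 ?_
  exact (hg.continuousOn.integrableOn_compact (isCompact_cubeR n R)).mono_set
    (window_subset_cube n R)

theorem IsPoissonProcess.eLpNorm_wienerItoFormula_window_le (hζ : IsPoissonProcess ζ volume Q)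
    {n : ℕ} (R : ℕ) {g : (Fin n → ℝ) → ℝ} (hg : Continuous g) :
    eLpNorm (wienerItoFormula n ((window n R).indicator g)) 2 (Q.map ζ) ≤
      n.factorial * eLpNorm ((window n R).indicator g) 2 volume := by
  have := hζ.isProbabilityMeasure_map
  refine hζ.hasLebesgueFactorialMoments.eLpNorm_wienerItoFormula_le_of_tendsto
    (f := fun j => stepApprox R g (j + 1)) (fun j => integrable_stepApprox R g (Nat.succ_pos j))
    (integrable_window_indicator R hg) (tendsto_eLpNorm_stepApprox R hg one_ne_zero (by simp))
    (tendsto_eLpNorm_stepApprox R hg two_ne_zero (by simp)) (ENNReal.natCast_ne_top _) fun j => ?_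
  exact hζ.eLpNorm_wienerItoFormula_step_le (A := fun i : Finset.Ico (-(R * (j + 1) : ℕ) : ℤ)
    (R * (j + 1) : ℕ) => gridCell (j + 1) i) (fun i => measurableSet_gridCell _ _)
    (fun i i' h => disjoint_gridCell _ (Subtype.coe_injective.ne h))
    (fun i => volume_gridCell_ne_top (Nat.succ_pos j) _) _
    (fun i hi => (Finset.mem_filter.1 hi).2) _

theorem IsTestFunction.integrable {n : ℕ} {f : (Fin n → ℝ) → ℝ} (hf : IsTestFunction f) :
    Integrable f := by
  obtain ⟨C, hC⟩ := hf.bounded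
  have hm : MeasurableSet (Function.support f) := measurableSet_support hf.measurable
  refine Integrable.mono' (g := (Function.support f).indicator fun _ => C)
    ((integrable_indicator_iff hm).2 (integrableOn_const hf.bounded_support.measure_lt_top.ne))
    hf.measurable.aestronglyMeasurable (Filter.Eventually.of_forall fun x => ?_)
  by_cases hx : x ∈ Function.support f
  · rw [Set.indicator_of_mem hx]
    exact hC x
  · rw [Set.indicator_of_notMem hx, Function.notMem_support.1 hx, norm_zero]

theorem IsTestFunction.exists_window {n : ℕ} {f : (Fin n → ℝ) → ℝ} (hf : IsTestFunction f) :
    ∃ R : ℕ, (window n R).indicator f = f := by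
  obtain ⟨r, hr⟩ := hf.bounded_support.subset_closedBall 0
  obtain ⟨R, hR⟩ := exists_nat_gt r
  refine ⟨R, Set.indicator_eq_self.2 fun x hx l _ => ?_⟩
  have h1 : ‖x‖ ≤ r := by simpa using hr hx
  have h2 : |x l| < R := ((norm_le_pi_norm x l).trans h1).trans_lt hR
  exact ⟨(abs_lt.1 h2).1.le, (abs_lt.1 h2).2⟩

/-- Approximate `f` in `L²` by continuous functions and cut these off to a window containing the
support of `f`. The window has finite volume, so the approximation also holds in `L¹`. -/
theorem IsPoissonProcess.eLpNorm_wienerItoFormula_le (hζ : IsPoissonProcess ζ volume Q)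
    {n : ℕ} {f : (Fin n → ℝ) → ℝ} (hf : IsTestFunction f) :
    eLpNorm (wienerItoFormula n f) 2 (Q.map ζ) ≤ n.factorial * eLpNorm f 2 volume := by
  have := hζ.isProbabilityMeasure_map
  obtain ⟨R, hR⟩ := hf.exists_window
  have hg : ∀ j : ℕ, ∃ g : (Fin n → ℝ) → ℝ, Continuous g ∧
      eLpNorm (f - g) 2 volume ≤ ((j : ℝ≥0∞) + 1)⁻¹ := by
    intro j
    obtain ⟨g, -, h1, h2, -⟩ := hf.memLp.exists_hasCompactSupport_eLpNorm_sub_le (by simp)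
      (ε := ((j : ℝ≥0∞) + 1)⁻¹) (ENNReal.inv_ne_zero.2 (by simp))
    exact ⟨g, h2, h1⟩
  choose g hgc hg using hg
  have heq : ∀ j, (window n R).indicator (g j) - f = (window n R).indicator (g j - f) := by
    intro j
    conv_lhs => rw [← hR]
    exact (Set.indicator_sub' _ _ _).symm
  have hm : ∀ j, AEStronglyMeasurable (g j - f) volume := fun j =>
    ((hgc j).measurable.sub hf.measurable).aestronglyMeasurable
  have h0 : Filter.Tendsto (fun j : ℕ => ((j : ℝ≥0∞) + 1)⁻¹) Filter.atTop (nhds 0) := by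
    have := (Filter.tendsto_add_atTop_iff_nat 1).2 ENNReal.tendsto_inv_nat_nhds_zero
    simpa using this
  have hle2 : ∀ j, eLpNorm ((window n R).indicator (g j) - f) 2 volume ≤ ((j : ℝ≥0∞) + 1)⁻¹ := by
    intro j
    rw [heq]
    refine (eLpNorm_indicator_le _).trans ?_
    rw [← neg_sub, eLpNorm_neg]
    exact hg j
  have hle1 : ∀ j, eLpNorm ((window n R).indicator (g j) - f) 1 volume
      ≤ ((j : ℝ≥0∞) + 1)⁻¹ * volume (window n R) ^ (1 / 2 : ℝ) := by
    intro j
    rw [heq, eLpNorm_indicator_eq_eLpNorm_restrict (measurableSet_window n R)]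
    refine (eLpNorm_le_eLpNorm_mul_rpow_measure_univ (p := 1) (q := 2) (by norm_num)
      (hm j).restrict).trans ?_
    rw [Measure.restrict_apply_univ]
    have he : 1 / (1 : ℝ≥0∞).toReal - 1 / (2 : ℝ≥0∞).toReal = 1 / 2 := by norm_num
    rw [he]
    gcongr
    · refine (eLpNorm_mono_measure _ Measure.restrict_le_self).trans ?_
      rw [← neg_sub, eLpNorm_neg]
      exact hg j
  refine hζ.hasLebesgueFactorialMoments.eLpNorm_wienerItoFormula_le_of_tendsto
    (f := fun j => (window n R).indicator (g j)) (fun j => integrable_window_indicator R (hgc j))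
    hf.integrable ?_ ?_ (ENNReal.natCast_ne_top _)
    fun j => hζ.eLpNorm_wienerItoFormula_window_le R (hgc j)
  · refine tendsto_of_tendsto_of_tendsto_of_le_of_le tendsto_const_nhds ?_ (fun _ => zero_le) hle1
    have := ENNReal.Tendsto.mul_const (b := volume (window n R) ^ (1 / 2 : ℝ)) h0
      (Or.inr (ENNReal.rpow_ne_top_of_nonneg (by norm_num) (volume_window_lt_top n R).ne))
    simpa using this
  · exact tendsto_of_tendsto_of_tendsto_of_le_of_le tendsto_const_nhds h0 (fun _ => zero_le) hle2

/-! ### The extension to square integrable functions -/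

/-- The vector space of test functions. -/
def testFunctions (n : ℕ) : Submodule ℝ ((Fin n → ℝ) → ℝ) where
  carrier := {f | IsTestFunction f}
  zero_mem' := ⟨measurable_zero, ⟨0, by simp⟩, by simp⟩
  add_mem' := by
    rintro f g hf hg
    obtain ⟨C, hC⟩ := hf.bounded
    obtain ⟨D, hD⟩ := hg.bounded
    exact ⟨hf.measurable.add hg.measurable, ⟨C + D, fun x =>
      (abs_add_le _ _).trans (add_le_add (hC x) (hD x))⟩,
      (hf.bounded_support.union hg.bounded_support).subset (Function.support_add _ _)⟩
  smul_mem' := by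
    rintro c f hf
    obtain ⟨C, hC⟩ := hf.bounded
    refine ⟨hf.measurable.const_smul c, ⟨|c| * C, fun x => ?_⟩,
      hf.bounded_support.subset (Function.support_const_smul_subset c f)⟩
    rw [Pi.smul_apply, smul_eq_mul, abs_mul]
    exact mul_le_mul_of_nonneg_left (hC x) (abs_nonneg c)

/-- The embedding of test functions into `L²`. -/
noncomputable def testFunctionsToLp (n : ℕ) :
    testFunctions n →ₗ[ℝ] Lp ℝ 2 (volume : Measure (Fin n → ℝ)) where
  toFun f := f.2.memLp.toLp f.1
  map_add' _ _ := rfl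
  map_smul' _ _ := rfl

theorem denseRange_testFunctionsToLp (n : ℕ) : DenseRange (testFunctionsToLp n) := by
  intro F
  rw [Metric.mem_closure_range_iff]
  intro ε hε
  obtain ⟨g, hgs, hg, hgc, hgm⟩ := (Lp.memLp F).exists_hasCompactSupport_eLpNorm_sub_le (by simp)
    (ε := ENNReal.ofReal (ε / 2)) (by simpa using hε)
  have hgt : IsTestFunction g := by
    obtain ⟨C, hC⟩ := hgc.bounded_above_of_compact_support hgs
    exact ⟨hgc.measurable, ⟨C, hC⟩, hgs.isBounded.subset (subset_tsupport g)⟩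
  refine ⟨⟨g, hgt⟩, ?_⟩
  rw [Lp.dist_def]
  have h : eLpNorm ((F : (Fin n → ℝ) → ℝ) -
      (testFunctionsToLp n ⟨g, hgt⟩ : (Fin n → ℝ) → ℝ)) 2 volume
      ≤ ENNReal.ofReal (ε / 2) := by
    refine le_trans (le_of_eq (eLpNorm_congr_ae ?_)) hg
    filter_upwards [hgt.memLp.coeFn_toLp] with x hx
    rw [Pi.sub_apply, Pi.sub_apply]
    congr 1
  calc _ ≤ (ENNReal.ofReal (ε / 2)).toReal := ENNReal.toReal_mono ENNReal.ofReal_ne_top h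
    _ = ε / 2 := ENNReal.toReal_ofReal (by positivity)
    _ < ε := by linarith

theorem IsPoissonProcess.memLp_wienerItoFormula (hζ : IsPoissonProcess ζ volume Q)
    {n : ℕ} {f : (Fin n → ℝ) → ℝ} (hf : IsTestFunction f) :
    MemLp (wienerItoFormula n f) 2 (Q.map ζ) := by
  have := hζ.isProbabilityMeasure_map
  exact ⟨hζ.hasLebesgueFactorialMoments.aestronglyMeasurable_wienerItoFormula hf.integrable,
    (hζ.eLpNorm_wienerItoFormula_le hf).trans_lt
      (ENNReal.mul_lt_top (ENNReal.natCast_lt_top _) hf.memLp.2)⟩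

/-- The explicit formula as a linear map from test functions to `L²`. -/
noncomputable def IsPoissonProcess.formulaToLp (hζ : IsPoissonProcess ζ volume Q) (n : ℕ) :
    testFunctions n →ₗ[ℝ] Lp ℝ 2 (Q.map ζ) where
  toFun f := (hζ.memLp_wienerItoFormula f.2).toLp _
  map_add' f g := by
    have := hζ.isProbabilityMeasure_map
    rw [← MemLp.toLp_add, MemLp.toLp_eq_toLp_iff]
    exact hζ.hasLebesgueFactorialMoments.wienerItoFormula_add f.2.integrable g.2.integrable
  map_smul' c f := by
    rw [RingHom.id_apply, ← MemLp.toLp_const_smul, MemLp.toLp_eq_toLp_iff]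
    exact Filter.Eventually.of_forall fun μ => wienerItoFormula_smul c f.1 μ

theorem IsPoissonProcess.norm_formulaToLp_le (hζ : IsPoissonProcess ζ volume Q) (n : ℕ)
    (f : testFunctions n) :
    ‖hζ.formulaToLp n f‖ ≤ n.factorial * ‖testFunctionsToLp n f‖ := by
  change ‖(hζ.memLp_wienerItoFormula f.2).toLp _‖ ≤ n.factorial * ‖f.2.memLp.toLp f.1‖
  rw [Lp.norm_toLp, Lp.norm_toLp, ← ENNReal.toReal_natCast, ← ENNReal.toReal_mul]
  exact ENNReal.toReal_mono (ENNReal.mul_ne_top (ENNReal.natCast_ne_top _) f.2.memLp.2.ne)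
    (hζ.eLpNorm_wienerItoFormula_le f.2)

/-- Test functions are dense in `L²`, and on them the formula is linear and bounded. -/
theorem IsPoissonProcess.existsUnique_extendsWienerIto (hζ : IsPoissonProcess ζ volume Q) (n : ℕ) :
    ∃! I, ExtendsWienerIto (Q.map ζ) n I := by
  refine ⟨(hζ.formulaToLp n).extendOfNorm (testFunctionsToLp n), ?_, ?_⟩
  · intro f hf
    have h := LinearMap.extendOfNorm_eq (f := hζ.formulaToLp n)
      (denseRange_testFunctionsToLp n) ⟨_, hζ.norm_formulaToLp_le n⟩ ⟨f, hf⟩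
    have h2 : (hζ.formulaToLp n).extendOfNorm (testFunctionsToLp n) (hf.memLp.toLp f)
      = (hζ.memLp_wienerItoFormula hf).toLp _ := h
    rw [h2]
    exact MemLp.coeFn_toLp _
  · intro I hI
    refine (LinearMap.extendOfNorm_unique (denseRange_testFunctionsToLp n) _
      (hζ.norm_formulaToLp_le n) I ?_).symm
    refine LinearMap.ext fun f => Lp.ext ?_
    exact (hI f.1 f.2).trans (hζ.memLp_wienerItoFormula f.2).coeFn_toLp.symm

theorem IsPoissonProcess.extendsWienerIto_multipleWienerIto (hζ : IsPoissonProcess ζ volume Q)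
    (n : ℕ) : ExtendsWienerIto (Q.map ζ) n (multipleWienerIto (Q.map ζ) n) := by
  have h := (hζ.existsUnique_extendsWienerIto n).exists
  rw [multipleWienerIto, dif_pos h]
  exact Classical.choose_spec h

/-! ### Functions that are integrable and square integrable -/

/-- Truncation of a function to the cube `[-j, j]^n` and to values of modulus at most `j`. -/
noncomputable def truncate {n : ℕ} (f : (Fin n → ℝ) → ℝ) (j : ℕ) : (Fin n → ℝ) → ℝ :=
  (cube n j ∩ {x | |f x| ≤ j}).indicator f

theorem isTestFunction_truncate {n : ℕ} {f : (Fin n → ℝ) → ℝ} (hf : Measurable f) (j : ℕ) :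
    IsTestFunction (truncate f j) := by
  refine ⟨hf.indicator ((measurableSet_cube n j).inter
    (measurableSet_le hf.abs measurable_const)), ⟨j, fun x => ?_⟩, ?_⟩
  · classical
    rw [truncate, Set.indicator_apply]
    split_ifs with h
    · exact h.2
    · simp
  · exact (isCompact_cubeR n j).isBounded.subset
      ((Set.support_indicator_subset).trans Set.inter_subset_left)

theorem tendsto_eLpNorm_truncate {n : ℕ} {f : (Fin n → ℝ) → ℝ} (hf : Measurable f) {p : ℝ≥0∞}
    (hp0 : p ≠ 0) (hp : p ≠ ∞) (hfp : MemLp f p volume) :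
    Filter.Tendsto (fun j => eLpNorm (truncate f j - f) p volume) Filter.atTop (nhds 0) := by
  refine tendsto_eLpNorm_sub_of_dominated hp0 hp hfp.abs
    (fun j => (isTestFunction_truncate hf j).measurable.aestronglyMeasurable)
    hf.aestronglyMeasurable (fun j => Filter.Eventually.of_forall fun x => ?_)
    (Filter.Eventually.of_forall fun x => ?_)
  · classical
    rw [truncate, Set.indicator_apply]
    split_ifs
    · simp
    · simp
  · refine tendsto_const_nhds.congr' ?_
    obtain ⟨m, hm⟩ := Set.mem_iUnion.1 ((iUnion_cube n).symm ▸ Set.mem_univ x)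
    obtain ⟨m', hm'⟩ := exists_nat_ge |f x|
    filter_upwards [Filter.eventually_ge_atTop m, Filter.eventually_ge_atTop m'] with j h1 h2
    rw [truncate, Set.indicator_of_mem]
    exact ⟨cube_mono n h1 hm, hm'.trans (Nat.cast_le.2 h2)⟩

/-- Needed because the semigroup destroys bounded support: the image of a test function is in
general only integrable and square integrable. Truncations converge in both senses; the formula is
continuous for the first, the operator for the second, and limits in measure are unique. -/
theorem IsPoissonProcess.multipleWienerIto_toLp (hζ : IsPoissonProcess ζ volume Q) {n : ℕ}
    {f : (Fin n → ℝ) → ℝ} (hfm : Measurable f) (hf1 : Integrable f) (hf2 : MemLp f 2 volume) :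
    multipleWienerIto (Q.map ζ) n (hf2.toLp f) =ᵐ[Q.map ζ] wienerItoFormula n f := by
  have := hζ.isProbabilityMeasure_map
  have hπ := hζ.hasLebesgueFactorialMoments
  have ht := isTestFunction_truncate hfm
  have hI := hζ.extendsWienerIto_multipleWienerIto n
  have h1 : TendstoInMeasure (Q.map ζ) (fun j => wienerItoFormula n (truncate f j)) Filter.atTop
      (wienerItoFormula n f) :=
    tendstoInMeasure_of_tendsto_eLpNorm one_ne_zero
      (fun j => hπ.aestronglyMeasurable_wienerItoFormula (ht j).integrable)
      (hπ.aestronglyMeasurable_wienerItoFormula hf1)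
      (hπ.tendsto_wienerItoFormula (fun j => (ht j).integrable) hf1
        (tendsto_eLpNorm_truncate hfm one_ne_zero (by simp) (memLp_one_iff_integrable.2 hf1)))
  have h2 : Filter.Tendsto (fun j => (ht j).memLp.toLp (truncate f j)) Filter.atTop
      (nhds (hf2.toLp f)) :=
    (Lp.tendsto_Lp_iff_tendsto_eLpNorm'' _ _ _ _).2
      (tendsto_eLpNorm_truncate hfm two_ne_zero (by simp) hf2)
  have h3 := tendstoInMeasure_of_tendsto_Lp
    (((multipleWienerIto (Q.map ζ) n).continuous.tendsto _).comp h2)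
  exact tendstoInMeasure_ae_unique (h3.congr_left fun j => hI _ (ht j)) h1

end Poisson

/-! ### Finite-dimensional Gaussian laws -/

theorem integral_variance_map_of_hasGaussianLaw {k : ℕ} {Ω : Type*} [MeasurableSpace Ω]
    {P : Measure Ω} {X : Fin k → Ω → ℝ}
    (hX : HasGaussianLaw (fun ω l => X l ω) P) (L : StrongDual ℝ (Fin k → ℝ)) :
    ∫ x, L x ∂(P.map fun ω l => X l ω) = ∑ l, L (Pi.single l 1) * ∫ ω, X l ω ∂P ∧
      Var[L; P.map fun ω l => X l ω] = ∑ l, ∑ m, L (Pi.single l 1) * (L (Pi.single m 1) *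
        cov[X l, X m; P]) := by
  have := hX.isProbabilityMeasure
  have hL : ∀ ω, L (fun l => X l ω) = ∑ l, L (Pi.single l 1) * X l ω := by
    intro ω
    conv_lhs => rw [pi_eq_sum_univ' fun l => X l ω]
    rw [map_sum]
    refine Finset.sum_congr rfl fun l _ => ?_
    rw [map_smul, smul_eq_mul, mul_comm]
  constructor
  · rw [integral_map hX.aemeasurable L.continuous.measurable.aestronglyMeasurable]
    simp_rw [hL]
    rw [integral_finsetSum _ fun l _ => ((hX.eval l).integrable).const_mul _]
    simp_rw [integral_const_mul]
  · rw [← covariance_self L.continuous.measurable.aemeasurable,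
      covariance_map L.continuous.measurable.aestronglyMeasurable
        L.continuous.measurable.aestronglyMeasurable hX.aemeasurable]
    have hL' : (⇑L ∘ fun ω l => X l ω) = fun ω => ∑ l, L (Pi.single l 1) * X l ω :=
      funext hL
    rw [hL', covariance_fun_sum_fun_sum (fun l => (hX.eval l).memLp_two.const_mul _)
      fun l => (hX.eval l).memLp_two.const_mul _]
    simp_rw [covariance_const_mul_left, covariance_const_mul_right]

/-- The characteristic function of a Gaussian law involves only means and variances of linear
functionals. Degenerate covariances are included, so `t = 0` and `a = 1` need no separate treatment.
-/
theorem map_pi_eq_of_hasGaussianLaw {k : ℕ} {Ω Ω' : Type*} [MeasurableSpace Ω] [MeasurableSpace Ω']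
    {P : Measure Ω} {P' : Measure Ω'} {X : Fin k → Ω → ℝ} {Y : Fin k → Ω' → ℝ}
    (hX : HasGaussianLaw (fun ω l => X l ω) P) (hY : HasGaussianLaw (fun ω l => Y l ω) P')
    (hmean : ∀ l, ∫ ω, X l ω ∂P = ∫ ω, Y l ω ∂P')
    (hcov : ∀ l m, cov[X l, X m; P] = cov[Y l, Y m; P']) :
    P.map (fun ω l => X l ω) = P'.map fun ω l => Y l ω := by
  have := hX.isGaussian_map
  have := hY.isGaussian_map
  refine Measure.ext_of_charFunDual (funext fun L => ?_)
  rw [IsGaussian.charFunDual_eq, IsGaussian.charFunDual_eq, integral_complex_ofReal,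
    integral_complex_ofReal, (integral_variance_map_of_hasGaussianLaw hX L).1,
    (integral_variance_map_of_hasGaussianLaw hX L).2,
    (integral_variance_map_of_hasGaussianLaw hY L).1,
    (integral_variance_map_of_hasGaussianLaw hY L).2]
  simp_rw [hmean, hcov]

/-! ### The transition kernel of finitely many particles -/

/-- The law of `(√(1-a) B_{1,t} + √a B_t + x_1, …, √(1-a) B_{k,t} + √a B_t + x_k)`. -/
noncomputable def particleKernel (a : ℝ) (k : ℕ) (t : ℝ≥0) (x : Fin k → ℝ) : Measure (Fin k → ℝ) :=
  ((gaussianReal 0 t).prod (Measure.pi fun _ : Fin k => gaussianReal 0 t)).map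
    fun z l => √(1 - a) * z.2 l + √a * z.1 + x l

theorem measurable_particleShift (a : ℝ) {k : ℕ} (x : Fin k → ℝ) :
    Measurable fun (z : ℝ × (Fin k → ℝ)) (l : Fin k) => √(1 - a) * z.2 l + √a * z.1 + x l := by
  fun_prop

instance isProbabilityMeasure_particleKernel (a : ℝ) (k : ℕ) (t : ℝ≥0) (x : Fin k → ℝ) :
    IsProbabilityMeasure (particleKernel a k t x) :=
  Measure.isProbabilityMeasure_map (measurable_particleShift a x).aemeasurable

theorem measurable_particleKernel (a : ℝ) (k : ℕ) (t : ℝ≥0) :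
    Measurable (particleKernel a k t) := by
  refine Measure.measurable_of_measurable_coe _ fun B hB => ?_
  have h : ∀ x, particleKernel a k t x B
      = ((gaussianReal 0 t).prod (Measure.pi fun _ : Fin k => gaussianReal 0 t))
        (Prod.mk x ⁻¹' {p : (Fin k → ℝ) × (ℝ × (Fin k → ℝ)) |
          (fun l => √(1 - a) * p.2.2 l + √a * p.2.1 + p.1 l) ∈ B}) := by
    intro x
    rw [particleKernel, Measure.map_apply (measurable_particleShift a x) hB]
    rfl
  simp_rw [h]
  refine measurable_measure_prodMk_left ?_
  have : Measurable fun p : (Fin k → ℝ) × (ℝ × (Fin k → ℝ)) =>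
      (fun l => √(1 - a) * p.2.2 l + √a * p.2.1 + p.1 l : Fin k → ℝ) := by fun_prop
  exact this hB

/-- For fixed noise the particles are translated by a fixed vector, and Lebesgue measure is
invariant under translations. -/
theorem volume_bind_particleKernel (a : ℝ) (k : ℕ) (t : ℝ≥0) :
    (volume : Measure (Fin k → ℝ)).bind (particleKernel a k t) = volume := by
  ext B hB
  rw [Measure.bind_apply hB (measurable_particleKernel a k t).aemeasurable]
  have h : ∀ x, particleKernel a k t x B
      = ∫⁻ z, B.indicator 1 (fun l => √(1 - a) * z.2 l + √a * z.1 + x l)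
        ∂((gaussianReal 0 t).prod (Measure.pi fun _ : Fin k => gaussianReal 0 t)) := by
    intro x
    rw [← lintegral_indicator_one hB, particleKernel,
      lintegral_map (measurable_one.indicator hB) (measurable_particleShift a x)]
  simp_rw [h]
  rw [lintegral_lintegral_swap]
  · have h2 : ∀ z : ℝ × (Fin k → ℝ), ∫⁻ x : Fin k → ℝ, B.indicator (1 : (Fin k → ℝ) → ℝ≥0∞)
        (fun l => √(1 - a) * z.2 l + √a * z.1 + x l) = volume B := by
      intro z
      have := lintegral_add_left_eq_self (μ := (volume : Measure (Fin k → ℝ)))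
        (B.indicator 1) (fun l => √(1 - a) * z.2 l + √a * z.1)
      rw [lintegral_indicator_one hB] at this
      exact this
    simp_rw [h2]
    simp
  · have h3 : Measurable fun p : (Fin k → ℝ) × (ℝ × (Fin k → ℝ)) =>
        (fun l => √(1 - a) * p.2.2 l + √a * p.2.1 + p.1 l : Fin k → ℝ) := by fun_prop
    exact ((measurable_one.indicator hB).comp h3).aemeasurable

theorem nParticleSemigroup_eq {a : ℝ} {n : ℕ} {t : ℝ≥0} {f : (Fin n → ℝ) → ℝ} {x : Fin n → ℝ}
    (hf : AEStronglyMeasurable f (particleKernel a n t x)) :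
    nParticleSemigroup a n t f x = ∫ y, f y ∂(particleKernel a n t x) := by
  rw [particleKernel, integral_map (measurable_particleShift a x).aemeasurable hf]
  rfl

theorem isGaussian_pi_gaussianReal (k : ℕ) (t : ℝ≥0) :
    IsGaussian (Measure.pi fun _ : Fin k => gaussianReal 0 t) := by
  have h1 : ∀ l : Fin k, HasGaussianLaw (fun z : Fin k → ℝ => z l)
      (Measure.pi fun _ : Fin k => gaussianReal 0 t) := by
    intro l
    constructor
    have : (Measure.pi fun _ : Fin k => gaussianReal 0 t).map (fun z => z l) = gaussianReal 0 t :=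
      (measurePreserving_eval (fun _ : Fin k => gaussianReal 0 t) l).map_eq
    rw [this]
    infer_instance
  have h2 : iIndepFun (fun (l : Fin k) (z : Fin k → ℝ) => z l)
      (Measure.pi fun _ : Fin k => gaussianReal 0 t) :=
    iIndepFun_pi (X := fun _ : Fin k => (id : ℝ → ℝ)) fun _ => aemeasurable_id
  have h3 := (h2.hasGaussianLaw h1).isGaussian_map
  rwa [show (fun (z : Fin k → ℝ) (l : Fin k) => z l) = id from rfl, Measure.map_id] at h3

section GaussianCoordinates

variable (k : ℕ) (t : ℝ≥0)

theorem map_fst_gaussian : ((gaussianReal 0 t).prod (Measure.pi fun _ : Fin k =>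
    gaussianReal 0 t)).map Prod.fst = gaussianReal 0 t :=
  measurePreserving_fst.map_eq

theorem map_snd_apply_gaussian (l : Fin k) : ((gaussianReal 0 t).prod (Measure.pi fun _ : Fin k =>
    gaussianReal 0 t)).map (fun z => z.2 l) = gaussianReal 0 t :=
  ((measurePreserving_eval (fun _ : Fin k => gaussianReal 0 t) l).comp
    measurePreserving_snd).map_eq

theorem hasGaussianLaw_fst : HasGaussianLaw (fun z : ℝ × (Fin k → ℝ) => z.1)
    ((gaussianReal 0 t).prod (Measure.pi fun _ : Fin k => gaussianReal 0 t)) :=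
  ⟨by rw [map_fst_gaussian]; infer_instance⟩

theorem hasGaussianLaw_snd_apply (l : Fin k) : HasGaussianLaw (fun z : ℝ × (Fin k → ℝ) => z.2 l)
    ((gaussianReal 0 t).prod (Measure.pi fun _ : Fin k => gaussianReal 0 t)) :=
  ⟨by rw [map_snd_apply_gaussian]; infer_instance⟩

theorem integral_fst_gaussian : ∫ z, z.1 ∂((gaussianReal 0 t).prod (Measure.pi fun _ : Fin k =>
    gaussianReal 0 t)) = 0 := by
  have h := integral_map (μ := (gaussianReal 0 t).prod (Measure.pi fun _ : Fin k =>
    gaussianReal 0 t)) (φ := Prod.fst) (f := fun r : ℝ => r) (by fun_prop) (by fun_prop)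
  rw [← h, map_fst_gaussian]
  exact integral_id_gaussianReal

theorem integral_snd_apply_gaussian (l : Fin k) : ∫ z, z.2 l ∂((gaussianReal 0 t).prod
    (Measure.pi fun _ : Fin k => gaussianReal 0 t)) = 0 := by
  have h := integral_map (μ := (gaussianReal 0 t).prod (Measure.pi fun _ : Fin k =>
    gaussianReal 0 t)) (φ := fun z => z.2 l) (f := fun r : ℝ => r) (by fun_prop) (by fun_prop)
  rw [← h, map_snd_apply_gaussian]
  exact integral_id_gaussianReal

theorem covariance_fst_fst_gaussian : cov[fun z : ℝ × (Fin k → ℝ) => z.1, fun z => z.1;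
    (gaussianReal 0 t).prod (Measure.pi fun _ : Fin k => gaussianReal 0 t)] = t := by
  have h := covariance_map_fun (μ := (gaussianReal 0 t).prod (Measure.pi fun _ : Fin k =>
    gaussianReal 0 t)) (Z := Prod.fst) (X := fun r : ℝ => r) (Y := fun r : ℝ => r)
    (by fun_prop) (by fun_prop) (by fun_prop)
  rw [← h, map_fst_gaussian, covariance_self (by fun_prop)]
  exact variance_fun_id_gaussianReal

theorem covariance_fst_snd_gaussian (l : Fin k) : cov[fun z : ℝ × (Fin k → ℝ) => z.1,
    fun z => z.2 l;
    (gaussianReal 0 t).prod (Measure.pi fun _ : Fin k => gaussianReal 0 t)] = 0 := by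
  have h : IndepFun (fun z : ℝ × (Fin k → ℝ) => z.1) (fun z => z.2 l)
      ((gaussianReal 0 t).prod (Measure.pi fun _ : Fin k => gaussianReal 0 t)) :=
    indepFun_prod (X := fun r : ℝ => r) (Y := fun z : Fin k → ℝ => z l)
      (by fun_prop) (by fun_prop)
  exact h.covariance_eq_zero (hasGaussianLaw_fst k t).memLp_two
    (hasGaussianLaw_snd_apply k t l).memLp_two

theorem covariance_snd_snd_gaussian (l m : Fin k) : cov[fun z : ℝ × (Fin k → ℝ) => z.2 l,
    fun z => z.2 m; (gaussianReal 0 t).prod (Measure.pi fun _ : Fin k => gaussianReal 0 t)] =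
      if l = m then (t : ℝ) else 0 := by
  split_ifs with hlm
  · subst hlm
    have h := covariance_map_fun (μ := (gaussianReal 0 t).prod (Measure.pi fun _ : Fin k =>
      gaussianReal 0 t)) (Z := fun z => z.2 l) (X := fun r : ℝ => r) (Y := fun r : ℝ => r)
      (by fun_prop) (by fun_prop) (by fun_prop)
    rw [← h, map_snd_apply_gaussian, covariance_self (by fun_prop)]
    exact variance_fun_id_gaussianReal
  · have h2 : iIndepFun (fun (l : Fin k) (z : Fin k → ℝ) => z l)
        (Measure.pi fun _ : Fin k => gaussianReal 0 t) :=
      iIndepFun_pi (X := fun _ : Fin k => (id : ℝ → ℝ)) fun _ => aemeasurable_id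
    have h3 : ((gaussianReal 0 t).prod (Measure.pi fun _ : Fin k => gaussianReal 0 t)).map
      Prod.snd = Measure.pi fun _ : Fin k => gaussianReal 0 t := measurePreserving_snd.map_eq
    have h := covariance_map_fun (μ := (gaussianReal 0 t).prod (Measure.pi fun _ : Fin k =>
      gaussianReal 0 t)) (Z := Prod.snd) (X := fun z : Fin k → ℝ => z l)
      (Y := fun z : Fin k → ℝ => z m) (measurable_pi_apply l).aestronglyMeasurable
      (measurable_pi_apply m).aestronglyMeasurable measurable_snd.aemeasurable
    rw [← h, h3]
    have h4 : ∀ l : Fin k, MemLp (fun z : Fin k → ℝ => z l) 2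
        (Measure.pi fun _ : Fin k => gaussianReal 0 t) := by
      intro l
      have h5 := (hasGaussianLaw_snd_apply k t l).memLp_two
      rw [← h3]
      exact (memLp_map_measure_iff (measurable_pi_apply l).aestronglyMeasurable
        measurable_snd.aemeasurable).2 h5
    exact (h2.indepFun hlm).covariance_eq_zero (h4 l) (h4 m)

end GaussianCoordinates

theorem hasGaussianLaw_particleShift (a : ℝ) {k : ℕ} (t : ℝ≥0) (x : Fin k → ℝ) :
    HasGaussianLaw (fun (z : ℝ × (Fin k → ℝ)) (l : Fin k) => √(1 - a) * z.2 l + √a * z.1 + x l)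
      ((gaussianReal 0 t).prod (Measure.pi fun _ : Fin k => gaussianReal 0 t)) := by
  have := isGaussian_pi_gaussianReal k t
  let L : (ℝ × (Fin k → ℝ)) →L[ℝ] (Fin k → ℝ) := ContinuousLinearMap.pi fun l =>
    √(1 - a) • ((ContinuousLinearMap.proj l).comp (ContinuousLinearMap.snd ℝ ℝ (Fin k → ℝ)))
      + √a • ContinuousLinearMap.fst ℝ ℝ (Fin k → ℝ)
  have h : ((gaussianReal 0 t).prod (Measure.pi fun _ : Fin k => gaussianReal 0 t)).map
      (fun (z : ℝ × (Fin k → ℝ)) (l : Fin k) => √(1 - a) * z.2 l + √a * z.1 + x l)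
      = (((gaussianReal 0 t).prod (Measure.pi fun _ : Fin k => gaussianReal 0 t)).map L).map
        fun y => y + x := by
    rw [Measure.map_map (by fun_prop) (by fun_prop)]
    rfl
  exact ⟨by rw [h]; infer_instance⟩

/-- The individual noises contribute `(1 - a) t` on the diagonal only, the common noise `a t`
everywhere. -/
theorem covariance_particleShift {a : ℝ} (ha0 : 0 ≤ a) (ha1 : a ≤ 1) {k : ℕ} (t : ℝ≥0)
    (x : Fin k → ℝ) (l m : Fin k) :
    cov[fun z : ℝ × (Fin k → ℝ) => √(1 - a) * z.2 l + √a * z.1 + x l,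
      fun z => √(1 - a) * z.2 m + √a * z.1 + x m;
      (gaussianReal 0 t).prod (Measure.pi fun _ : Fin k => gaussianReal 0 t)] =
      if l = m then (t : ℝ) else a * t := by
  have hW := (hasGaussianLaw_fst k t).memLp_two
  have hZ := fun l => (hasGaussianLaw_snd_apply k t l).memLp_two
  have hZc : ∀ l, MemLp (fun z : ℝ × (Fin k → ℝ) => √(1 - a) * z.2 l) 2
      ((gaussianReal 0 t).prod (Measure.pi fun _ : Fin k => gaussianReal 0 t)) :=
    fun l => (hZ l).const_mul _
  have hWc : MemLp (fun z : ℝ × (Fin k → ℝ) => √a * z.1) 2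
      ((gaussianReal 0 t).prod (Measure.pi fun _ : Fin k => gaussianReal 0 t)) := hW.const_mul _
  have hs : ∀ l, MemLp (fun z : ℝ × (Fin k → ℝ) => √(1 - a) * z.2 l + √a * z.1) 2
      ((gaussianReal 0 t).prod (Measure.pi fun _ : Fin k => gaussianReal 0 t)) :=
    fun l => (hZc l).add hWc
  rw [covariance_add_const_left ((hs l).integrable (by norm_num)),
    covariance_add_const_right ((hs m).integrable (by norm_num))]
  change cov[(fun z : ℝ × (Fin k → ℝ) => √(1 - a) * z.2 l) + fun z => √a * z.1,
    (fun z : ℝ × (Fin k → ℝ) => √(1 - a) * z.2 m) + fun z => √a * z.1; _] = _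
  rw [covariance_add_left (hZc l) hWc ((hZc m).add hWc), covariance_add_right (hZc l) (hZc m) hWc,
    covariance_add_right hWc (hZc m) hWc]
  simp_rw [covariance_const_mul_left, covariance_const_mul_right]
  rw [covariance_comm (fun z : ℝ × (Fin k → ℝ) => z.2 l) fun z => z.1,
    covariance_fst_fst_gaussian, covariance_fst_snd_gaussian, covariance_fst_snd_gaussian,
    covariance_snd_snd_gaussian]
  have h1 : √(1 - a) * √(1 - a) = 1 - a := Real.mul_self_sqrt (by linarith)
  have h2 : √a * √a = a := Real.mul_self_sqrt ha0
  split_ifs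
  · linear_combination (t : ℝ) * h1 + (t : ℝ) * h2
  · linear_combination (t : ℝ) * h2

theorem integral_particleShift (a : ℝ) {k : ℕ} (t : ℝ≥0) (x : Fin k → ℝ) (l : Fin k) :
    ∫ z, √(1 - a) * z.2 l + √a * z.1 + x l
      ∂((gaussianReal 0 t).prod (Measure.pi fun _ : Fin k => gaussianReal 0 t)) = x l := by
  have hW := ((hasGaussianLaw_fst k t).integrable).const_mul √a
  have hZ := ((hasGaussianLaw_snd_apply k t l).integrable).const_mul √(1 - a)
  have hs : Integrable (fun z : ℝ × (Fin k → ℝ) => √(1 - a) * z.2 l + √a * z.1)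
    ((gaussianReal 0 t).prod (Measure.pi fun _ : Fin k => gaussianReal 0 t)) := hZ.add hW
  rw [integral_add hs (integrable_const _), integral_add hZ hW, integral_const_mul,
    integral_const_mul, integral_fst_gaussian, integral_snd_apply_gaussian]
  simp

/-- The law of finitely many correlated Brownian motions at a fixed time. -/
theorem IsCorrelatedBM.map_eq_particleKernel {κ Ω : Type*} [MeasurableSpace Ω] {a : ℝ}
    (ha0 : 0 ≤ a) (ha1 : a ≤ 1) {x : κ → ℝ} {X : κ → ℝ≥0 → Ω → ℝ} {P : Measure Ω}
    (hX : IsCorrelatedBM a x X P) (t : ℝ≥0) {k : ℕ} (e : Fin k ↪ κ) :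
    P.map (fun ω l => X (e l) t ω) = particleKernel a k t (x ∘ e) := by
  refine map_pi_eq_of_hasGaussianLaw (X := fun l ω => X (e l) t ω)
    (Y := fun l (z : ℝ × (Fin k → ℝ)) => √(1 - a) * z.2 l + √a * z.1 + (x ∘ e) l) ?_
    (hasGaussianLaw_particleShift a t (x ∘ e)) ?_ ?_
  · have h1 : IsGaussianProcess (fun l : Fin k => X (e l) t) P :=
      hX.gaussian.comp_right fun l : Fin k => (e l, t)
    have h2 := h1.hasGaussianLaw Finset.univ
    let L : (↥(Finset.univ : Finset (Fin k)) → ℝ) →L[ℝ] (Fin k → ℝ) :=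
      ContinuousLinearMap.pi fun l => ContinuousLinearMap.proj ⟨l, Finset.mem_univ l⟩
    exact h2.map_fun L
  · intro l
    rw [hX.mean, integral_particleShift]
    rfl
  · intro l m
    rw [covariance_particleShift ha0 ha1]
    split_ifs with h
    · subst h
      rw [hX.cov_same]
      simp
    · rw [hX.cov_ne _ _ _ _ (e.injective.ne h)]
      simp

/-! ### Factorial moments of the particle system -/

section System

variable {a : ℝ} {Ω : Type*} [MeasurableSpace Ω] {η : ℝ≥0 → Ω → Config} {P : Config → Measure Ω}

theorem IsUnlabeledCorrelatedBM.exists_map_eq (hη : IsUnlabeledCorrelatedBM a η P) (t : ℝ≥0)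
    {n : ℕ∞} (x : Idx n → ℝ) : ∃ (Ω' : Type) (_ : MeasurableSpace Ω') (P' : Measure Ω')
      (X : Idx n → ℝ≥0 → Ω' → ℝ), IsProbabilityMeasure P' ∧ IsCorrelatedBM a x X P' ∧
      AEMeasurable (fun ω => iota fun k => X k t ω) P' ∧
      (P (iota x)).map (η t) = P'.map fun ω => iota fun k => X k t ω := by
  obtain ⟨Ω', m, P', X, h1, h2, h3⟩ := hη.law n x
  have h4 := h3.comp (measurable_pi_apply t)
  exact ⟨Ω', m, P', X, h1, h2, h4.aemeasurable_snd, h4.map_eq⟩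

/-- The factorial measure at time `t` is a sum over injective tuples of labels. Each such tuple of
particles has the law `particleKernel` started from its initial positions, and Tonelli's theorem
applies to the countably many tuples. -/
theorem lintegral_factorialMeasure_iota (ha0 : 0 ≤ a) (ha1 : a ≤ 1) {n : ℕ∞} {x : Idx n → ℝ}
    {Ω' : Type*} [MeasurableSpace Ω'] {P' : Measure Ω'} {X : Idx n → ℝ≥0 → Ω' → ℝ}
    (hX : IsCorrelatedBM a x X P') (t : ℝ≥0) {k : ℕ} {B : Set (Fin k → ℝ)} (hB : MeasurableSet B) :
    ∫⁻ ω, factorialMeasure k (iota fun k => X k t ω) B ∂P' =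
      ∫⁻ y, particleKernel a k t y B ∂(factorialMeasure k (iota x)) := by
  have hm : ∀ e : Fin k ↪ Idx n, Measurable fun ω => (fun l => X (e l) t ω : Fin k → ℝ) :=
    fun e => measurable_pi_lambda _ fun l => hX.measurable _ _
  rw [factorialMeasure_iota, lintegral_factorialSum x (f := fun y => particleKernel a k t y B)
    ((Measure.measurable_coe hB).comp (measurable_particleKernel a k t))]
  have h1 : ∀ ω, factorialMeasure k (iota fun k => X k t ω) B
      = ∑' e : Fin k ↪ Idx n, B.indicator 1 (fun l => X (e l) t ω) := by
    intro ω
    rw [factorialMeasure_iota, ← lintegral_indicator_one hB,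
      lintegral_factorialSum _ (measurable_one.indicator hB)]
    rfl
  simp_rw [h1]
  have : Countable (Fin k ↪ Idx n) := DFunLike.coe_injective.countable
  rw [lintegral_tsum (f := fun (e : Fin k ↪ Idx n) ω => B.indicator 1 fun l => X (e l) t ω)
    fun e => ((measurable_one.indicator hB).comp (hm e)).aemeasurable]
  refine tsum_congr fun e => ?_
  rw [← hX.map_eq_particleKernel ha0 ha1 t e, ← lintegral_indicator_one hB,
    lintegral_map (measurable_one.indicator hB) (hm e)]

/-- The mean number of points in `B`. It is stated with `factorialMeasure` rather than
`factorialKernel` because it serves to prove that `η t` is locally finite. -/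
theorem IsUnlabeledCorrelatedBM.lintegral_apply (hη : IsUnlabeledCorrelatedBM a η P)
    (ha0 : 0 ≤ a) (ha1 : a ≤ 1) (t : ℝ≥0) (μ : Config) {B : Set ℝ} (hB : MeasurableSet B) :
    ∫⁻ ω, (η t ω).1 B ∂(P μ) =
      ∫⁻ y, particleKernel a 1 t y {y | y 0 ∈ B} ∂(factorialMeasure 1 μ) := by
  obtain ⟨n, x, rfl⟩ := exists_eq_iota μ
  obtain ⟨Ω', _, P', X, _, hX, hm, hmap⟩ := hη.exists_map_eq t x
  have hB' : MeasurableSet {y : Fin 1 → ℝ | y 0 ∈ B} := measurable_pi_apply 0 hB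
  rw [← lintegral_factorialMeasure_iota ha0 ha1 hX t hB',
    ← lintegral_map (f := fun ν : Config => ν.1 B) (measurable_config_apply hB)
      (hη.markovFamily.measurable t), hmap, lintegral_map' (measurable_config_apply hB).aemeasurable
      hm]
  refine lintegral_congr fun ω => ?_
  rw [← lintegral_indicator_one hB, ← lintegral_indicator_one hB',
    ← lintegral_factorialMeasure_one _ (measurable_one.indicator hB)]
  rfl

/-- This transfers the dynamics of configurations to that of `k` particles. Local finiteness is
required at both times because `factorialKernel` vanishes on all other configurations. -/
theorem IsUnlabeledCorrelatedBM.map_bind_factorialKernel (hη : IsUnlabeledCorrelatedBM a η P)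
    (ha0 : 0 ≤ a) (ha1 : a ≤ 1) (t : ℝ≥0) {μ : Config} (hμ : μ ∈ locallyFiniteConfig)
    (hμ' : ∀ᵐ ω ∂(P μ), η t ω ∈ locallyFiniteConfig) (k : ℕ) :
    ((P μ).map (η t)).bind (factorialKernel k) =
      (factorialKernel k μ).bind (particleKernel a k t) := by
  obtain ⟨n, x, rfl⟩ := exists_eq_iota μ
  obtain ⟨Ω', _, P', X, _, hX, hm, hmap⟩ := hη.exists_map_eq t x
  have hμ'' : ∀ᵐ ω ∂P', (iota fun k => X k t ω) ∈ locallyFiniteConfig := by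
    refine ae_of_ae_map hm (p := fun ν => ν ∈ locallyFiniteConfig) ?_
    rw [← hmap]
    exact (ae_map_iff (p := fun ν => ν ∈ locallyFiniteConfig)
      (hη.markovFamily.measurable t).aemeasurable measurableSet_locallyFiniteConfig).2 hμ'
  ext B hB
  rw [Measure.bind_apply hB (measurable_factorialKernel k).aemeasurable,
    Measure.bind_apply hB (measurable_particleKernel a k t).aemeasurable, hmap,
    lintegral_map' (f := fun ν => factorialKernel k ν B)
      ((Measure.measurable_coe hB).comp (measurable_factorialKernel k)).aemeasurable hm,
    factorialKernel_of_mem hμ, ← lintegral_factorialMeasure_iota ha0 ha1 hX t hB]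
  refine lintegral_congr_ae ?_
  filter_upwards [hμ''] with ω hω
  rw [factorialKernel_of_mem hω]

end System

/-! ### Integration against mixtures -/

section Bind

variable {α β E : Type*} [MeasurableSpace α] [MeasurableSpace β] [NormedAddCommGroup E]
  {m : Measure α} {κ : α → Measure β} {f : β → E}

theorem ae_integrable_of_integrable_bind (hκ : Measurable κ) (hf : Integrable f (m.bind κ)) :
    ∀ᵐ x ∂m, Integrable f (κ x) :=
  Measure.ae_integrable_of_integrable_comp (κ := ⟨κ, hκ⟩) hf

theorem integrable_integral_bind [NormedSpace ℝ E] (hκ : Measurable κ)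
    (hf : Integrable f (m.bind κ)) : Integrable (fun x => ∫ y, f y ∂(κ x)) m := by
  let κ' : Kernel α β := ⟨κ, hκ⟩
  have hf' : Integrable f ((κ' ∘ₖ Kernel.const Unit m) ()) := by
    rwa [← Measure.comp_eq_comp_const_apply]
  have h := hf'.integral_comp
  rwa [Kernel.const_apply] at h

theorem integral_bind [NormedSpace ℝ E] (hκ : Measurable κ) (hf : Integrable f (m.bind κ)) :
    ∫ y, f y ∂(m.bind κ) = ∫ x, ∫ y, f y ∂(κ x) ∂m := by
  let κ' : Kernel α β := ⟨κ, hκ⟩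
  have hf' : Integrable f ((κ' ∘ₖ Kernel.const Unit m) ()) := by
    rwa [← Measure.comp_eq_comp_const_apply]
  have h := Kernel.integral_comp hf'
  rwa [← Measure.comp_eq_comp_const_apply, Kernel.const_apply] at h

end Bind

/-! ### Factorial expansion of products over a configuration -/

/-- Each set of `k` indices is the range of exactly `k!` injective tuples. -/
theorem sum_embedding_prod {α R : Type*} [Fintype α] [CommSemiring R] (k : ℕ) (g : α → R) :
    ∑ e : Fin k ↪ α, ∏ l, g (e l) =
      k.factorial * ∑ T ∈ Finset.univ.powersetCard k, ∏ i ∈ T, g i := by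
  classical
  have h1 : ∀ e : Fin k ↪ α, ∏ l, g (e l) = ∏ i ∈ Finset.univ.map e, g i := fun e =>
    (Finset.prod_map _ _ _).symm
  simp_rw [h1]
  rw [← Finset.sum_fiberwise_of_maps_to (s := (Finset.univ : Finset (Fin k ↪ α)))
    (t := Finset.univ.powersetCard k) (g := fun e => Finset.univ.map e)
    (fun e _ => by simp [Finset.mem_powersetCard]), Finset.mul_sum]
  refine Finset.sum_congr rfl fun T hT => ?_
  have hcard : T.card = k := (Finset.mem_powersetCard.1 hT).2
  rw [Finset.sum_congr rfl (g := fun _ => ∏ i ∈ T, g i) fun e he => by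
    rw [(Finset.mem_filter.1 he).2], Finset.sum_const, nsmul_eq_mul]
  congr 2
  rw [← Fintype.card_subtype]
  have e : {e : Fin k ↪ α // Finset.univ.map e = T} ≃ (Fin k ≃ T) :=
    { toFun := fun e => Equiv.ofBijective
        (fun l => (⟨e.1 l, (Finset.ext_iff.1 e.2 (e.1 l)).1 (by simp)⟩ : T)) (by
          constructor
          · intro l m hlm
            exact e.1.injective (congrArg Subtype.val hlm)
          · intro i
            obtain ⟨l, -, hl⟩ := Finset.mem_map.1 ((Finset.ext_iff.1 e.2 i.1).2 i.2)
            exact ⟨l, Subtype.ext hl⟩)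
      invFun := fun e => ⟨e.toEmbedding.trans (Function.Embedding.subtype _), by
        ext i
        simp only [Finset.mem_map, Finset.mem_univ, true_and]
        constructor
        · rintro ⟨l, rfl⟩
          exact (e l).2
        · intro hi
          exact ⟨e.symm ⟨i, hi⟩, by simp⟩⟩
      left_inv := fun e => by ext; rfl
      right_inv := fun e => by ext; rfl }
  rw [Fintype.card_congr e, Fintype.card_equiv (Fintype.equivFinOfCardEq (by simp [hcard])).symm,
    Fintype.card_fin]

/-- A finite expansion of the product over subsets: the terms with `k` above the number of indices
vanish. The form of a series anticipates a random number of points. -/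
theorem hasSum_sum_embedding_prod {α : Type*} [Fintype α] (g : α → ℂ) :
    HasSum (fun k : ℕ => (k.factorial : ℂ)⁻¹ * ∑ e : Fin k ↪ α, ∏ l, g (e l))
      (∏ i, (1 + g i)) := by
  classical
  have h : ∀ k : ℕ, (k.factorial : ℂ)⁻¹ * ∑ e : Fin k ↪ α, ∏ l, g (e l)
      = ∑ T ∈ Finset.univ.powersetCard k, ∏ i ∈ T, g i := by
    intro k
    rw [sum_embedding_prod, inv_mul_cancel_left₀ (by exact_mod_cast k.factorial_ne_zero)]
  simp_rw [h]
  rw [Finset.prod_one_add, Finset.sum_powerset]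
  refine hasSum_sum_of_ne_finset_zero fun k hk => ?_
  rw [Finset.powersetCard_eq_empty.2 (by simpa using hk), Finset.sum_empty]

/-- Only the finitely many points in the support interval of `h` contribute, so the generating
functional of the configuration is expressed by its factorial measures. -/
theorem hasSum_integral_factorialMeasure_iota {n : ℕ∞} {x : Idx n → ℝ}
    (hx : iota x ∈ locallyFiniteConfig) {h : ℝ → ℂ} (hm : Measurable h) {C : ℝ}
    (hC : ∀ r, ‖h r‖ ≤ C) {m : ℕ} (hsupp : ∀ r ∉ Set.Icc (-m : ℝ) m, h r = 0) {S : Finset (Idx n)}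
    (hS : ∀ i, i ∈ S ↔ x i ∈ Set.Icc (-m : ℝ) m) :
    HasSum (fun k : ℕ => (k.factorial : ℂ)⁻¹ *
      ∫ y : Fin k → ℝ, ∏ l, h (y l) ∂(factorialKernel k (iota x)))
      (∏ i ∈ S, (1 + h (x i))) := by
  rw [← Finset.prod_coe_sort S]
  convert hasSum_sum_embedding_prod fun i : S => h (x i) using 3 with k
  have hC0 : 0 ≤ C := (norm_nonneg _).trans (hC 0)
  have hGm : Measurable fun y : Fin k → ℝ => ∏ l, h (y l) := by fun_prop
  have hG0 : ∀ y : Fin k → ℝ, y ∉ cube k m → ∏ l, h (y l) = 0 := by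
    intro y hy
    have hy' : ∃ l, y l ∉ Set.Icc (-m : ℝ) m := by
      by_contra hcon
      push Not at hcon
      exact hy fun l _ => hcon l
    obtain ⟨l, hl⟩ := hy'
    exact Finset.prod_eq_zero (Finset.mem_univ l) (hsupp _ hl)
  have hint : Integrable (fun y : Fin k → ℝ => ∏ l, h (y l)) (factorialKernel k (iota x)) := by
    rw [← integrableOn_iff_integrable_of_support_subset (s := cube k m)
      fun y hy => by_contra fun hcon => hy (hG0 y hcon)]
    refine Measure.integrableOn_of_bounded (M := C ^ k) (factorialKernel_cube_lt_top k m _).ne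
      hGm.aestronglyMeasurable (Filter.Eventually.of_forall fun y => ?_)
    rw [norm_prod]
    refine (Finset.prod_le_prod (fun _ _ => norm_nonneg _) fun l _ => hC (y l)).trans_eq ?_
    simp
  rw [factorialKernel_of_mem hx, factorialMeasure_iota, factorialSum] at hint ⊢
  rw [← (hasSum_integral_measure hint).tsum_eq]
  have h1 : ∀ e : Fin k ↪ Idx n, ∫ y : Fin k → ℝ, ∏ l, h (y l) ∂(Measure.dirac (x ∘ e))
      = ∏ l, h (x (e l)) := fun e => integral_dirac _ _
  simp_rw [h1]
  -- A tuple using an index outside `S` has a vanishing factor, so the sum over all tuples reduces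
  -- to tuples in `S`.
  let g : (Fin k ↪ S) → (Fin k ↪ Idx n) := fun e => e.trans (Function.Embedding.subtype _)
  have hg : Function.Injective g := by
    intro e e' hee
    ext l
    exact congrArg Subtype.val (DFunLike.congr_fun hee l)
  rw [← hg.tsum_eq, tsum_fintype]
  · rfl
  · intro e he
    have he' : ∀ l, e l ∈ S := by
      intro l
      rw [hS]
      by_contra hl
      exact he (Finset.prod_eq_zero (Finset.mem_univ l) (hsupp _ hl))
    exact ⟨⟨fun l => ⟨e l, he' l⟩, fun l m hlm => e.injective (congrArg Subtype.val hlm)⟩, rfl⟩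

/-- The function `exp(i ∑_j c_j 1_{B_j}) - 1`. -/
noncomputable def expStep {ι : Type*} [Fintype ι] (c : ι → ℝ) (B : ι → Set ℝ) (r : ℝ) : ℂ :=
  Complex.exp ((∑ j, c j * (B j).indicator 1 r : ℝ) * Complex.I) - 1

/-! ### Lebesgue factorial moments determine the law. -/

section ExpStep

variable {ι : Type*} [Fintype ι] {B : ι → Set ℝ}

theorem measurable_expStep (c : ι → ℝ) (hB : ∀ j, MeasurableSet (B j)) :
    Measurable (expStep c B) := by
  have h : ∀ j, Measurable ((B j).indicator (1 : ℝ → ℝ)) := fun j =>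
    measurable_one.indicator (hB j)
  unfold expStep
  fun_prop

theorem norm_expStep_le (c : ι → ℝ) (r : ℝ) : ‖expStep c B r‖ ≤ 2 := by
  refine (norm_sub_le _ _).trans ?_
  rw [Complex.norm_exp_ofReal_mul_I]
  norm_num

theorem expStep_eq_zero (c : ι → ℝ) {A : Set ℝ} (hA : ∀ j, B j ⊆ A) {r : ℝ} (hr : r ∉ A) :
    expStep c B r = 0 := by
  have h : ∀ j, (B j).indicator (1 : ℝ → ℝ) r = 0 := fun j =>
    Set.indicator_of_notMem (fun h => hr (hA j h)) _
  simp [expStep, h]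

/-- One plus `expStep` is an exponential, so its product over the points is the exponential of the
linear combination of the counts. -/
theorem hasSum_integral_expStep {μ : Config} (hμ : μ ∈ locallyFiniteConfig) (c : ι → ℝ)
    (hB : ∀ j, MeasurableSet (B j)) {m : ℕ} (hBm : ∀ j, B j ⊆ Set.Icc (-m : ℝ) m) :
    HasSum (fun k : ℕ => (k.factorial : ℂ)⁻¹ *
      ∫ y : Fin k → ℝ, ∏ l, expStep c B (y l) ∂(factorialKernel k μ))
      (Complex.exp ((∑ j, c j * (μ.1 (B j)).toReal : ℝ) * Complex.I)) := by
  obtain ⟨n, x, rfl⟩ := exists_eq_iota μ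
  have hfin : {i | x i ∈ Set.Icc (-m : ℝ) m}.Finite := by
    have h1 := hμ m
    have h2 : (iota x).1 (Set.Icc (-m : ℝ) m)
        = ∑' i, (Set.Icc (-m : ℝ) m).indicator 1 (x i) := by
      rw [← lintegral_indicator_one measurableSet_Icc]
      exact lintegral_diracSum x (measurable_one.indicator measurableSet_Icc)
    rw [h2] at h1
    have h3 := ENNReal.finite_const_le_of_tsum_ne_top h1.ne one_ne_zero
    refine h3.subset fun i hi => ?_
    have hi' : x i ∈ Set.Icc (-m : ℝ) m := hi
    simp [Set.indicator_of_mem hi']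
  have hS : ∀ i, i ∈ hfin.toFinset ↔ x i ∈ Set.Icc (-m : ℝ) m := fun i => by simp
  convert hasSum_integral_factorialMeasure_iota hμ (measurable_expStep c hB) (norm_expStep_le c)
    (fun r hr => expStep_eq_zero c hBm hr) hS using 1
  have h4 : ∀ j, ((iota x).1 (B j)).toReal
      = ∑ i ∈ hfin.toFinset, (B j).indicator (1 : ℝ → ℝ) (x i) := by
    intro j
    have h2 : (iota x).1 (B j) = ∑' i, (B j).indicator 1 (x i) := by
      rw [← lintegral_indicator_one (hB j)]
      exact lintegral_diracSum x (measurable_one.indicator (hB j))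
    rw [h2, tsum_eq_sum (s := hfin.toFinset), ENNReal.toReal_sum]
    · refine Finset.sum_congr rfl fun i _ => ?_
      by_cases h : x i ∈ B j <;> simp [h]
    · intro i _
      by_cases h : x i ∈ B j <;> simp [h]
    · intro i hi
      rw [hS] at hi
      exact Set.indicator_of_notMem (fun h => hi (hBm j h)) _
  simp_rw [h4, expStep, add_sub_cancel, ← Complex.exp_sum, ← Finset.sum_mul,
    ← Complex.ofReal_sum, Finset.mul_sum]
  rw [Finset.sum_comm]

/-- The characteristic function of the numbers of points in bounded sets. -/
theorem HasLebesgueFactorialMoments.integral_exp {π : Measure Config} [IsProbabilityMeasure π]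
    (hπ : HasLebesgueFactorialMoments π) (c : ι → ℝ)
    (hB : ∀ j, MeasurableSet (B j)) {m : ℕ} (hBm : ∀ j, B j ⊆ Set.Icc (-m : ℝ) m) :
    ∫ μ : Config, Complex.exp ((∑ j, c j * (μ.1 (B j)).toReal : ℝ) * Complex.I) ∂π =
      ∑' k : ℕ, (k.factorial : ℂ)⁻¹ * ∫ y : Fin k → ℝ, ∏ l, expStep c B (y l) := by
  have hint1 : Integrable (expStep c B) := by
    rw [← integrableOn_iff_integrable_of_support_subset (s := Set.Icc (-m : ℝ) m)
      fun y hy => by_contra fun hcon => hy (expStep_eq_zero c hBm hcon)]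
    exact Measure.integrableOn_of_bounded (M := 2) measure_Icc_lt_top.ne
      (measurable_expStep c hB).aestronglyMeasurable
      (Filter.Eventually.of_forall fun y => norm_expStep_le c y)
  have hint : ∀ k : ℕ, Integrable fun y : Fin k → ℝ => ∏ l, expStep c B (y l) := fun k =>
    Integrable.fintype_prod fun _ => hint1
  have hintb : ∀ k : ℕ, Integrable (fun y : Fin k → ℝ => ∏ l, expStep c B (y l))
      (π.bind (factorialKernel k)) := by
    intro k
    rw [hπ k]
    exact hint k
  -- Because the factorial moments are Lebesgue measures, the `k`-th term is at most `Cᵏ / k!` with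
  -- `C` the `L¹` norm of `expStep`. This justifies exchanging series and expectation.
  have hnorm : ∀ k : ℕ, ∫ μ, ‖(k.factorial : ℂ)⁻¹ *
      ∫ y : Fin k → ℝ, ∏ l, expStep c B (y l) ∂(factorialKernel k μ)‖ ∂π
      ≤ (∫ r, ‖expStep c B r‖) ^ k / k.factorial := by
    intro k
    have h1 : ∫ y : Fin k → ℝ, ‖∏ l, expStep c B (y l)‖ = (∫ r, ‖expStep c B r‖) ^ k := by
      simp_rw [norm_prod]
      rw [integral_fintype_prod_volume_eq_pow fun r => ‖expStep c B r‖, Fintype.card_fin]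
    rw [← h1, ← hπ k, integral_bind (measurable_factorialKernel k) (hintb k).norm,
      div_eq_inv_mul, ← integral_const_mul]
    refine integral_mono_of_nonneg (Filter.Eventually.of_forall fun μ => norm_nonneg _)
      ((integrable_integral_bind (measurable_factorialKernel k) (hintb k).norm).const_mul _)
      (Filter.Eventually.of_forall fun μ => ?_)
    simp only [norm_mul, norm_inv, Complex.norm_natCast]
    gcongr
    exact norm_integral_le_integral_norm _
  have h := hasSum_integral_of_summable_integral_norm (μ := π)
    (F := fun (k : ℕ) (μ : Config) => (k.factorial : ℂ)⁻¹ *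
      ∫ y : Fin k → ℝ, ∏ l, expStep c B (y l) ∂(factorialKernel k μ))
    (fun k => (integrable_integral_bind (measurable_factorialKernel k) (hintb k)).const_mul _)
    (Summable.of_nonneg_of_le (fun k => integral_nonneg fun _ => norm_nonneg _) hnorm
      (Real.summable_pow_div_factorial _))
  have h2 : ∫ μ : Config, Complex.exp ((∑ j, c j * (μ.1 (B j)).toReal : ℝ) * Complex.I) ∂π
      = ∫ μ, ∑' k : ℕ, (k.factorial : ℂ)⁻¹ *
        ∫ y : Fin k → ℝ, ∏ l, expStep c B (y l) ∂(factorialKernel k μ) ∂π := by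
    refine integral_congr_ae ?_
    filter_upwards [hπ.ae_mem_locallyFiniteConfig] with μ hμ
    exact (hasSum_integral_expStep hμ c hB hBm).tsum_eq.symm
  rw [h2, ← h.tsum_eq]
  refine tsum_congr fun k => ?_
  rw [integral_const_mul, ← integral_bind (measurable_factorialKernel k) (hintb k), hπ k]

/-- The characteristic functions of both count vectors are given by the same series, which no longer
involves the law. -/
theorem HasLebesgueFactorialMoments.map_eq {π π' : Measure Config} [IsProbabilityMeasure π]
    [IsProbabilityMeasure π'] (hπ : HasLebesgueFactorialMoments π)
    (hπ' : HasLebesgueFactorialMoments π') (hB : ∀ j, MeasurableSet (B j)) {m : ℕ}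
    (hBm : ∀ j, B j ⊆ Set.Icc (-m : ℝ) m) :
    π.map (fun μ j => (μ.1 (B j)).toReal) = π'.map fun μ j => (μ.1 (B j)).toReal := by
  classical
  have hmeas : Measurable fun (μ : Config) (j : ι) => (μ.1 (B j)).toReal :=
    measurable_pi_lambda _ fun j => (measurable_config_apply (hB j)).ennreal_toReal
  have := Measure.isProbabilityMeasure_map (μ := π) hmeas.aemeasurable
  have := Measure.isProbabilityMeasure_map (μ := π') hmeas.aemeasurable
  refine Measure.ext_of_charFunDual (funext fun L => ?_)
  have hL : ∀ μ : Config, L (fun j => (μ.1 (B j)).toReal)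
      = ∑ j, L (Pi.single j 1) * (μ.1 (B j)).toReal := by
    intro μ
    conv_lhs => rw [pi_eq_sum_univ' fun j => (μ.1 (B j)).toReal]
    rw [map_sum]
    refine Finset.sum_congr rfl fun l _ => ?_
    rw [map_smul, smul_eq_mul, mul_comm]
  have hLm : Measurable fun v : ι → ℝ => Complex.exp (L v * Complex.I) := by
    have := L.continuous.measurable
    fun_prop
  rw [charFunDual_apply, charFunDual_apply,
    integral_map hmeas.aemeasurable hLm.aestronglyMeasurable,
    integral_map hmeas.aemeasurable hLm.aestronglyMeasurable]
  simp_rw [hL]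
  rw [hπ.integral_exp _ hB hBm, hπ'.integral_exp _ hB hBm]

end ExpStep

/-- Probability measures whose factorial moment measures are Lebesgue measures agree. -/
theorem HasLebesgueFactorialMoments.unique {π π' : Measure Config} [IsProbabilityMeasure π]
    [IsProbabilityMeasure π'] (hπ : HasLebesgueFactorialMoments π)
    (hπ' : HasLebesgueFactorialMoments π') : π = π' := by
  let I : Type := {B : Set ℝ // MeasurableSet B ∧ ∃ m : ℕ, B ⊆ Set.Icc (-m : ℝ) m}
  let Φ : Config → I → ℝ := fun μ B => (μ.1 B.1).toReal
  have hΦ : Measurable Φ :=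
    measurable_pi_lambda _ fun B => (measurable_config_apply B.2.1).ennreal_toReal
  -- The counts of all bounded Borel sets form a process whose finite-dimensional laws are known;
  -- finitely many bounded sets lie in a common interval.
  have hmap : π.map Φ = π'.map Φ := by
    refine IsProjectiveLimit.unique (P := fun J => (π'.map Φ).map J.restrict) (ι := I) ?_
      fun J => rfl
    intro J
    change _ = (π'.map Φ).map J.restrict
    rw [Measure.map_map (Finset.measurable_restrict J) hΦ,
      Measure.map_map (Finset.measurable_restrict J) hΦ]
    choose M hM using fun B : I => B.2.2
    refine hπ.map_eq hπ' (B := fun j : J => j.1.1) (fun j => j.1.2.1) (m := J.sup M) fun j => ?_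
    refine (hM j.1).trans (Set.Icc_subset_Icc ?_ ?_)
    · exact neg_le_neg (by exact_mod_cast Finset.le_sup (f := M) j.2)
    · exact_mod_cast Finset.le_sup (f := M) j.2
  let Ψ : locallyFiniteConfig → I → ℝ := fun μ => Φ μ.1
  -- Real-valued counts lose the value `∞`, but on locally finite configurations the counts of
  -- bounded sets generate the full σ-algebra: `μ B` is the supremum over the bounded pieces of `B`.
  -- Both laws are carried by these configurations.
  have hval : Measurable[MeasurableSpace.comap Ψ inferInstance]
      (Subtype.val : locallyFiniteConfig → Config) := by
    refine @Measurable.subtype_mk _ _ (MeasurableSpace.comap Ψ inferInstance) _ _ _ ?_ _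
    refine @Measure.measurable_of_measurable_coe _ _ _ (MeasurableSpace.comap Ψ inferInstance) _
      fun B hB => ?_
    have h1 : (fun μ : locallyFiniteConfig => μ.1.1 B) = fun μ =>
        ⨆ m : ℕ, ENNReal.ofReal (Ψ μ ⟨B ∩ Set.Icc (-m : ℝ) m, hB.inter measurableSet_Icc, m,
          Set.inter_subset_right⟩) := by
      funext μ
      have h2 : B = ⋃ m : ℕ, B ∩ Set.Icc (-m : ℝ) m := by
        rw [← Set.inter_iUnion, Set.iUnion_eq_univ_iff.2, Set.inter_univ]
        intro r
        obtain ⟨m, hm⟩ := exists_nat_ge |r|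
        exact ⟨m, abs_le.1 hm⟩
      conv_lhs => rw [h2]
      rw [Monotone.measure_iUnion]
      · refine iSup_congr fun m => ?_
        rw [ENNReal.ofReal_toReal]
        exact ((measure_mono Set.inter_subset_right).trans_lt (μ.2 m)).ne
      · intro m m' hmm
        have : (m : ℝ) ≤ m' := by exact_mod_cast hmm
        exact Set.inter_subset_inter_right _ (Set.Icc_subset_Icc (neg_le_neg this) this)
    rw [h1]
    refine Measurable.iSup fun m => ENNReal.measurable_ofReal.comp ?_
    exact (measurable_pi_apply _).comp (comap_measurable Ψ)
  ext A hA
  obtain ⟨A', hA', hAA⟩ := hval hA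
  have hae : ∀ {ρ : Measure Config}, (∀ᵐ μ ∂ρ, μ ∈ locallyFiniteConfig) →
      ρ A = ρ.map Φ A' := by
    intro ρ hρ
    rw [Measure.map_apply hΦ hA']
    refine measure_congr ?_
    filter_upwards [hρ] with μ hμ
    exact propext (Set.ext_iff.1 hAA ⟨μ, hμ⟩).symm
  rw [hae hπ.ae_mem_locallyFiniteConfig, hae hπ'.ae_mem_locallyFiniteConfig, hmap]

/-! ### Invariance of the Poisson law -/

section Invariance

variable {a : ℝ} {Ω : Type*} [MeasurableSpace Ω] {η : ℝ≥0 → Ω → Config} {P : Config → Measure Ω}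
  {Ω₀ : Type*} [MeasurableSpace Ω₀] {Q : Measure Ω₀} {ζ : Ω₀ → Config}

/-- Measurability of the starting configuration in `P` is assumed only along enumerations with a
fixed number of points. Properness of `ζ` provides measurable enumerations once the values of `K`
are separated. -/
theorem IsMarkovFamily.measurable_map_comp (hη : IsMarkovFamily η P) (hζ : IsProper ζ)
    (t : ℝ≥0) : Measurable fun ω => (P (ζ ω)).map (η t) := by
  obtain ⟨K, Z, hK, hZ, h⟩ := hζ
  refine Measure.measurable_of_measurable_coe _ fun A hA => ?_
  intro S hS
  have h1 : (fun ω => (P (ζ ω)).map (η t) A) ⁻¹' S = ⋃ n : ℕ∞, K ⁻¹' {n} ∩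
      (fun ω => P (iota fun k : Idx n => Z k.1 ω) (η t ⁻¹' A)) ⁻¹' S := by
    ext ω
    have h2 : ζ ω = iota fun k : Idx (K ω) => Z k.1 ω := Subtype.ext (h ω)
    simp only [Set.mem_preimage, Set.mem_iUnion, Set.mem_inter_iff, Set.mem_singleton_iff]
    rw [Measure.map_apply (hη.measurable t) hA]
    constructor
    · intro hω
      exact ⟨K ω, rfl, by rwa [← h2]⟩
    · rintro ⟨n, rfl, hω⟩
      rwa [h2]
  rw [h1]
  refine MeasurableSet.iUnion fun n => (hK (measurableSet_singleton n)).inter ?_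
  exact (hη.measurable_prob n t A hA).comp
    (measurable_pi_lambda (fun ω (k : Idx n) => Z k.1 ω) fun k => hZ k.1) hS

/-- Averaged over `ζ`, the mean number of points of `η t` in `[-m, m]` is the length of that
interval, since the one-particle kernel preserves Lebesgue measure. A finite mean forces finite
counts. -/
theorem IsUnlabeledCorrelatedBM.ae_ae_mem_locallyFiniteConfig
    (hη : IsUnlabeledCorrelatedBM a η P) (ha0 : 0 ≤ a) (ha1 : a ≤ 1) (t : ℝ≥0)
    [IsProbabilityMeasure Q] (hζ : Measurable ζ)
    (hπ : HasLebesgueFactorialMoments (Q.map ζ)) :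
    ∀ᵐ ω ∂Q, ∀ᵐ ω' ∂(P (ζ ω)), η t ω' ∈ locallyFiniteConfig := by
  have := Measure.isProbabilityMeasure_map (μ := Q) hζ.aemeasurable
  have hLF : ∀ᵐ ω ∂Q, ζ ω ∈ locallyFiniteConfig :=
    ae_of_ae_map (p := fun μ => μ ∈ locallyFiniteConfig) hζ.aemeasurable
      hπ.ae_mem_locallyFiniteConfig
  have key : ∀ m : ℕ, ∀ᵐ ω ∂Q, ∀ᵐ ω' ∂(P (ζ ω)), (η t ω').1 (Set.Icc (-m : ℝ) m) < ∞ := by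
    intro m
    have hB : MeasurableSet {y : Fin 1 → ℝ | y 0 ∈ Set.Icc (-m : ℝ) m} :=
      measurable_pi_apply 0 measurableSet_Icc
    have hF : Measurable fun y => particleKernel a 1 t y {y | y 0 ∈ Set.Icc (-m : ℝ) m} :=
      (Measure.measurable_coe hB).comp (measurable_particleKernel a 1 t)
    have hG : Measurable fun μ => ∫⁻ y, particleKernel a 1 t y {y | y 0 ∈ Set.Icc (-m : ℝ) m}
        ∂(factorialKernel 1 μ) :=
      (Measure.measurable_lintegral hF).comp (measurable_factorialKernel 1)
    have h1 : ∫⁻ ω, ∫⁻ y, particleKernel a 1 t y {y | y 0 ∈ Set.Icc (-m : ℝ) m}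
        ∂(factorialKernel 1 (ζ ω)) ∂Q < ∞ := by
      rw [← lintegral_map (μ := Q) hG hζ, hπ.lintegral hF.aemeasurable,
        ← Measure.bind_apply hB (measurable_particleKernel a 1 t).aemeasurable,
        volume_bind_particleKernel]
      have h2 : {y : Fin 1 → ℝ | y 0 ∈ Set.Icc (-m : ℝ) m} = cube 1 m := by
        ext y
        rw [cube, Set.mem_univ_pi]
        exact ⟨fun h i => by rwa [Subsingleton.elim i 0], fun h => h 0⟩
      rw [h2, cube, volume_pi_pi]
      exact ENNReal.prod_lt_top fun _ _ => measure_Icc_lt_top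
    filter_upwards [ae_lt_top (hG.comp hζ) h1.ne, hLF] with ω h2 h3
    rw [Function.comp_apply, factorialKernel_of_mem h3,
      ← hη.lintegral_apply ha0 ha1 t _ measurableSet_Icc] at h2
    exact ae_lt_top ((measurable_config_apply measurableSet_Icc).comp
      (hη.markovFamily.measurable t)) h2.ne
  filter_upwards [ae_all_iff.2 key] with ω h
  exact ae_all_iff.2 h

theorem IsUnlabeledCorrelatedBM.ae_map_bind_factorialKernel
    (hη : IsUnlabeledCorrelatedBM a η P) (ha0 : 0 ≤ a) (ha1 : a ≤ 1) (t : ℝ≥0)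
    [IsProbabilityMeasure Q] (hζ : Measurable ζ)
    (hπ : HasLebesgueFactorialMoments (Q.map ζ)) (k : ℕ) :
    ∀ᵐ ω ∂Q, ((P (ζ ω)).map (η t)).bind (factorialKernel k) =
      (factorialKernel k (ζ ω)).bind (particleKernel a k t) := by
  have := Measure.isProbabilityMeasure_map (μ := Q) hζ.aemeasurable
  have hLF : ∀ᵐ ω ∂Q, ζ ω ∈ locallyFiniteConfig :=
    ae_of_ae_map (p := fun μ => μ ∈ locallyFiniteConfig) hζ.aemeasurable
      hπ.ae_mem_locallyFiniteConfig
  filter_upwards [hη.ae_ae_mem_locallyFiniteConfig ha0 ha1 t hζ hπ, hLF] with ω h1 h2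
  exact hη.map_bind_factorialKernel ha0 ha1 t h2 h1 k

theorem measurable_factorialKernel_bind_particleKernel (a : ℝ) (t : ℝ≥0) (k : ℕ) :
    Measurable fun μ => (factorialKernel k μ).bind (particleKernel a k t) :=
  (Measure.measurable_bind' (measurable_particleKernel a k t)).comp (measurable_factorialKernel k)

theorem bind_factorialKernel_bind_particleKernel (a : ℝ) (t : ℝ≥0) (hζ : Measurable ζ)
    (hπ : HasLebesgueFactorialMoments (Q.map ζ)) (k : ℕ) :
    Q.bind (fun ω => (factorialKernel k (ζ ω)).bind (particleKernel a k t)) = volume := by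
  have h1 : Q.bind (fun ω => factorialKernel k (ζ ω)) = volume := by
    rw [← hπ k, Measure.bind, Measure.bind, Measure.map_map (measurable_factorialKernel k) hζ]
    rfl
  rw [← Measure.bind_bind (f := fun ω => factorialKernel k (ζ ω))
    ((measurable_factorialKernel k).comp hζ).aemeasurable
    (measurable_particleKernel a k t).aemeasurable, h1, volume_bind_particleKernel]

/-- The law of a Poisson process is invariant under the dynamics. -/
theorem IsUnlabeledCorrelatedBM.bind_map_eq [IsProbabilityMeasure Q]
    (hη : IsUnlabeledCorrelatedBM a η P)
    (ha0 : 0 ≤ a) (ha1 : a ≤ 1) (t : ℝ≥0) (hζ : Measurable ζ) (hζ' : IsProper ζ)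
    (hπ : HasLebesgueFactorialMoments (Q.map ζ)) :
    Q.bind (fun ω => (P (ζ ω)).map (η t)) = Q.map ζ := by
  have hm := hη.markovFamily.measurable_map_comp hζ' t
  have := Measure.isProbabilityMeasure_map (μ := Q) hζ.aemeasurable
  have : IsProbabilityMeasure (Q.bind (fun ω => (P (ζ ω)).map (η t))) := by
    refine isProbabilityMeasure_bind hm.aemeasurable (Filter.Eventually.of_forall fun ω => ?_)
    have := hη.markovFamily.prob (ζ ω)
    exact Measure.isProbabilityMeasure_map (hη.markovFamily.measurable t).aemeasurable
  -- It suffices that the law after time `t` has Lebesgue factorial moments; they are those of `ζ`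
  -- transported by the particle kernel, which preserves Lebesgue measure.
  refine HasLebesgueFactorialMoments.unique (fun k => ?_) hπ
  rw [Measure.bind_bind hm.aemeasurable (measurable_factorialKernel k).aemeasurable,
    ← bind_factorialKernel_bind_particleKernel a t hζ hπ k, Measure.bind, Measure.bind,
    Measure.map_congr (hη.ae_map_bind_factorialKernel ha0 ha1 t hζ hπ k)]

end Invariance

/-! ### The semigroup on integrable functions -/

section Semigroup

variable {a : ℝ} {n : ℕ} {t : ℝ≥0} {f : (Fin n → ℝ) → ℝ}

theorem nParticleSemigroup_eq_of_measurable (hf : Measurable f) :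
    nParticleSemigroup a n t f = fun x => ∫ y, f y ∂(particleKernel a n t x) :=
  funext fun _ => nParticleSemigroup_eq hf.aestronglyMeasurable

theorem measurable_nParticleSemigroup (hf : Measurable f) :
    Measurable (nParticleSemigroup a n t f) := by
  rw [nParticleSemigroup_eq_of_measurable hf]
  have h := StronglyMeasurable.integral_kernel (f := f)
    (κ := (⟨particleKernel a n t, measurable_particleKernel a n t⟩ : Kernel _ _))
    hf.stronglyMeasurable
  exact h.measurable

/-- The kernel may be singular, for instance at `t = 0`, so null sets cannot be ignored at every
starting point. Invariance of Lebesgue measure shows that they can at almost every one. -/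
theorem nParticleSemigroup_congr {g : (Fin n → ℝ) → ℝ} (hf : AEStronglyMeasurable f)
    (hfg : f =ᵐ[volume] g) :
    nParticleSemigroup a n t f =ᵐ[volume] nParticleSemigroup a n t g := by
  have h1 : ∀ᵐ x : Fin n → ℝ, f =ᵐ[particleKernel a n t x] g := by
    refine Measure.ae_ae_of_ae_bind (measurable_particleKernel a n t).aemeasurable ?_
    rwa [volume_bind_particleKernel]
  have h2 : ∀ᵐ x : Fin n → ℝ, f =ᵐ[particleKernel a n t x] hf.mk f := by
    refine Measure.ae_ae_of_ae_bind (measurable_particleKernel a n t).aemeasurable ?_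
    rw [volume_bind_particleKernel]
    exact hf.ae_eq_mk
  filter_upwards [h1, h2] with x h1 h2
  have h3 : AEStronglyMeasurable f (particleKernel a n t x) := ⟨_, hf.stronglyMeasurable_mk, h2⟩
  rw [nParticleSemigroup_eq h3, nParticleSemigroup_eq (h3.congr h1), integral_congr_ae h1]

theorem ae_integrable_particleKernel (hf : Integrable f) :
    ∀ᵐ x, Integrable f (particleKernel a n t x) :=
  ae_integrable_of_integrable_bind (measurable_particleKernel a n t)
    (by rwa [volume_bind_particleKernel])

theorem integrable_nParticleSemigroup (hfm : Measurable f) (hf : Integrable f) :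
    Integrable (nParticleSemigroup a n t f) := by
  rw [nParticleSemigroup_eq_of_measurable hfm]
  exact integrable_integral_bind (measurable_particleKernel a n t)
    (by rwa [volume_bind_particleKernel])

/-- Under a probability kernel the `L¹` norm is at most the `L²` norm; integrating the squares and
using invariance of Lebesgue measure gives contractivity. -/
theorem eLpNorm_two_nParticleSemigroup_le (hf : Measurable f) :
    eLpNorm (nParticleSemigroup a n t f) 2 volume ≤ eLpNorm f 2 volume := by
  have h : eLpNorm (nParticleSemigroup a n t f) 2 volume ^ 2 ≤ eLpNorm f 2 volume ^ 2 := by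
    rw [eLpNorm_two_sq_eq_lintegral, eLpNorm_two_sq_eq_lintegral]
    conv_rhs => rw [← volume_bind_particleKernel a n t,
      Measure.lintegral_bind (measurable_particleKernel a n t).aemeasurable
        (hf.enorm.pow_const 2).aemeasurable]
    refine lintegral_mono fun x => ?_
    rw [← eLpNorm_two_sq_eq_lintegral, nParticleSemigroup_eq_of_measurable hf]
    gcongr
    refine (enorm_integral_le_lintegral_enorm _).trans ?_
    rw [← eLpNorm_one_eq_lintegral_enorm]
    exact eLpNorm_le_eLpNorm_of_exponent_le (by norm_num) hf.aestronglyMeasurable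
  exact (ENNReal.pow_le_pow_left_iff two_ne_zero).1 h

theorem memLp_nParticleSemigroup (hfm : Measurable f) (hf : MemLp f 2 volume) :
    MemLp (nParticleSemigroup a n t f) 2 volume :=
  ⟨(measurable_nParticleSemigroup hfm).aestronglyMeasurable,
    (eLpNorm_two_nParticleSemigroup_le hfm).trans_lt hf.2⟩

theorem memLp_two_integrable_particleKernel (hfm : Measurable f) (hf : MemLp f 2 volume) :
    ∀ᵐ x, Integrable f (particleKernel a n t x) := by
  have h : ∀ᵐ x, ∫⁻ y, ‖f y‖ₑ ^ 2 ∂(particleKernel a n t x) < ∞ := by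
    refine ae_lt_top ((Measure.measurable_lintegral (hfm.enorm.pow_const 2)).comp
      (measurable_particleKernel a n t)) ?_
    rw [← Measure.lintegral_bind (measurable_particleKernel a n t).aemeasurable
        (hfm.enorm.pow_const 2).aemeasurable, volume_bind_particleKernel,
      ← eLpNorm_two_sq_eq_lintegral]
    exact (ENNReal.pow_lt_top hf.2).ne
  filter_upwards [h] with x hx
  rw [← eLpNorm_two_sq_eq_lintegral] at hx
  have h2 : MemLp f 2 (particleKernel a n t x) := ⟨hfm.aestronglyMeasurable, by
    by_contra hcon
    rw [not_lt, top_le_iff] at hcon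
    rw [hcon] at hx
    simp at hx⟩
  exact h2.integrable (by norm_num)

theorem nParticleSemigroup_sub {g : (Fin n → ℝ) → ℝ} (hfm : Measurable f)
    (hf : MemLp f 2 volume) (hgm : Measurable g) (hg : MemLp g 2 volume) :
    nParticleSemigroup a n t (f - g) =ᵐ[volume]
      nParticleSemigroup a n t f - nParticleSemigroup a n t g := by
  filter_upwards [memLp_two_integrable_particleKernel hfm hf,
    memLp_two_integrable_particleKernel hgm hg] with x h1 h2
  rw [nParticleSemigroup_eq_of_measurable (hfm.sub hgm), nParticleSemigroup_eq_of_measurable hfm,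
    nParticleSemigroup_eq_of_measurable hgm]
  exact integral_sub h1 h2

end Semigroup

/-! ### The semigroup commutes with symmetrization and marginals -/

section Commute

variable {a : ℝ} {k n : ℕ} {t : ℝ≥0} {f : (Fin n → ℝ) → ℝ}

/-- The individual noises are exchangeable and the common noise is symmetric in the particles. -/
theorem map_particleKernel_comp_perm (a : ℝ) (t : ℝ≥0) (x : Fin n → ℝ)
    (s : Equiv.Perm (Fin n)) :
    (particleKernel a n t x).map (fun y => y ∘ s) = particleKernel a n t (x ∘ s) := by
  have h : MeasurePreserving (Prod.map id fun y : Fin n → ℝ => y ∘ s)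
      ((gaussianReal 0 t).prod (Measure.pi fun _ : Fin n => gaussianReal 0 t))
      ((gaussianReal 0 t).prod (Measure.pi fun _ : Fin n => gaussianReal 0 t)) :=
    (MeasurePreserving.id _).prod (measurePreserving_pi_comp_perm _ s)
  rw [particleKernel, particleKernel, Measure.map_map (by fun_prop) (measurable_particleShift a x)]
  conv_rhs => rw [← h.map_eq, Measure.map_map (measurable_particleShift a _) h.measurable]
  rfl

theorem ae_symmetrization_nParticleSemigroup (hfm : Measurable f) (hf : Integrable f) :
    symmetrization (nParticleSemigroup a n t f) =ᵐ[volume]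
      nParticleSemigroup a n t (symmetrization f) := by
  have h : ∀ᵐ x : Fin n → ℝ, ∀ s : Equiv.Perm (Fin n),
      Integrable f (particleKernel a n t (x ∘ s)) := by
    rw [ae_all_iff]
    exact fun s => (measurePreserving_comp_perm s).quasiMeasurePreserving.ae
      (ae_integrable_particleKernel hf)
  filter_upwards [h] with x hx
  have hs : ∀ s : Equiv.Perm (Fin n), Measurable fun y : Fin n → ℝ => y ∘ s := fun s => by fun_prop
  have hx' : ∀ s : Equiv.Perm (Fin n), Integrable (fun y => f (y ∘ s))
      (particleKernel a n t x) := by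
    intro s
    have h1 := hx s
    rw [← map_particleKernel_comp_perm] at h1
    exact h1.comp_measurable (hs s)
  rw [nParticleSemigroup_eq_of_measurable hfm,
    nParticleSemigroup_eq_of_measurable (measurable_symmetrization hfm)]
  simp only [symmetrization]
  rw [integral_const_mul, integral_finsetSum _ fun s _ => hx' s]
  congr 1
  refine Finset.sum_congr rfl fun s _ => ?_
  rw [← map_particleKernel_comp_perm, integral_map (hs s).aemeasurable hfm.aestronglyMeasurable]

theorem map_castLE_gaussian (h : k ≤ n) (ν : Measure ℝ) [IsProbabilityMeasure ν] :
    MeasurePreserving (fun (y : Fin n → ℝ) (l : Fin k) => y (Fin.castLE h l))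
      (Measure.pi fun _ => ν) (Measure.pi fun _ => ν) := by
  refine ⟨by fun_prop, ?_⟩
  rw [← map_joinCoords h ν, Measure.map_map (by fun_prop) (measurable_joinCoords k)]
  have h1 : ((fun (y : Fin n → ℝ) (l : Fin k) => y (Fin.castLE h l)) ∘
      fun p : (Fin k → ℝ) × (Fin (n - k) → ℝ) => (joinCoords k p.1 p.2 : Fin n → ℝ))
      = Prod.fst := by
    funext p l
    simp [joinCoords]
  rw [h1]
  exact measurePreserving_fst.map_eq

/-- The common noise correlates the last particles with the first `k`, but for given noise it merely
translates them, which Lebesgue measure does not notice. What remains depends on the noise of the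
first `k` particles alone. -/
theorem lintegral_particleKernel_joinCoords (a : ℝ) (t : ℝ≥0) (h : k ≤ n)
    {G : (Fin n → ℝ) → ℝ≥0∞} (hG : Measurable G) (y : Fin k → ℝ) :
    ∫⁻ z : Fin (n - k) → ℝ, ∫⁻ u, G u ∂(particleKernel a n t (joinCoords k y z)) =
      ∫⁻ u, (∫⁻ z : Fin (n - k) → ℝ, G (joinCoords k u z)) ∂(particleKernel a k t y) := by
  have hJ := measurable_joinCoords (n := n) k
  have hH : Measurable fun u : Fin k → ℝ =>
      ∫⁻ z : Fin (n - k) → ℝ, G (joinCoords k u z) := by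
    exact (hG.comp hJ).lintegral_prod_right'
  have hP : MeasurePreserving
      (Prod.map id fun (y : Fin n → ℝ) (l : Fin k) => y (Fin.castLE h l))
      ((gaussianReal 0 t).prod (Measure.pi fun _ : Fin n => gaussianReal 0 t))
      ((gaussianReal 0 t).prod (Measure.pi fun _ : Fin k => gaussianReal 0 t)) :=
    (MeasurePreserving.id _).prod (map_castLE_gaussian h _)
  simp_rw [particleKernel]
  have h0 := hP.lintegral_comp (hH.comp (measurable_particleShift a y))
  simp only [Function.comp_apply] at h0
  rw [lintegral_map hH (measurable_particleShift a y), ← h0]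
  have h1 : ∀ z : Fin (n - k) → ℝ, ∫⁻ u, G u ∂(((gaussianReal 0 t).prod
      (Measure.pi fun _ : Fin n => gaussianReal 0 t)).map
        fun w l => √(1 - a) * w.2 l + √a * w.1 + joinCoords k y z l)
      = ∫⁻ w, G (fun l => √(1 - a) * w.2 l + √a * w.1 + joinCoords k y z l)
        ∂((gaussianReal 0 t).prod (Measure.pi fun _ : Fin n => gaussianReal 0 t)) :=
    fun z => lintegral_map hG (measurable_particleShift a _)
  simp_rw [h1]
  rw [lintegral_lintegral_swap]
  · refine lintegral_congr fun w => ?_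
    -- For fixed `w` the last coordinates are shifted by a vector that does not involve `z`.
    conv_rhs => rw [← lintegral_add_left_eq_self (μ := (volume : Measure (Fin (n - k) → ℝ))) _
      fun l => √(1 - a) * w.2 ⟨k + l.1, by omega⟩ + √a * w.1]
    refine lintegral_congr fun z => ?_
    congr 1
    funext l
    by_cases hl : l.1 < k
    · simp [joinCoords, hl]
    · have hl' : (⟨k + (l.1 - k), by omega⟩ : Fin n) = l := Fin.ext (by simp; omega)
      simp [joinCoords, hl, hl']
  · have h2 : Measurable fun p : (Fin (n - k) → ℝ) × (ℝ × (Fin n → ℝ)) =>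
        (fun l => √(1 - a) * p.2.2 l + √a * p.2.1 + joinCoords k y p.1 l : Fin n → ℝ) := by
      have h3 : Measurable fun p : (Fin (n - k) → ℝ) × (ℝ × (Fin n → ℝ)) =>
          (joinCoords k y p.1 : Fin n → ℝ) :=
        hJ.comp (measurable_const.prodMk measurable_fst)
      refine measurable_pi_lambda _ fun l => ?_
      have h4 := (measurable_pi_apply l).comp h3
      exact Measurable.add (by fun_prop) h4
    exact (hG.comp h2).aemeasurable

/-- The law obtained by letting particles at `y` and Lebesgue distributed further particles move. -/
theorem bind_particleKernel_joinCoords (a : ℝ) (t : ℝ≥0) (h : k ≤ n) (y : Fin k → ℝ) :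
    (volume : Measure (Fin (n - k) → ℝ)).bind
      (fun z => particleKernel a n t (joinCoords k y z)) =
    ((particleKernel a k t y).prod (volume : Measure (Fin (n - k) → ℝ))).map
      fun p => joinCoords k p.1 p.2 := by
  have hJ := measurable_joinCoords (n := n) k
  have hm : Measurable fun z : Fin (n - k) → ℝ => particleKernel a n t (joinCoords k y z) :=
    (measurable_particleKernel a n t).comp (hJ.comp (measurable_const.prodMk measurable_id))
  ext B hB
  have hG : Measurable (B.indicator (1 : (Fin n → ℝ) → ℝ≥0∞)) := measurable_one.indicator hB
  rw [← lintegral_indicator_one hB, ← lintegral_indicator_one hB,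
    Measure.lintegral_bind hm.aemeasurable hG.aemeasurable,
    lintegral_particleKernel_joinCoords a t h hG, lintegral_map hG hJ,
    lintegral_prod (fun p => B.indicator 1 (joinCoords k p.1 p.2)) (hG.comp hJ).aemeasurable]

/-- Consistency of the semigroups under marginals: additional Lebesgue distributed particles stay
Lebesgue distributed, irrespective of where the first `k` move. Exceptional null sets arise only
from integrability. -/
theorem ae_symMarginal_nParticleSemigroup (h : k ≤ n) (hfm : Measurable f) (hf : Integrable f) :
    symMarginal k (nParticleSemigroup a n t f) =ᵐ[volume]
      nParticleSemigroup a k t (symMarginal k f) := by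
  have hJ := measurable_joinCoords (n := n) k
  have hsm := measurable_symmetrization hfm
  have hs := integrable_symmetrization hf
  have h1 : ∀ᵐ y : Fin k → ℝ, ∀ᵐ z : Fin (n - k) → ℝ,
      symmetrization (nParticleSemigroup a n t f) (joinCoords k y z)
        = nParticleSemigroup a n t (symmetrization f) (joinCoords k y z) :=
    Measure.ae_ae_of_ae_prod ((measurePreserving_joinCoords h).quasiMeasurePreserving.ae
      (ae_symmetrization_nParticleSemigroup hfm hf))
  have h2 : ∀ᵐ y : Fin k → ℝ, ∫⁻ z : Fin (n - k) → ℝ, ∫⁻ u, ‖symmetrization f u‖ₑ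
      ∂(particleKernel a n t (joinCoords k y z)) < ∞ := by
    have hL : Measurable fun x => ∫⁻ u, ‖symmetrization f u‖ₑ ∂(particleKernel a n t x) :=
      (Measure.measurable_lintegral hsm.enorm).comp (measurable_particleKernel a n t)
    refine ae_lt_top ((hL.comp hJ).lintegral_prod_right') ?_
    have h3 := lintegral_prod (μ := (volume : Measure (Fin k → ℝ)))
      (ν := (volume : Measure (Fin (n - k) → ℝ))) _ (hL.comp hJ).aemeasurable
    simp only [Function.comp_apply] at h3
    rw [← h3, ← Measure.volume_eq_prod, (measurePreserving_joinCoords h).lintegral_comp hL,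
      ← Measure.lintegral_bind (measurable_particleKernel a n t).aemeasurable
        hsm.enorm.aemeasurable, volume_bind_particleKernel]
    exact hs.hasFiniteIntegral.ne
  filter_upwards [h1, h2] with y h1 h2
  have hm : Measurable fun z : Fin (n - k) → ℝ => particleKernel a n t (joinCoords k y z) :=
    (measurable_particleKernel a n t).comp (hJ.comp (measurable_const.prodMk measurable_id))
  have hi : Integrable (symmetrization f) ((volume : Measure (Fin (n - k) → ℝ)).bind
      fun z => particleKernel a n t (joinCoords k y z)) := by
    refine ⟨hsm.aestronglyMeasurable, ?_⟩
    rw [HasFiniteIntegral, Measure.lintegral_bind hm.aemeasurable hsm.enorm.aemeasurable]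
    exact h2
  rw [symMarginal, integral_congr_ae h1, nParticleSemigroup_eq_of_measurable hsm,
    ← integral_bind hm hi, nParticleSemigroup_eq_of_measurable (measurable_symMarginal hfm)]
  rw [bind_particleKernel_joinCoords a t h] at hi ⊢
  rw [integral_map hJ.aemeasurable hsm.aestronglyMeasurable,
    integral_prod (fun p => symmetrization f (joinCoords k p.1 p.2)) (hi.comp_measurable hJ)]
  rfl

end Commute

/-! ### The intertwining identity for integrable functions. -/

section Expectation

variable {a : ℝ} {Ω : Type*} [MeasurableSpace Ω] {η : ℝ≥0 → Ω → Config} {P : Config → Measure Ω}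
  {Ω₀ : Type*} [MeasurableSpace Ω₀] {Q : Measure Ω₀} [IsProbabilityMeasure Q] {ζ : Ω₀ → Config}
  {n : ℕ} {t : ℝ≥0} {f : (Fin n → ℝ) → ℝ}

/-- The intertwining of `I_n` with the semigroups for integrable functions. -/
theorem IsUnlabeledCorrelatedBM.ae_integral_wienerItoFormula
    (hη : IsUnlabeledCorrelatedBM a η P) (ha0 : 0 ≤ a) (ha1 : a ≤ 1)
    (hζ : Measurable ζ) (hπ : HasLebesgueFactorialMoments (Q.map ζ))
    (hfm : Measurable f) (hf : Integrable f) :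
    ∀ᵐ ω ∂Q, ∫ μ, wienerItoFormula n f μ ∂((P (ζ ω)).map (η t)) =
      wienerItoFormula n (nParticleSemigroup a n t f) (ζ ω) := by
  have := Measure.isProbabilityMeasure_map (μ := Q) hζ.aemeasurable
  have hk : ∀ k ∈ Finset.range (n + 1), k ≤ n := fun k hk =>
    Nat.lt_succ_iff.1 (Finset.mem_range.1 hk)
  have hcomm : ∀ k ∈ Finset.range (n + 1), ∀ᵐ ω ∂Q, ∀ᵐ y ∂(factorialKernel k (ζ ω)),
      symMarginal k (nParticleSemigroup a n t f) y
        = nParticleSemigroup a k t (symMarginal k f) y := fun k h =>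
    ae_of_ae_map hζ.aemeasurable
      (hπ.ae_ae (ae_symMarginal_nParticleSemigroup (a := a) (t := t) (hk k h) hfm hf))
  have hint : ∀ k ∈ Finset.range (n + 1), ∀ᵐ ω ∂Q, Integrable (symMarginal k f)
      ((factorialKernel k (ζ ω)).bind (particleKernel a k t)) := by
    intro k h
    refine ae_integrable_of_integrable_bind
      ((measurable_factorialKernel_bind_particleKernel a t k).comp hζ) ?_
    have := bind_factorialKernel_bind_particleKernel a t hζ hπ k
    rw [this]
    exact integrable_symMarginal (hk k h) hf
  have hform := ae_of_ae_map hζ.aemeasurable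
    (hπ.ae_wienerItoFormula_eq (nParticleSemigroup a n t f))
  filter_upwards [(Filter.eventually_all_finset _).2 hcomm,
    (Filter.eventually_all_finset _).2 hint, hform,
    hη.ae_ae_mem_locallyFiniteConfig ha0 ha1 t hζ hπ,
    ae_all_iff.2 fun k => hη.ae_map_bind_factorialKernel ha0 ha1 t hζ hπ k]
    with ω hcomm hint hform hLF hbind
  have hLF' : ∀ᵐ μ ∂((P (ζ ω)).map (η t)), μ ∈ locallyFiniteConfig :=
    (ae_map_iff (p := fun ν => ν ∈ locallyFiniteConfig)
      (hη.markovFamily.measurable t).aemeasurable measurableSet_locallyFiniteConfig).2 hLF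
  have h1 : wienerItoFormula n f =ᵐ[(P (ζ ω)).map (η t)] fun μ => ∑ k ∈ Finset.range (n + 1),
      (n.choose k : ℝ) * (-1) ^ (n - k) * ∫ x, symMarginal k f x ∂(factorialKernel k μ) := by
    filter_upwards [hLF'] with μ hμ
    rw [wienerItoFormula_eq]
    simp_rw [factorialKernel_of_mem hμ]
  rw [integral_congr_ae h1, hform, integral_finsetSum]
  · refine Finset.sum_congr rfl fun k h => ?_
    rw [integral_const_mul]
    congr 1
    have h2 := hint k h
    -- Both sides are the integral of `symMarginal k f` against the `k`-th factorial measure of `ζ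
    -- ω` transported by the `k`-particle kernel.
    rw [integral_congr_ae (hcomm k h),
      nParticleSemigroup_eq_of_measurable (measurable_symMarginal hfm),
      ← integral_bind (measurable_particleKernel a k t) h2, ← hbind k,
      integral_bind (measurable_factorialKernel k)]
    rwa [hbind k]
  · intro k h
    refine (integrable_integral_bind (measurable_factorialKernel k) ?_).const_mul _
    rw [hbind k]
    exact hint k h

end Expectation

/-! ### Passage to square integrable functions -/

theorem eLpNorm_one_sub_le_opNorm {n : ℕ} {π : Measure Config} [IsProbabilityMeasure π]
    (I : Lp ℝ 2 (volume : Measure (Fin n → ℝ)) →L[ℝ] Lp ℝ 2 π) {f f' : (Fin n → ℝ) → ℝ}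
    (hf : MemLp f 2 volume) (hf' : MemLp f' 2 volume) {g g' : Config → ℝ}
    (hg : g =ᵐ[π] I (hf.toLp f)) (hg' : g' =ᵐ[π] I (hf'.toLp f')) :
    eLpNorm (g - g') 1 π ≤ ‖I‖ₑ * eLpNorm (f - f') 2 volume := by
  have h1 : g - g' =ᵐ[π] I ((hf.sub hf').toLp (f - f')) := by
    rw [MemLp.toLp_sub hf hf', map_sub]
    exact (hg.sub hg').trans (Lp.coeFn_sub _ _).symm
  rw [eLpNorm_congr_ae h1, ← Lp.enorm_toLp (hf := hf.sub hf')]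
  refine (eLpNorm_le_eLpNorm_of_exponent_le (one_le_two : (1 : ℝ≥0∞) ≤ 2)
    (Lp.aestronglyMeasurable _)).trans ?_
  rw [← Lp.enorm_def]
  exact I.le_opENorm _

section L2

variable {a : ℝ} {Ω : Type*} [MeasurableSpace Ω] {η : ℝ≥0 → Ω → Config} {P : Config → Measure Ω}
  {Ω₀ : Type*} [MeasurableSpace Ω₀] {Q : Measure Ω₀} {ζ : Ω₀ → Config}
  {n : ℕ} {t : ℝ≥0} {f : (Fin n → ℝ) → ℝ}

/-- Conditional averaging contracts `L¹`. With `κ ω` the law of `η t` started from `ζ ω`, the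
mixture `Q.bind κ` is again the Poisson law, which is where invariance enters. -/
theorem eLpNorm_one_integral_sub_le {κ : Ω₀ → Measure Config} (hκ : Measurable κ)
    {g g' : Config → ℝ} (hg : Integrable g (Q.bind κ)) (hg' : Integrable g' (Q.bind κ)) :
    eLpNorm ((fun ω => ∫ μ, g μ ∂(κ ω)) - fun ω => ∫ μ, g' μ ∂(κ ω)) 1 Q ≤
      eLpNorm (g - g') 1 (Q.bind κ) := by
  rw [eLpNorm_one_eq_lintegral_enorm, eLpNorm_one_eq_lintegral_enorm,
    Measure.lintegral_bind hκ.aemeasurable (hg.sub hg').aestronglyMeasurable.enorm]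
  refine lintegral_mono_ae ?_
  filter_upwards [ae_integrable_of_integrable_bind hκ hg,
    ae_integrable_of_integrable_bind hκ hg'] with ω h1 h2
  rw [Pi.sub_apply, ← integral_sub h1 h2]
  exact enorm_integral_le_lintegral_enorm _

/-- For truncations of `f` the identity holds between explicit formulas. Both sides depend
continuously, into `L¹` of `Q`, on `f` in `L²`. -/
theorem IsUnlabeledCorrelatedBM.ae_integral_multipleWienerIto_of_measurable
    [IsProbabilityMeasure Q] (hη : IsUnlabeledCorrelatedBM a η P) (ha0 : 0 ≤ a) (ha1 : a ≤ 1)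
    (hζ : IsPoissonProcess ζ volume Q) (hζ' : IsProper ζ) (hfm : Measurable f)
    (hf : MemLp f 2 volume) (hPf : MemLp (nParticleSemigroup a n t f) 2 volume)
    {g g' : Config → ℝ} (hg : g =ᵐ[Q.map ζ] multipleWienerIto (Q.map ζ) n (hf.toLp f))
    (hg' : g' =ᵐ[Q.map ζ] multipleWienerIto (Q.map ζ) n
      (hPf.toLp (nParticleSemigroup a n t f))) :
    ∀ᵐ ω ∂Q, Integrable (fun ω' => g (η t ω')) (P (ζ ω)) ∧
      ∫ ω', g (η t ω') ∂(P (ζ ω)) = g' (ζ ω) := by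
  have := hζ.isProbabilityMeasure_map
  have hπ := hζ.hasLebesgueFactorialMoments
  have hκ := hη.markovFamily.measurable_map_comp hζ' t
  have hb := hη.bind_map_eq ha0 ha1 t hζ.measurable hζ' hπ
  have hηt := hη.markovFamily.measurable t
  set I := multipleWienerIto (Q.map ζ) n with hI
  have hgi : Integrable g (Q.map ζ) :=
    (MemLp.ae_eq hg.symm (Lp.memLp _)).integrable (by norm_num)
  have hgi' : Integrable g' (Q.map ζ) :=
    (MemLp.ae_eq hg'.symm (Lp.memLp _)).integrable (by norm_num)
  have ht := isTestFunction_truncate hfm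
  have hPm : ∀ j, Measurable (nParticleSemigroup a n t (truncate f j)) := fun j =>
    measurable_nParticleSemigroup (ht j).measurable
  have hP1 : ∀ j, Integrable (nParticleSemigroup a n t (truncate f j)) := fun j =>
    integrable_nParticleSemigroup (ht j).measurable (ht j).integrable
  have hP2 : ∀ j, MemLp (nParticleSemigroup a n t (truncate f j)) 2 volume := fun j =>
    memLp_nParticleSemigroup (ht j).measurable (ht j).memLp
  -- The two summands come from inserting the averaged formula for the truncation. The first
  -- replaces `g` by that formula and uses invariance; the second uses the identity for integrable
  -- functions, boundedness of `I` and contractivity of the semigroup.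
  have hbound : ∀ j, eLpNorm ((fun ω => ∫ μ, g μ ∂((P (ζ ω)).map (η t))) - g' ∘ ζ) 1 Q ≤
      ‖I‖ₑ * eLpNorm (truncate f j - f) 2 volume
        + ‖I‖ₑ * eLpNorm (truncate f j - f) 2 volume := by
    intro j
    have hG := hζ.extendsWienerIto_multipleWienerIto n _ (ht j)
    have hGi : Integrable (wienerItoFormula n (truncate f j)) (Q.map ζ) :=
      (MemLp.ae_eq hG (Lp.memLp _)).integrable (by norm_num)
    have hH := hζ.multipleWienerIto_toLp (hPm j) (hP1 j) (hP2 j)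
    have hHi : Integrable (wienerItoFormula n (nParticleSemigroup a n t (truncate f j)))
        (Q.map ζ) := (MemLp.ae_eq hH (Lp.memLp _)).integrable (by norm_num)
    have hgb : Integrable g (Q.bind fun ω => (P (ζ ω)).map (η t)) := by rwa [hb]
    have hGb : Integrable (wienerItoFormula n (truncate f j))
        (Q.bind fun ω => (P (ζ ω)).map (η t)) := by rwa [hb]
    have h1 : eLpNorm ((fun ω => ∫ μ, g μ ∂((P (ζ ω)).map (η t))) -
        fun ω => ∫ μ, wienerItoFormula n (truncate f j) μ ∂((P (ζ ω)).map (η t))) 1 Q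
        ≤ ‖I‖ₑ * eLpNorm (truncate f j - f) 2 volume := by
      refine (eLpNorm_one_integral_sub_le hκ hgb hGb).trans ?_
      rw [hb, eLpNorm_sub_comm, eLpNorm_sub_comm (truncate f j) f, eLpNorm_sub_comm f]
      exact eLpNorm_one_sub_le_opNorm I (ht j).memLp hf hG.symm hg
    have h2 : eLpNorm ((fun ω => ∫ μ, wienerItoFormula n (truncate f j) μ
        ∂((P (ζ ω)).map (η t))) - g' ∘ ζ) 1 Q
        ≤ ‖I‖ₑ * eLpNorm (truncate f j - f) 2 volume := by
      have h3 : (fun ω => ∫ μ, wienerItoFormula n (truncate f j) μ ∂((P (ζ ω)).map (η t)))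
          - g' ∘ ζ =ᵐ[Q]
          (wienerItoFormula n (nParticleSemigroup a n t (truncate f j)) - g') ∘ ζ := by
        filter_upwards [hη.ae_integral_wienerItoFormula (t := t) ha0 ha1 hζ.measurable hπ
          (ht j).measurable (ht j).integrable] with ω hω
        rw [Pi.sub_apply, hω]
        rfl
      rw [eLpNorm_congr_ae h3, ← eLpNorm_map_measure (hHi.sub hgi').aestronglyMeasurable
        hζ.measurable.aemeasurable]
      refine (eLpNorm_one_sub_le_opNorm I (hP2 j) hPf hH.symm hg').trans ?_
      gcongr
      rw [← eLpNorm_congr_ae (nParticleSemigroup_sub (ht j).measurable (ht j).memLp hfm hf)]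
      exact eLpNorm_two_nParticleSemigroup_le ((ht j).measurable.sub hfm)
    have hs := (integrable_integral_bind hκ hgb).aestronglyMeasurable
    have hs' := (integrable_integral_bind hκ hGb).aestronglyMeasurable
    have hs'' : AEStronglyMeasurable (g' ∘ ζ) Q :=
      hgi'.aestronglyMeasurable.comp_measurable hζ.measurable
    rw [← sub_add_sub_cancel _ (fun ω => ∫ μ, wienerItoFormula n (truncate f j) μ
        ∂((P (ζ ω)).map (η t)))]
    exact (eLpNorm_add_le (hs.sub hs') (hs'.sub hs'') le_rfl).trans (add_le_add h1 h2)
  have hgb : Integrable g (Q.bind fun ω => (P (ζ ω)).map (η t)) := by rwa [hb]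
  have hzero : eLpNorm ((fun ω => ∫ μ, g μ ∂((P (ζ ω)).map (η t))) - g' ∘ ζ) 1 Q = 0 := by
    have hlim := ENNReal.Tendsto.const_mul (a := ‖I‖ₑ)
      (tendsto_eLpNorm_truncate hfm two_ne_zero (by simp) hf) (Or.inr enorm_ne_top)
    have hlim2 := hlim.add hlim
    simp only [mul_zero, add_zero] at hlim2
    exact le_antisymm (ge_of_tendsto' hlim2 hbound) (zero_le)
  have hae := (eLpNorm_eq_zero_iff ((integrable_integral_bind hκ hgb).aestronglyMeasurable.sub
    (hgi'.aestronglyMeasurable.comp_measurable hζ.measurable)) one_ne_zero).1 hzero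
  filter_upwards [hae, ae_integrable_of_integrable_bind hκ hgb] with ω h1 h2
  refine ⟨h2.comp_measurable hηt, ?_⟩
  rw [← integral_map hηt.aemeasurable h2.aestronglyMeasurable]
  exact sub_eq_zero.1 h1

end L2

end CorrelatedBM

/-! ### The main theorem. -/

theorem mainTheorem3 (a : ℝ) (ha0 : 0 ≤ a) (ha1 : a ≤ 1)
    {Ω : Type*} [MeasurableSpace Ω] (η : ℝ≥0 → Ω → CorrelatedBM.Config)
    (P : CorrelatedBM.Config → Measure Ω)
    (hη : CorrelatedBM.IsUnlabeledCorrelatedBM a η P)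
    {Ω₀ : Type*} [MeasurableSpace Ω₀] (Q : Measure Ω₀) [IsProbabilityMeasure Q]
    (ζ : Ω₀ → CorrelatedBM.Config) (hζ : CorrelatedBM.IsPoissonProcess ζ volume Q)
    (hζ_proper : CorrelatedBM.IsProper ζ) (n : ℕ) :
    (∃! I, CorrelatedBM.ExtendsWienerIto (Q.map ζ) n I) ∧
    ∀ (t : ℝ≥0) (f : (Fin n → ℝ) → ℝ) (hf : MemLp f 2 volume),
      ∃ hPf : MemLp (CorrelatedBM.nParticleSemigroup a n t f) 2 volume,
        ∀ g g' : CorrelatedBM.Config → ℝ,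
          g =ᵐ[Q.map ζ] CorrelatedBM.multipleWienerIto (Q.map ζ) n (hf.toLp f) →
          g' =ᵐ[Q.map ζ] CorrelatedBM.multipleWienerIto (Q.map ζ) n
            (hPf.toLp (CorrelatedBM.nParticleSemigroup a n t f)) →
          ∀ᵐ ω ∂Q, Integrable (fun ω' => g (η t ω')) (P (ζ ω)) ∧
            ∫ ω', g (η t ω') ∂(P (ζ ω)) = g' (ζ ω) := by
  refine ⟨hζ.existsUnique_extendsWienerIto n, fun t f hf => ?_⟩
  -- `nParticleSemigroup` acts on functions rather than classes, so `f` is exchanged for a Borel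
  -- representative; the images under the semigroup then agree almost everywhere, and `I_n` sees
  -- only the classes.
  have hfm : Measurable (hf.1.mk f) := hf.1.stronglyMeasurable_mk.measurable
  have hf0 : MemLp (hf.1.mk f) 2 volume := hf.ae_eq hf.1.ae_eq_mk
  have hPf0 := CorrelatedBM.memLp_nParticleSemigroup (a := a) (t := t) hfm hf0
  have hcongr := CorrelatedBM.nParticleSemigroup_congr (a := a) (t := t) hf.1 hf.1.ae_eq_mk
  have hPf := hPf0.ae_eq hcongr.symm
  refine ⟨hPf, fun g g' hg hg' => ?_⟩
  rw [(MemLp.toLp_eq_toLp_iff hf hf0).2 hf.1.ae_eq_mk] at hg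
  rw [(MemLp.toLp_eq_toLp_iff hPf hPf0).2 hcongr] at hg'
  exact hη.ae_integral_multipleWienerIto_of_measurable ha0 ha1 hζ hζ_proper hfm hf0 hPf0 hg hg'
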